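/- Let $m\ge 1$ be an integer, $0<\alpha<2$, $t=m+\alpha/2$, $n>2m$ and $p>1$. Let $\mathbb R^n_+=\{x\in\mathbb R^n : x_n>0\}$ and let $x^*=(x_1,\dots,x_{n-1},-x_n)$. Let $$G^+_{2t}(x,y)=\int_{\mathbb R^n_+}G^+_{2m}(x,z)\,G^+_{\alpha}(z,y)\,dz ,\qquad x,y\in\mathbb R^n_+ ,$$ where $$G^+_{2m}(x,z)=\frac{\Gamma(\frac n2-m)}{4^m\pi^{n/2}\Gamma(m)}\Big(\frac1{|x-z|^{n-2m}}-\frac1{|x^*-z|^{n-2m}}\Big)$$ is the Green's function of $(-\Delta)^m$ in $\mathbb R^n_+$ with Navier boundary conditions, and $$G^+_{\alpha}(z,y)=\frac{\Gamma(\frac n2)}{2^\alpha\pi^{n/2}\Gamma(\frac\alpha2)^2}\,\frac1{|z-y|^{n-\alpha}}\int_0^{4z_ny_n/|z-y|^2}\frac{b^{\alpha/2-1}}{(1+b)^{n/2}}\,db$$ is the Green's function of $(-\Delta)^{\alpha/2}$ in $\mathbb R^n_+$ with zero exterior condition. Let $u:\mathbb R^n\to\mathbb R$ be nonnegative on $\mathbb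 R^n_+$ and such that - $u\in C^{2m,1}_{loc}(\mathbb R^n_+)$, i.e. $u$ is $2m$ times continuously differentiable in $\mathbb R^n_+$ and its derivatives of order $2m$ are locally Lipschitz there; - $u\in L_{2t}$, i.e. $u$ is measurable and $\int_{\mathbb R^n}\frac{|u(x)|}{1+|x|^{n+2t}}\,dx<\infty$; - $u\in L^{n(p-1)/(2t)}(\mathbb R^n_+)$; - $(-\Delta)^m u\ge 0$ in $\mathbb R^n_+$. If $$u(x)=\int_{\mathbb R^n_+}G^+_{2t}(x,y)\,u^p(y)\,dy\qquad\text{for all }x\in\mathbb R^n_+ ,$$ then $u\equiv 0$ in $\mathbb R^n_+$. -/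

import Mathlib

open MeasureTheory Set
open scoped ENNReal Laplacian

noncomputable section

namespace HalfSpace

/-- The upper half-space `ℝⁿ₊ = {x ∈ ℝⁿ | xₙ > 0}`, where `n = d + 1`. -/
def upper (d : ℕ) : Set (EuclideanSpace ℝ (Fin (d + 1))) :=
  {x | 0 < x (Fin.last d)}

/-- The reflection `x* = (x₁, …, xₙ₋₁, -xₙ)` of `x` in the boundary of the half-space. -/
def reflect {d : ℕ} (x : EuclideanSpace ℝ (Fin (d + 1))) : EuclideanSpace ℝ (Fin (d + 1)) :=
  WithLp.toLp 2 (fun i => if i = Fin.last d then -x i else x i)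

/-- Green's function of `(-Δ)ᵐ` in the half-space (`n = d + 1 > 2m`, `m ≥ 1`) under the Navier
conditions `u = Δu = ⋯ = Δᵐ⁻¹u = 0` on the boundary:
`c (|x - y|^(2m-n) - |x* - y|^(2m-n))`, where `c |x|^(2m-n)` is the
fundamental solution of `(-Δ)ᵐ` in `ℝⁿ`. -/
def greenPoly {d : ℕ} (m : ℕ) (x y : EuclideanSpace ℝ (Fin (d + 1))) : ℝ :=
  Real.Gamma (((d + 1 : ℕ) : ℝ) / 2 - m) /
      (4 ^ m * Real.pi ^ (((d + 1 : ℕ) : ℝ) / 2) * Real.Gamma m) *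
    (‖x - y‖ ^ (2 * (m : ℝ) - ((d + 1 : ℕ) : ℝ)) -
      ‖reflect x - y‖ ^ (2 * (m : ℝ) - ((d + 1 : ℕ) : ℝ)))

/-- Green's function of the fractional Laplacian `(-Δ)^(α/2)`, `0 < α < 2`, in the half-space with
zero exterior condition. With `s = |x - y|²`, `t = 4 xₙ yₙ` and `n = d + 1` it is
`κ s^(-(n-α)/2) ∫₀^{t/s} b^(α/2-1) (1+b)^(-n/2) db`,
`κ = Γ(n/2) / (2^α π^(n/2) Γ(α/2)²)`. The same function is often written as
`A s^(-(n-α)/2) [1 - B (s+t)^(-(n-2)/2) ∫₀^{s/t} (s-tb)^((n-2)/2) b^(-α/2) (1+b)⁻¹ db]` with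
`A = Γ((n-α)/2) / (2^α π^(n/2) Γ(α/2))` and `B = sin(πα/2)/π`. -/
def greenFrac {d : ℕ} (α : ℝ) (x y : EuclideanSpace ℝ (Fin (d + 1))) : ℝ :=
  Real.Gamma (((d + 1 : ℕ) : ℝ) / 2) /
      (2 ^ α * Real.pi ^ (((d + 1 : ℕ) : ℝ) / 2) * Real.Gamma (α / 2) ^ 2) *
    ‖x - y‖ ^ (α - ((d + 1 : ℕ) : ℝ)) *
    ∫ b in (0 : ℝ)..(4 * x (Fin.last d) * y (Fin.last d) / ‖x - y‖ ^ 2),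
      b ^ (α / 2 - 1) / (1 + b) ^ (((d + 1 : ℕ) : ℝ) / 2)

/-- Green's function `G⁺_{2t}` of `(-Δ)ᵗ = (-Δ)^(α/2) ∘ (-Δ)ᵐ`, `t = m + α/2`, in the half-space:
`G⁺_{2t}(x, y) = ∫ G⁺_{2m}(x, z) G⁺_α(z, y) dz` over `z` in the half-space. Off the diagonals both
factors are positive, so the integral is taken with values in `[0, ∞]`. -/
def green {d : ℕ} (m : ℕ) (α : ℝ) (x y : EuclideanSpace ℝ (Fin (d + 1))) : ℝ≥0∞ :=
  ∫⁻ z in upper d, ENNReal.ofReal (greenPoly m x z) * ENNReal.ofReal (greenFrac α z y)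

/-- `C^{k,1}_loc` on an open set `Ω`: `u` is `k` times continuously differentiable in `Ω` and its
`k`-th derivatives are locally Lipschitz in `Ω`. -/
def IsLocC1 {d : ℕ} (k : ℕ) (u : EuclideanSpace ℝ (Fin (d + 1)) → ℝ)
    (Ω : Set (EuclideanSpace ℝ (Fin (d + 1)))) : Prop :=
  ContDiffOn ℝ k u Ω ∧ LocallyLipschitzOn Ω (iteratedFDeriv ℝ k u)

/-- The weighted space `L_{2t}`: measurable `u : ℝⁿ → ℝ` with `∫ |u(x)| / (1 + |x|^(n+2t)) dx < ∞`,
where `n = d + 1` and `r = 2t`. -/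
def MemWeightedL {d : ℕ} (r : ℝ) (u : EuclideanSpace ℝ (Fin (d + 1)) → ℝ) : Prop :=
  AEStronglyMeasurable u volume ∧
    Integrable (fun x => |u x| / (1 + ‖x‖ ^ (((d + 1 : ℕ) : ℝ) + r))) volume

/-- The classical polyharmonic operator `(-Δ)ᵐ`. -/
def negLaplacianPow {d : ℕ} (m : ℕ) (u : EuclideanSpace ℝ (Fin (d + 1)) → ℝ) :
    EuclideanSpace ℝ (Fin (d + 1)) → ℝ :=
  (fun f => -(Δ f))^[m] u

end HalfSpace

end

/-! Both Green functions are constant multiples of one kernel P(s, τ) = ∫₀^τ c^(a-1) (s+c)^(-b) dc,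
taken at s = |x-y|² and τ = 4xₙyₙ: (a, b) = (1, n/2-m+1) in the Navier case and (α/2, n/2) in the
fractional case (`ofReal_greenPoly`, `ofReal_greenFrac`). By Tonelli, u extended by zero solves U =
C K₁K₂U^p (`isPotSol_indicator`). The argument runs on this equation, the continuity of U in the
half-space, and U ∈ L^s with s = n(p-1)/T, T = 2t.

The engine is the method of moving planes in integral form. Since P decreases in s and increases in
τ, the kernel satisfies a four-point inequality under reflection in xₙ = l
(`kern_reflectAt_add_le`). Hence the positive part of U - U∘(reflection) in the strip 0 < xₙ < l is
dominated by C p K₁K₂(U^(p-1)·gap) (`gap_le`). A Hardy–Littlewood–Sobolev estimate in Marcinkiewicz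
spaces forces the gap to vanish as soon as U^(p-1) is small on its support
(`exists_ae_eq_zero_of_le_pot_pot`). Starting from the empty strip, the planes move to infinity, so
a nonzero U is nondecreasing in xₙ, which contradicts U ∈ L^s (`eq_zero_of_weighted`).

The estimate needs 1/s + θ/n < 1, where θ is the total order of the two potentials. Without weights
θ = T, which works exactly for p(n-T) > n. For the other p one uses that K₂ vanishes on the
boundary: a weight yₙ^φ with φ ≤ α/2 can be extracted, and the order drops to T - φ
(`exists_kern_le_weighted`). Take φ = α/2. If 1/s + (T-α/2)/n ≥ 1, a nontrivial U is at least a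
multiple of R^(T-α/2-n) on a ball of radius R/4 about R·eₙ, which is too large for L^s
(`eq_zero_of_le`). If it is < 1, moving planes apply once yₙ^φ U^(p-1) is known to be in L^(n/θ);
this follows from U ∈ L^s and the scale-invariant interior bound xₙ^T U^(p-1) ≤ K (`exists_bound`),
proved by a doubling argument and a Harnack inequality. `eq_zero` assembles the cases. -/

namespace HalfSpace

/-! ### Potential estimates in Marcinkiewicz form, ∫_E g ≤ A|E|^a for every E -/

section Riesz

variable {X : Type*} [MeasurableSpace X] {μ : Measure X}

/-- Weighted layer-cake formula. -/
lemma lintegral_mul_eq_lintegral_setLIntegral_lt {g φ : X → ℝ≥0∞} (hg : Measurable g)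
    (hφ : Measurable φ) (hfin : ∀ x, φ x ≠ ∞) :
    ∫⁻ x, g x * φ x ∂μ = ∫⁻ τ in Ioi (0 : ℝ), ∫⁻ x in {x | ENNReal.ofReal τ < φ x}, g x ∂μ := by
  have h1 : ∫⁻ x, g x * φ x ∂μ
      = ∫⁻ x, ENNReal.ofReal (φ x).toReal ∂(μ.withDensity g) := by
    rw [lintegral_withDensity_eq_lintegral_mul _ hg (by fun_prop)]
    simp [ENNReal.ofReal_toReal (hfin _)]
  rw [h1, lintegral_eq_lintegral_meas_lt _ (Filter.Eventually.of_forall fun x => by simp)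
    (by fun_prop)]
  refine setLIntegral_congr_fun measurableSet_Ioi fun τ hτ => ?_
  have h2 : {a | τ < (φ a).toReal} = {x | ENNReal.ofReal τ < φ x} := by
    ext x
    exact (ENNReal.ofReal_lt_iff_lt_toReal (le_of_lt hτ) (hfin x)).symm
  simp only [h2]
  rw [withDensity_apply _ (measurableSet_lt measurable_const hφ)]

lemma lintegral_Ioc_rpow_neg {e Λ : ℝ} (he : e < 1) (hΛ : 0 < Λ) :
    ∫⁻ τ in Ioc 0 Λ, ENNReal.ofReal (τ ^ (-e)) = ENNReal.ofReal (Λ ^ (1 - e) / (1 - e)) := by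
  have hint : IntervalIntegrable (fun τ : ℝ => τ ^ (-e)) volume 0 Λ :=
    intervalIntegral.intervalIntegrable_rpow' (by linarith)
  rw [← ofReal_integral_eq_lintegral_ofReal]
  · rw [← intervalIntegral.integral_of_le hΛ.le, integral_rpow (Or.inl (by linarith)),
      Real.zero_rpow (by linarith)]
    congr 2 <;> ring_nf
  · exact (intervalIntegrable_iff_integrableOn_Ioc_of_le hΛ.le).1 hint
  · filter_upwards [ae_restrict_mem measurableSet_Ioc] with τ hτ
    exact Real.rpow_nonneg hτ.1.le _

lemma lintegral_Ioi_rpow_neg {e Λ : ℝ} (he : 1 < e) (hΛ : 0 < Λ) :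
    ∫⁻ τ in Ioi Λ, ENNReal.ofReal (τ ^ (-e)) = ENNReal.ofReal (Λ ^ (1 - e) / (e - 1)) := by
  rw [← ofReal_integral_eq_lintegral_ofReal]
  · rw [integral_Ioi_rpow_of_lt (by linarith) hΛ]
    congr 1
    rw [← neg_div_neg_eq, neg_neg]
    congr 2 <;> ring_nf
  · exact integrableOn_Ioi_rpow_of_lt (by linarith) hΛ
  · filter_upwards [ae_restrict_mem measurableSet_Ioi] with τ hτ
    exact Real.rpow_nonneg (hΛ.trans hτ).le _

/-- If a symmetric kernel satisfies `∫_E k(x, y) dy ≤ C₀ |E|^γ`, then the superlevel sets of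
`∫_E k(·, y) dy` satisfy a weak type estimate. -/
lemma measure_superlevel_le [SigmaFinite μ] {k : X → X → ℝ≥0∞}
    (hkm : Measurable (Function.uncurry k)) (hks : ∀ x y, k x y = k y x)
    {C₀ : ℝ≥0∞} {γ : ℝ} (hγ1 : γ < 1)
    (hk : ∀ x E, MeasurableSet E → ∫⁻ y in E, k x y ∂μ ≤ C₀ * μ E ^ γ)
    {E : Set X} {τ : ℝ≥0∞} :
    τ * μ {x | τ < ∫⁻ y in E, k x y ∂μ} ^ (1 - γ) ≤ C₀ * μ E := by
  have hφ : Measurable fun x => ∫⁻ y in E, k x y ∂μ := hkm.lintegral_prod_right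
  set F := {x | τ < ∫⁻ y in E, k x y ∂μ} with hF
  have hFm : MeasurableSet F := measurableSet_lt measurable_const hφ
  -- On a piece G of finite measure, integrating over G and swapping gives τ|G| ≤ C₀|E||G|^γ, and
  -- |G|^γ may be cancelled; the pieces then increase to F.
  have key : ∀ i, τ * μ (F ∩ spanningSets μ i) ^ (1 - γ) ≤ C₀ * μ E := by
    intro i
    set G := F ∩ spanningSets μ i
    have hGm : MeasurableSet G := hFm.inter (measurableSet_spanningSets μ i)
    have hGfin : μ G ≠ ∞ :=
      ((measure_mono inter_subset_right).trans_lt (measure_spanningSets_lt_top μ i)).ne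
    rcases eq_or_ne (μ G) 0 with h0 | h0
    · rw [h0, ENNReal.zero_rpow_of_pos (by linarith)]; simp
    have h1 : τ * μ G ≤ C₀ * μ E * μ G ^ γ := by
      calc τ * μ G = ∫⁻ _ in G, τ ∂μ := by simp
        _ ≤ ∫⁻ x in G, ∫⁻ y in E, k x y ∂μ ∂μ :=
            setLIntegral_mono hφ fun x hx => hx.1.le
        _ = ∫⁻ y in E, ∫⁻ x in G, k x y ∂μ ∂μ :=
            lintegral_lintegral_swap hkm.aemeasurable
        _ ≤ ∫⁻ _ in E, C₀ * μ G ^ γ ∂μ := by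
            refine lintegral_mono fun y => ?_
            simp_rw [fun x => hks x y]
            exact hk y G hGm
        _ = C₀ * μ E * μ G ^ γ := by simp; ring
    have h2 : μ G = μ G ^ (1 - γ) * μ G ^ γ := by
      rw [← ENNReal.rpow_add _ _ h0 hGfin]; simp
    have h3 : μ G ^ γ ≠ 0 := by
      simp [ENNReal.rpow_eq_zero_iff, h0, hGfin]
    have h4 : μ G ^ γ ≠ ∞ := by
      simp [ENNReal.rpow_eq_top_iff, h0, hGfin]
    have h5 : τ * μ G ^ (1 - γ) * μ G ^ γ ≤ C₀ * μ E * μ G ^ γ := by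
      rwa [mul_assoc, ← h2]
    exact (ENNReal.mul_le_mul_iff_left h3 h4).1 h5
  have hlim : Filter.Tendsto (fun i => τ * μ (F ∩ spanningSets μ i) ^ (1 - γ)) Filter.atTop
      (nhds (τ * μ F ^ (1 - γ))) := by
    have h := tendsto_measure_iUnion_atTop (μ := μ) (s := fun i => F ∩ spanningSets μ i)
      (fun i j hij => inter_subset_inter_right _ (monotone_spanningSets μ hij))
    rw [← inter_iUnion, iUnion_spanningSets, inter_univ] at h
    by_cases hτ : τ = ∞
    · have : F = ∅ := by ext x; simp [hF, hτ]
      simp [this, ENNReal.zero_rpow_of_pos (show 0 < 1 - γ by linarith)]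
    exact ENNReal.Tendsto.const_mul ((ENNReal.continuous_rpow_const.tendsto _).comp h)
      (Or.inr hτ)
  exact le_of_tendsto' hlim key

/-- Hardy–Littlewood–Sobolev inequality between Marcinkiewicz spaces, in dual form. -/
lemma lintegral_mul_potential_le [SigmaFinite μ] {k : X → X → ℝ≥0∞}
    (hkm : Measurable (Function.uncurry k)) (hks : ∀ x y, k x y = k y x)
    {C₀ : ℝ≥0∞} (hC₀ : C₀ ≠ ∞) (hC₀' : C₀ ≠ 0) {γ a : ℝ} (hγ0 : 0 < γ) (ha0 : 0 < a)
    (haγ : a + γ < 1)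
    (hk : ∀ x E, MeasurableSet E → ∫⁻ y in E, k x y ∂μ ≤ C₀ * μ E ^ γ)
    {g : X → ℝ≥0∞} (hg : Measurable g) {A : ℝ≥0∞}
    (hgA : ∀ E, MeasurableSet E → ∫⁻ x in E, g x ∂μ ≤ A * μ E ^ a)
    {E : Set X} (hE : MeasurableSet E) (hEfin : μ E ≠ ∞) :
    ∫⁻ x, g x * ∫⁻ y in E, k x y ∂μ ∂μ
      ≤ C₀ * ENNReal.ofReal (1 / (1 - a / (1 - γ))) * A * μ E ^ (a + γ) := by
  have hφ : Measurable fun x => ∫⁻ y in E, k x y ∂μ := hkm.lintegral_prod_right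
  rcases eq_or_ne (μ E) 0 with h0 | h0
  · have : ∀ x, ∫⁻ y in E, k x y ∂μ = 0 := fun x => setLIntegral_measure_zero _ _ h0
    simp [this]
  have hγ1 : 0 < 1 - γ := by linarith
  set e := a / (1 - γ) with he
  have he1 : e < 1 := by rw [he, div_lt_one hγ1]; linarith
  have he0 : 0 < e := div_pos ha0 hγ1
  have hae : a = (1 - γ) * e := by rw [he]; field_simp
  set L := C₀ * μ E ^ γ with hL
  have hLfin : L ≠ ∞ := ENNReal.mul_ne_top hC₀ (ENNReal.rpow_ne_top_of_nonneg hγ0.le hEfin)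
  have hL0 : L ≠ 0 := mul_ne_zero hC₀' (by simp [ENNReal.rpow_eq_zero_iff, h0, hEfin])
  have hΛ : 0 < L.toReal := ENNReal.toReal_pos hL0 hLfin
  have hCE : C₀ * μ E ≠ ∞ := ENNReal.mul_ne_top hC₀ hEfin
  rw [lintegral_mul_eq_lintegral_setLIntegral_lt hg hφ
    fun x => ((hk x E hE).trans_lt hLfin.lt_top).ne]
  -- Above L = C₀|E|^γ the superlevel set is empty; below L the weak type bound gives τ^(-e),
  -- integrable at 0 because e < 1, that is, a + γ < 1.
  have hpt : ∀ τ ∈ Ioi (0 : ℝ), ∫⁻ x in {x | ENNReal.ofReal τ < ∫⁻ y in E, k x y ∂μ}, g x ∂μ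
      ≤ (Ioc 0 L.toReal).indicator
        (fun τ => A * (C₀ * μ E) ^ e * ENNReal.ofReal (τ ^ (-e))) τ := by
    intro τ hτ
    have hτ' : 0 < τ := hτ
    by_cases hτL : τ ≤ L.toReal
    · rw [indicator_of_mem (by exact ⟨hτ, hτL⟩)]
      refine (hgA _ (measurableSet_lt measurable_const hφ)).trans ?_
      rw [mul_assoc]
      gcongr
      have h1 := measure_superlevel_le hkm hks (by linarith) hk (E := E) (τ := ENNReal.ofReal τ)
      have hτne : ENNReal.ofReal τ ≠ 0 := by simpa using hτ'
      rw [hae, ENNReal.rpow_mul, ← ENNReal.ofReal_rpow_of_pos hτ', ENNReal.rpow_neg,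
        ← ENNReal.inv_rpow, ← ENNReal.mul_rpow_of_nonneg _ _ he0.le]
      gcongr
      rw [← div_eq_mul_inv, ENNReal.le_div_iff_mul_le (Or.inl hτne) (Or.inl ENNReal.ofReal_ne_top),
        mul_comm]
      exact h1
    · have : {x | ENNReal.ofReal τ < ∫⁻ y in E, k x y ∂μ} = ∅ := by
        ext x
        simp only [mem_ofPred_eq, mem_empty_iff_false, iff_false, not_lt]
        refine (hk x E hE).trans ?_
        rw [← hL, ← ENNReal.ofReal_toReal hLfin]
        exact ENNReal.ofReal_le_ofReal (not_le.1 hτL).le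
      simp [this]
  refine (setLIntegral_mono' measurableSet_Ioi hpt).trans ?_
  rw [lintegral_indicator measurableSet_Ioc, Measure.restrict_restrict measurableSet_Ioc,
    inter_eq_left.2 Ioc_subset_Ioi_self, lintegral_const_mul _ (by fun_prop),
    lintegral_Ioc_rpow_neg he1 hΛ, div_eq_mul_one_div,
    ENNReal.ofReal_mul (Real.rpow_nonneg hΛ.le _), ← ENNReal.ofReal_rpow_of_pos hΛ,
    ENNReal.ofReal_toReal hLfin, hL, ENNReal.mul_rpow_of_nonneg _ _ he0.le,
    ENNReal.mul_rpow_of_nonneg _ _ (by linarith : 0 ≤ 1 - e), ← ENNReal.rpow_mul]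
  have h1 : C₀ = C₀ ^ e * C₀ ^ (1 - e) := by rw [← ENNReal.rpow_add _ _ hC₀' hC₀]; simp
  have h2 : μ E ^ (a + γ) = μ E ^ e * μ E ^ (γ * (1 - e)) := by
    rw [← ENNReal.rpow_add _ _ h0 hEfin]; congr 1; rw [hae]; ring
  rw [h2]
  nth_rw 3 [h1]
  apply le_of_eq
  ring

/-- Product of an `L^q` function and a function in a Marcinkiewicz space. -/
lemma setLIntegral_mul_le_of_marcinkiewicz {V w : X → ℝ≥0∞} (hV : Measurable V)
    (hw : Measurable w) (hVfin : ∀ x, V x ≠ ∞) {q a : ℝ} (hq : 0 < q) (ha : 0 < a)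
    (hqa : 1 < q * a) {N A : ℝ≥0∞} (hN : ∫⁻ x, V x ^ q ∂μ ≤ N) (hN0 : N ≠ 0) (hNfin : N ≠ ∞)
    (hwA : ∀ E, MeasurableSet E → ∫⁻ x in E, w x ∂μ ≤ A * μ E ^ a)
    {E : Set X} (hE : MeasurableSet E) (hEfin : μ E ≠ ∞) :
    ∫⁻ x in E, V x * w x ∂μ
      ≤ ENNReal.ofReal (1 + 1 / (q * a - 1)) * N ^ (1 / q) * A * μ E ^ (a - 1 / q) := by
  rcases eq_or_ne (μ E) 0 with h0 | h0
  · simp [setLIntegral_measure_zero _ _ h0]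
  -- The level where the Chebyshev bound N t^(-q) for |{V > t}| equals |E|: below it E itself is the
  -- better bound, above it Chebyshev is.
  set t₀ := (N / μ E) ^ (1 / q) with ht₀
  have hNE : N / μ E ≠ ∞ := ENNReal.div_ne_top hNfin h0
  have hNE0 : N / μ E ≠ 0 := ENNReal.div_ne_zero.2 ⟨hN0, hEfin⟩
  have ht₀fin : t₀ ≠ ∞ := ENNReal.rpow_ne_top_of_nonneg (by positivity) hNE
  have ht₀0 : t₀ ≠ 0 := by simp [ht₀, ENNReal.rpow_eq_zero_iff, hNE0, hNE]
  have hΛ : 0 < t₀.toReal := ENNReal.toReal_pos ht₀0 ht₀fin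
  simp_rw [mul_comm (V _)]
  rw [lintegral_mul_eq_lintegral_setLIntegral_lt hw hV hVfin,
    ← Ioc_union_Ioi_eq_Ioi hΛ.le,
    lintegral_union measurableSet_Ioi (by
      rw [Set.disjoint_left]; intro x hx hx'; exact absurd hx.2 (not_le.2 hx'))]
  have hlev : ∀ τ, MeasurableSet {x | ENNReal.ofReal τ < V x} := fun τ =>
    measurableSet_lt measurable_const hV
  have b1 : ∫⁻ τ in Ioc 0 t₀.toReal, ∫⁻ x in {x | ENNReal.ofReal τ < V x}, w x ∂(μ.restrict E)
      ≤ A * μ E ^ a * t₀ := by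
    calc _ ≤ ∫⁻ τ in Ioc 0 t₀.toReal, A * μ E ^ a := by
          refine lintegral_mono fun τ => ?_
          rw [Measure.restrict_restrict (hlev τ)]
          refine (hwA _ ((hlev τ).inter hE)).trans ?_
          gcongr
          exact inter_subset_right
      _ = _ := by simp [ENNReal.ofReal_toReal ht₀fin]
  have b2 : ∫⁻ τ in Ioi t₀.toReal, ∫⁻ x in {x | ENNReal.ofReal τ < V x}, w x ∂(μ.restrict E)
      ≤ A * N ^ a * (t₀ ^ (1 - q * a) * ENNReal.ofReal (1 / (q * a - 1))) := by
    calc _ ≤ ∫⁻ τ in Ioi t₀.toReal, A * N ^ a * ENNReal.ofReal (τ ^ (-(q * a))) := by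
          refine setLIntegral_mono' measurableSet_Ioi fun τ hτ => ?_
          have hτ' : 0 < τ := hΛ.trans hτ
          have hτne : ENNReal.ofReal τ ^ q ≠ 0 := by
            simp [ENNReal.rpow_eq_zero_iff, hτ', not_lt.2 hq.le]
          have hτtop : ENNReal.ofReal τ ^ q ≠ ∞ :=
            ENNReal.rpow_ne_top_of_nonneg hq.le ENNReal.ofReal_ne_top
          rw [Measure.restrict_restrict (hlev τ)]
          refine (hwA _ ((hlev τ).inter hE)).trans ?_
          rw [mul_assoc]
          gcongr
          have hm : ENNReal.ofReal τ ^ q * μ {x | ENNReal.ofReal τ < V x} ≤ N := by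
            refine le_trans ?_ ((mul_meas_ge_le_lintegral (hV.pow_const q)
              (ENNReal.ofReal τ ^ q)).trans hN)
            exact mul_le_mul_right (measure_mono fun x hx =>
              ENNReal.rpow_le_rpow (le_of_lt hx) hq.le) _
          rw [← ENNReal.ofReal_rpow_of_pos hτ', ENNReal.rpow_neg, ENNReal.rpow_mul,
            ← ENNReal.inv_rpow, ← ENNReal.mul_rpow_of_nonneg _ _ ha.le]
          gcongr
          rw [← div_eq_mul_inv, ENNReal.le_div_iff_mul_le (Or.inl hτne) (Or.inl hτtop), mul_comm]
          refine le_trans ?_ hm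
          gcongr
          exact inter_subset_left
      _ = _ := by
          rw [lintegral_const_mul _ (by fun_prop), lintegral_Ioi_rpow_neg hqa hΛ, div_eq_mul_one_div,
            ENNReal.ofReal_mul (Real.rpow_nonneg hΛ.le _), ← ENNReal.ofReal_rpow_of_pos hΛ,
            ENNReal.ofReal_toReal ht₀fin]
  refine (add_le_add b1 b2).trans ?_
  have c1 : μ E ^ a * t₀ = N ^ (1 / q) * μ E ^ (a - 1 / q) := by
    rw [ht₀, ENNReal.div_rpow_of_nonneg _ _ (by positivity), sub_eq_add_neg,
      ENNReal.rpow_add _ _ h0 hEfin, ENNReal.rpow_neg, div_eq_mul_inv]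
    ring
  have c2 : N ^ a * t₀ ^ (1 - q * a) = N ^ (1 / q) * μ E ^ (a - 1 / q) := by
    have e1 : N / μ E = N * (μ E)⁻¹ := div_eq_mul_inv _ _
    have e2 : 1 / q * (1 - q * a) = 1 / q - a := by field_simp
    rw [ht₀, ← ENNReal.rpow_mul, e2, e1,
      ENNReal.mul_rpow_of_ne_zero hN0 (by simpa using hEfin), ENNReal.inv_rpow, ← ENNReal.rpow_neg,
      ← mul_assoc, ← ENNReal.rpow_add _ _ hN0 hNfin]
    congr 2 <;> ring
  have hpos : 0 < q * a - 1 := by linarith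
  rw [ENNReal.ofReal_add zero_le_one (by positivity), mul_assoc A, c1, mul_assoc A, ← mul_assoc (N ^ a), c2]
  apply le_of_eq
  simp only [ENNReal.ofReal_one]
  ring

/-! ### Riesz kernels on a finite-dimensional normed space -/

section Space

open Metric Module

variable {X : Type*} [NormedAddCommGroup X] [NormedSpace ℝ X] [FiniteDimensional ℝ X]
  [MeasurableSpace X] [BorelSpace X] {μ : Measure X} [μ.IsAddHaarMeasure]

lemma lintegral_ball_enorm_rpow_lt_top {β : ℝ} (hβ : 0 < β) (hdim : 1 ≤ finrank ℝ X) :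
    ∫⁻ y in ball (0 : X) 1, ‖y‖ₑ ^ (β - finrank ℝ X) ∂μ < ∞ := by
  have : Nontrivial X := nontrivial_of_finrank_pos (R := ℝ) (by positivity)
  have h := integrableOn_ball_of_norm_le_rpow (μ := μ) (E := X) (F := ℝ) (r := 1)
    (f := fun y => ‖y‖ ^ (β - finrank ℝ X)) (C := 1) (α := finrank ℝ X - β) hdim (by linarith)
    (Filter.Eventually.of_forall fun y => by
      rw [Real.norm_of_nonneg (by positivity), one_mul, neg_sub])
    (Measurable.aestronglyMeasurable (by fun_prop))
  have h2 := h.2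
  rw [hasFiniteIntegral_iff_enorm] at h2
  refine lt_of_le_of_lt (lintegral_mono_ae ?_) h2
  have h0 : ∀ᵐ y ∂(μ.restrict (ball (0 : X) 1)), y ≠ 0 :=
    ae_restrict_of_ae (Measure.ae_ne μ 0)
  filter_upwards [h0] with y hy
  have hy' : 0 < ‖y‖ := norm_pos_iff.2 hy
  rw [Real.enorm_of_nonneg (by positivity), ← ENNReal.ofReal_rpow_of_pos hy', ofReal_norm]

lemma lintegral_ball_smul (f : X → ℝ≥0∞) {r : ℝ} (hr : 0 < r) :
    ∫⁻ y in ball (0 : X) r, f y ∂μ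
      = ENNReal.ofReal r ^ (finrank ℝ X : ℝ) * ∫⁻ y in ball (0 : X) 1, f (r • y) ∂μ := by
  have h := Measure.map_addHaar_smul μ (inv_ne_zero hr.ne')
  have hemb : MeasurableEmbedding fun x : X => r⁻¹ • x :=
    (Homeomorph.smulOfNeZero r⁻¹ (inv_ne_zero hr.ne')).measurableEmbedding
  have h1 : ∫⁻ y in ball (0 : X) r, f y ∂μ
      = ∫⁻ y in ball (0 : X) 1, f (r • y) ∂(μ.map (r⁻¹ • ·)) := by
    rw [hemb.restrict_map, hemb.lintegral_map]
    have : (fun x : X => r⁻¹ • x) ⁻¹' ball 0 1 = ball 0 r := by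
      ext x
      simp only [mem_preimage, mem_ball_zero_iff, norm_smul, norm_inv, Real.norm_of_nonneg hr.le]
      rw [inv_mul_lt_one₀ hr]
    rw [this]
    refine lintegral_congr fun y => ?_
    rw [smul_inv_smul₀ hr.ne']
  rw [h1, h, Measure.restrict_smul, lintegral_smul_measure, smul_eq_mul]
  congr 1
  rw [inv_pow, inv_inv, abs_of_pos (by positivity), ENNReal.rpow_natCast, ENNReal.ofReal_pow hr.le]

/-- Bathtub bound for the potential of a set. -/
lemma exists_setLIntegral_riesz_le (μ : Measure X) [μ.IsAddHaarMeasure] {β : ℝ} (hβ : 0 < β)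
    (hβn : β < finrank ℝ X) :
    ∃ C : ℝ≥0∞, C ≠ ∞ ∧ C ≠ 0 ∧ ∀ (x : X) (E : Set X), MeasurableSet E →
      ∫⁻ y in E, ‖x - y‖ₑ ^ (β - finrank ℝ X) ∂μ ≤ C * μ E ^ (β / finrank ℝ X) := by
  have hn : (0 : ℝ) < finrank ℝ X := hβ.trans hβn
  have hdim : 1 ≤ finrank ℝ X := by exact_mod_cast hn
  have : Nontrivial X := nontrivial_of_finrank_pos (R := ℝ) (by positivity)
  set n : ℝ := (finrank ℝ X : ℝ) with hndef
  set C₁ := ∫⁻ y in ball (0 : X) 1, ‖y‖ₑ ^ (β - n) ∂μ with hC₁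
  have hC₁fin : C₁ < ∞ := lintegral_ball_enorm_rpow_lt_top hβ hdim
  refine ⟨C₁ + 1, by simp [hC₁fin.ne], by simp, fun x E hE => ?_⟩
  rcases eq_or_ne (μ E) 0 with h0 | h0
  · simp [setLIntegral_measure_zero _ _ h0]
  rcases eq_or_ne (μ E) ∞ with h1 | h1
  · rw [h1, ENNReal.top_rpow_of_pos (by positivity)]
    simp
  have hm : 0 < (μ E).toReal := ENNReal.toReal_pos h0 h1
  -- The radius of a ball of volume comparable to |E|: the kernel is integrated exactly inside this
  -- ball and bounded by r^(β-n) on the rest of E.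
  set r := (μ E).toReal ^ (1 / n) with hr
  have hr0 : 0 < r := Real.rpow_pos_of_pos hm _
  have hrE : ENNReal.ofReal r = μ E ^ (1 / n) := by
    rw [hr, ← ENNReal.ofReal_rpow_of_pos hm, ENNReal.ofReal_toReal h1]
  have hball : ∫⁻ y in ball x r, ‖x - y‖ₑ ^ (β - n) ∂μ = ENNReal.ofReal r ^ β * C₁ := by
    have t1 : ∫⁻ y in ball x r, ‖x - y‖ₑ ^ (β - n) ∂μ
        = ∫⁻ y in ball (0 : X) r, ‖y‖ₑ ^ (β - n) ∂μ := by
      rw [← lintegral_indicator measurableSet_ball, ← lintegral_indicator measurableSet_ball,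
        ← lintegral_sub_left_eq_self _ x]
      refine lintegral_congr fun y => ?_
      by_cases hy : ‖y‖ < r <;> simp [indicator, hy]
    have hrne : ENNReal.ofReal r ≠ 0 := by simpa using hr0
    rw [t1, lintegral_ball_smul _ hr0, hC₁]
    have t2 : ∀ y : X, ‖r • y‖ₑ ^ (β - n) = ENNReal.ofReal r ^ (β - n) * ‖y‖ₑ ^ (β - n) := by
      intro y
      rw [enorm_smul, Real.enorm_of_nonneg hr0.le, ENNReal.mul_rpow_of_ne_top ENNReal.ofReal_ne_top (by simp)]
    simp_rw [t2]
    rw [lintegral_const_mul _ (by fun_prop), ← mul_assoc, ← ENNReal.rpow_add _ _ hrne (by simp)]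
    congr 2
    ring
  calc ∫⁻ y in E, ‖x - y‖ₑ ^ (β - n) ∂μ
      ≤ ∫⁻ y in ball x r ∪ (E \ ball x r), ‖x - y‖ₑ ^ (β - n) ∂μ := by
        apply lintegral_mono_set
        intro y hy
        by_cases h : y ∈ ball x r
        · exact Or.inl h
        · exact Or.inr ⟨hy, h⟩
    _ ≤ ∫⁻ y in ball x r, ‖x - y‖ₑ ^ (β - n) ∂μ + ∫⁻ y in E \ ball x r, ‖x - y‖ₑ ^ (β - n) ∂μ :=
        lintegral_union_le _ _ _
    _ ≤ ENNReal.ofReal r ^ β * C₁ + ∫⁻ y in E \ ball x r, ENNReal.ofReal r ^ (β - n) ∂μ := by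
        rw [hball]
        refine add_le_add le_rfl ?_
        refine setLIntegral_mono' (hE.diff measurableSet_ball) fun y hy => ?_
        have h2 : r ≤ ‖x - y‖ := by
          have := hy.2
          rw [mem_ball, dist_comm, dist_eq_norm] at this
          exact not_lt.1 this
        rw [← neg_sub n β, ENNReal.rpow_neg, ENNReal.rpow_neg]
        refine ENNReal.inv_le_inv.2 (ENNReal.rpow_le_rpow ?_ (by linarith))
        rw [← ofReal_norm]
        exact ENNReal.ofReal_le_ofReal h2
    _ ≤ ENNReal.ofReal r ^ β * C₁ + ENNReal.ofReal r ^ (β - n) * μ E := by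
        gcongr
        rw [setLIntegral_const]
        gcongr
        exact sdiff_subset
    _ = (C₁ + 1) * μ E ^ (β / n) := by
        have e1 : 1 / n * β = β / n := by ring
        have e2 : μ E ^ (1 / n * (β - n)) * μ E = μ E ^ (β / n) := by
          nth_rw 2 [← ENNReal.rpow_one (μ E)]
          rw [← ENNReal.rpow_add _ _ h0 h1]
          congr 1
          field_simp
          ring
        rw [hrE, ← ENNReal.rpow_mul, ← ENNReal.rpow_mul, e1, e2]
        ring

/-- The Riesz potential maps Marcinkiewicz spaces to Marcinkiewicz spaces (dual form). -/
lemma exists_lintegral_mul_riesz_le (μ : Measure X) [μ.IsAddHaarMeasure] {β a : ℝ} (hβ : 0 < β)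
    (ha : 0 < a) (hβa : a + β / finrank ℝ X < 1) (hdim : 1 ≤ finrank ℝ X) :
    ∃ C : ℝ≥0∞, C ≠ ∞ ∧ ∀ (g : X → ℝ≥0∞) (A : ℝ≥0∞), Measurable g →
      (∀ E, MeasurableSet E → ∫⁻ x in E, g x ∂μ ≤ A * μ E ^ a) →
      ∀ E : Set X, MeasurableSet E → μ E ≠ ∞ →
        ∫⁻ x, g x * ∫⁻ y in E, ‖x - y‖ₑ ^ (β - finrank ℝ X) ∂μ ∂μ
          ≤ C * A * μ E ^ (a + β / finrank ℝ X) := by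
  have hn : (0 : ℝ) < finrank ℝ X := by exact_mod_cast hdim
  have hβn : β < finrank ℝ X := by
    have : β / finrank ℝ X < 1 := by linarith
    rwa [div_lt_one hn] at this
  obtain ⟨C₀, hC, hC', h⟩ := exists_setLIntegral_riesz_le μ hβ hβn
  refine ⟨_, ENNReal.mul_ne_top hC ENNReal.ofReal_ne_top, fun g A hg hgA E hE hEfin =>
    lintegral_mul_potential_le (k := fun x y : X => ‖x - y‖ₑ ^ (β - finrank ℝ X))
      ?_ ?_ hC hC' (div_pos hβ hn) ha hβa h hg hgA hE hEfin⟩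
  · simp only [Function.uncurry_def]
    fun_prop
  · intro x y
    simp only [← edist_eq_enorm_sub, edist_comm]

/-- The Riesz potential maps Marcinkiewicz spaces to Marcinkiewicz spaces. -/
lemma exists_setLIntegral_riesz_potential_le (μ : Measure X) [μ.IsAddHaarMeasure] {β a : ℝ}
    (hβ : 0 < β)
    (ha : 0 < a) (hβa : a + β / finrank ℝ X < 1) (hdim : 1 ≤ finrank ℝ X) :
    ∃ C : ℝ≥0∞, C ≠ ∞ ∧ C ≠ 0 ∧ ∀ (g : X → ℝ≥0∞) (A : ℝ≥0∞), Measurable g →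
      (∀ E, MeasurableSet E → ∫⁻ x in E, g x ∂μ ≤ A * μ E ^ a) →
      ∀ E : Set X, MeasurableSet E → μ E ≠ ∞ →
        ∫⁻ x in E, ∫⁻ y, ‖x - y‖ₑ ^ (β - finrank ℝ X) * g y ∂μ ∂μ
          ≤ C * A * μ E ^ (a + β / finrank ℝ X) := by
  obtain ⟨C, hC, h⟩ := exists_lintegral_mul_riesz_le μ hβ ha hβa hdim
  -- A nonzero constant keeps the same bound true on sets of infinite measure, where 0 · ∞ would
  -- spoil it.
  refine ⟨C + 1, by simp [hC], by simp, fun g A hg hgA E hE hEfin =>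
    le_trans (le_trans (le_of_eq ?_) (h g A hg hgA E hE hEfin)) (by gcongr; exact le_self_add)⟩
  rw [lintegral_lintegral_swap (by simp only [Function.uncurry_def]; fun_prop)]
  refine lintegral_congr fun y => ?_
  rw [lintegral_mul_const _ (by fun_prop), mul_comm]
  simp only [← edist_eq_enorm_sub, edist_comm]

end Space

end Riesz

end HalfSpace

/-! ### The common profile of the two Green functions -/

namespace HalfSpace

/-- The common profile `∫₀^τ c^(a-1) (s+c)^(-b) dc` of the Green functions of the half-space. -/
noncomputable def profile (a b s τ : ℝ) : ℝ≥0∞ :=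
  ∫⁻ c in Ioo 0 τ, ENNReal.ofReal (c ^ (a - 1) * (s + c) ^ (-b))

lemma profile_integrand_anti {a b s s' c : ℝ} (hb : 0 ≤ b) (hs' : 0 ≤ s') (hs : s' ≤ s)
    (hc : 0 < c) :
    ENNReal.ofReal (c ^ (a - 1) * (s + c) ^ (-b))
      ≤ ENNReal.ofReal (c ^ (a - 1) * (s' + c) ^ (-b)) := by
  apply ENNReal.ofReal_le_ofReal
  apply mul_le_mul_of_nonneg_left _ (Real.rpow_nonneg hc.le _)
  exact Real.rpow_le_rpow_of_nonpos (by linarith) (by linarith) (by linarith)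

lemma profile_mono {a b s s' τ τ' : ℝ} (hb : 0 ≤ b) (hs' : 0 ≤ s') (hs : s' ≤ s) (hτ : τ ≤ τ') :
    profile a b s τ ≤ profile a b s' τ' :=
  (setLIntegral_mono' measurableSet_Ioo fun _ hc => profile_integrand_anti hb hs' hs hc.1).trans
    (lintegral_mono_set (Ioo_subset_Ioo_right hτ))

lemma profile_add {a b s τ τ' : ℝ} (hτ0 : 0 < τ) (hτ : τ ≤ τ') :
    profile a b s τ + ∫⁻ c in Ico τ τ', ENNReal.ofReal (c ^ (a - 1) * (s + c) ^ (-b))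
      = profile a b s τ' := by
  rw [profile, profile, ← Ioo_union_Ico_eq_Ioo hτ0 hτ, lintegral_union measurableSet_Ico]
  rw [Set.disjoint_left]
  intro x hx hx'
  exact absurd hx.2 (not_lt.2 hx'.1)

/-- The inequality between four values of the profile behind the method of moving planes. -/
lemma profile_add_le_add {a b s s' τ τ₁ τ₂ τ₃ : ℝ} (hb : 0 ≤ b) (hs : 0 ≤ s) (hs' : s ≤ s')
    (hτ : 0 < τ) (h2 : τ ≤ τ₂) (h3 : τ ≤ τ₃) (h13 : τ₁ ≤ τ₃) :
    profile a b s τ + profile a b s' τ₁ ≤ profile a b s' τ₂ + profile a b s τ₃ := by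
  rcases le_total τ₁ τ₂ with h12 | h12
  · rw [add_comm]
    exact add_le_add (profile_mono hb (hs.trans hs') le_rfl h12) (profile_mono hb hs le_rfl h3)
  -- The only excess on the left is the integral over [τ₂, τ₁) with s'. It is at most the same
  -- integral with s, and [τ₂, τ₁) lies in [τ, τ₃).
  · rw [← profile_add (hτ.trans_le h2) h12, ← add_assoc, add_right_comm, add_comm _ (profile a b s' τ₂),
      ← profile_add hτ (h2.trans (h12.trans h13))]
    gcongr profile a b s' τ₂ + (profile a b s τ + ?_)
    refine (setLIntegral_mono' measurableSet_Ico fun c hc =>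
      profile_integrand_anti hb hs hs' (hτ.trans_le (h2.trans hc.1))).trans
      (lintegral_mono_set ?_)
    intro c hc
    exact ⟨h2.trans hc.1, hc.2.trans_le h13⟩

lemma profile_lt {a b s s' τ τ' : ℝ} (hb : 0 ≤ b) (hs' : 0 ≤ s') (hs : s' ≤ s) (hτ0 : 0 < τ)
    (hτ : τ < τ') (hfin : profile a b s τ ≠ ∞) : profile a b s τ < profile a b s' τ' := by
  refine lt_of_lt_of_le ?_ (profile_mono hb hs' hs (le_refl τ'))
  rw [← profile_add hτ0 hτ.le]
  refine ENNReal.lt_add_right hfin ?_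
  refine (setLIntegral_pos_iff (by fun_prop)).2 ?_ |>.ne'
  refine lt_of_lt_of_le (b := volume (Ico τ τ')) (by simp [hτ]) (measure_mono fun c hc => ⟨?_, hc⟩)
  have hc0 : 0 < c := hτ0.trans_le hc.1
  simp only [Function.mem_support, ne_eq, ENNReal.ofReal_eq_zero, not_le]
  exact mul_pos (Real.rpow_pos_of_pos hc0 _) (Real.rpow_pos_of_pos (by linarith) _)

lemma lintegral_Ioo_rpow_sub_one {a τ : ℝ} (ha : 0 < a) (hτ : 0 ≤ τ) :
    ∫⁻ c in Ioo 0 τ, ENNReal.ofReal (c ^ (a - 1)) = ENNReal.ofReal (τ ^ a / a) := by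
  rcases hτ.eq_or_lt with h | h
  · simp [← h, Real.zero_rpow ha.ne']
  · have := lintegral_Ioc_rpow_neg (e := 1 - a) (by linarith) h
    rw [neg_sub, sub_sub_cancel] at this
    rw [← this]
    exact setLIntegral_congr Ioo_ae_eq_Ioc

lemma profile_le_left {a b s τ : ℝ} (ha : 0 < a) (hb : 0 ≤ b) (hs : 0 < s) (hτ : 0 ≤ τ) :
    profile a b s τ ≤ ENNReal.ofReal (τ ^ a * s ^ (-b) / a) := by
  calc profile a b s τ
      ≤ ∫⁻ c in Ioo 0 τ, ENNReal.ofReal (s ^ (-b)) * ENNReal.ofReal (c ^ (a - 1)) := by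
        refine setLIntegral_mono' measurableSet_Ioo fun c hc => ?_
        rw [← ENNReal.ofReal_mul (Real.rpow_nonneg hs.le _), mul_comm]
        apply ENNReal.ofReal_le_ofReal
        apply mul_le_mul_of_nonneg_right _ (Real.rpow_nonneg hc.1.le _)
        exact Real.rpow_le_rpow_of_nonpos hs (by linarith [hc.1]) (by linarith)
    _ = _ := by
        rw [lintegral_const_mul _ (by fun_prop), lintegral_Ioo_rpow_sub_one ha hτ,
          ← ENNReal.ofReal_mul (Real.rpow_nonneg hs.le _)]
        congr 1
        ring

lemma le_profile {a b s τ : ℝ} (ha : 0 < a) (hb : 0 ≤ b) (hs : 0 ≤ s) (hτ : 0 < τ) :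
    ENNReal.ofReal (τ ^ a * (s + τ) ^ (-b) / a) ≤ profile a b s τ := by
  calc _ = ∫⁻ c in Ioo 0 τ, ENNReal.ofReal ((s + τ) ^ (-b)) * ENNReal.ofReal (c ^ (a - 1)) := by
        rw [lintegral_const_mul _ (by fun_prop), lintegral_Ioo_rpow_sub_one ha hτ.le,
          ← ENNReal.ofReal_mul (Real.rpow_nonneg (by positivity) _)]
        congr 1
        ring
    _ ≤ profile a b s τ := by
        refine setLIntegral_mono' measurableSet_Ioo fun c hc => ?_
        rw [← ENNReal.ofReal_mul (Real.rpow_nonneg (by positivity) _), mul_comm]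
        apply ENNReal.ofReal_le_ofReal
        apply mul_le_mul_of_nonneg_left _ (Real.rpow_nonneg hc.1.le _)
        exact Real.rpow_le_rpow_of_nonpos (by linarith [hc.1]) (by linarith [hc.2]) (by linarith)

lemma profile_pos {a b s τ : ℝ} (ha : 0 < a) (hb : 0 ≤ b) (hs : 0 ≤ s) (hτ : 0 < τ) :
    0 < profile a b s τ := by
  refine lt_of_lt_of_le ?_ (le_profile ha hb hs hτ)
  simp only [ENNReal.ofReal_pos]
  positivity

/-- Split at c = s: below, s + c ≥ s; above, s + c ≥ c, and the tail of c^(a-1-b) converges since a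
< b. With s = |x-y|² this is the Riesz kernel bound. -/
lemma profile_le_right {a b s τ : ℝ} (ha : 0 < a) (hab : a < b) (hs : 0 < s) :
    profile a b s τ ≤ ENNReal.ofReal ((1 / a + 1 / (b - a)) * s ^ (a - b)) := by
  have hb : 0 ≤ b := by linarith
  have hba : 0 < b - a := by linarith
  have h1 := profile_le_left ha hb hs hs.le
  have h2 : ∫⁻ c in Ici s, ENNReal.ofReal (c ^ (a - 1) * (s + c) ^ (-b))
      ≤ ENNReal.ofReal (s ^ (a - b) / (b - a)) := by
    have h3 := lintegral_Ioi_rpow_neg (e := 1 + b - a) (by linarith) hs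
    rw [show 1 - (1 + b - a) = a - b by ring, show 1 + b - a - 1 = b - a by ring] at h3
    rw [← h3, setLIntegral_congr Ioi_ae_eq_Ici.symm]
    refine setLIntegral_mono' measurableSet_Ioi fun c hc => ENNReal.ofReal_le_ofReal ?_
    have hc0 : 0 < c := hs.trans hc
    rw [show -(1 + b - a) = (a - 1) + (-b) by ring, Real.rpow_add hc0]
    gcongr ?_ * ?_
    exact Real.rpow_le_rpow_of_nonpos hc0 (by linarith) (by linarith)
  calc profile a b s τ
      ≤ ∫⁻ c in Ioo 0 s ∪ Ici s, ENNReal.ofReal (c ^ (a - 1) * (s + c) ^ (-b)) := by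
        apply lintegral_mono_set
        intro c hc
        rcases lt_or_ge c s with h | h
        · exact Or.inl ⟨hc.1, h⟩
        · exact Or.inr h
    _ ≤ _ := lintegral_union_le _ _ _
    _ ≤ ENNReal.ofReal (s ^ a * s ^ (-b) / a) + ENNReal.ofReal (s ^ (a - b) / (b - a)) :=
        add_le_add h1 h2
    _ = _ := by
        rw [← ENNReal.ofReal_add (by positivity) (by positivity), ← Real.rpow_add hs,
          ← sub_eq_add_neg]
        congr 1
        ring

lemma profile_ne_top {a b s τ : ℝ} (ha : 0 < a) (hab : a < b) (hs : 0 < s) :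
    profile a b s τ ≠ ∞ :=
  ((profile_le_right ha hab hs).trans_lt ENNReal.ofReal_lt_top).ne

/-- Comparable arguments have comparable profiles. -/
lemma profile_le_mul {a b s s' τ τ' M : ℝ} (hb : 0 ≤ b) (hM : 1 ≤ M) (hs : 0 ≤ s)
    (hs' : 0 ≤ s') (hss' : s' ≤ M * s) (hττ' : τ ≤ M * τ') :
    profile a b s τ ≤ ENNReal.ofReal (M ^ (a + b)) * profile a b s' τ' := by
  have hM0 : 0 < M := by linarith
  refine (profile_mono hb hs le_rfl hττ').trans ?_
  have himg : (fun c : ℝ => M * c) '' Ioo 0 τ' = Ioo 0 (M * τ') := by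
    rw [image_mul_left_Ioo hM0, mul_zero]
  rw [profile, ← himg, lintegral_image_eq_lintegral_abs_deriv_mul (f' := fun _ => M)
    measurableSet_Ioo (fun x _ => by simpa using (hasDerivAt_id x).const_mul M |>.hasDerivWithinAt)
    (fun x _ y _ h => by simpa [hM0.ne'] using h), profile,
    ← lintegral_const_mul' _ _ ENNReal.ofReal_ne_top]
  refine setLIntegral_mono' measurableSet_Ioo fun c hc => ?_
  rw [← ENNReal.ofReal_mul (abs_nonneg _), ← ENNReal.ofReal_mul (by positivity), abs_of_pos hM0]
  apply ENNReal.ofReal_le_ofReal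
  have hc0 : 0 < c := hc.1
  have h1 : (s + M * c) ^ (-b) ≤ M ^ b * (s' + c) ^ (-b) := by
    have h2 : (s' + c) / M ≤ s + M * c := by
      rw [div_le_iff₀ hM0]
      nlinarith [mul_pos hM0 hc0, mul_nonneg (mul_nonneg (sub_nonneg.2 hM) hM0.le) hc0.le]
    have h3 : 0 < (s' + c) / M := by positivity
    refine (Real.rpow_le_rpow_of_nonpos h3 h2 (by linarith)).trans ?_
    rw [Real.div_rpow (by positivity) hM0.le, Real.rpow_neg hM0.le, div_inv_eq_mul, mul_comm]
  calc M * ((M * c) ^ (a - 1) * (s + M * c) ^ (-b))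
      = M ^ a * c ^ (a - 1) * (s + M * c) ^ (-b) := by
        rw [Real.mul_rpow hM0.le hc0.le, Real.rpow_sub_one hM0.ne']
        field_simp
    _ ≤ M ^ a * c ^ (a - 1) * (M ^ b * (s' + c) ^ (-b)) := by gcongr
    _ = M ^ (a + b) * (c ^ (a - 1) * (s' + c) ^ (-b)) := by
        rw [Real.rpow_add hM0]; ring

lemma measurable_profile (a b : ℝ) : Measurable fun q : ℝ × ℝ => profile a b q.1 q.2 := by
  have h : ∀ q : ℝ × ℝ, profile a b q.1 q.2 = ∫⁻ c : ℝ,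
      ({z : (ℝ × ℝ) × ℝ | 0 < z.2 ∧ z.2 < z.1.2}.indicator
        fun z => ENNReal.ofReal (z.2 ^ (a - 1) * (z.1.1 + z.2) ^ (-b))) (q, c) := by
    intro q
    rw [profile, ← lintegral_indicator measurableSet_Ioo]
    rfl
  simp_rw [h]
  have hm : MeasurableSet {z : (ℝ × ℝ) × ℝ | 0 < z.2 ∧ z.2 < z.1.2} :=
    (measurableSet_lt measurable_const measurable_snd).inter
      (measurableSet_lt measurable_snd (measurable_snd.comp measurable_fst))
  refine Measurable.lintegral_prod_right' (Measurable.indicator ?_ hm)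
  fun_prop

lemma integrableOn_profile {a b s τ : ℝ} (ha : 0 < a) (hab : a < b) (hs : 0 < s) :
    IntegrableOn (fun c => c ^ (a - 1) * (s + c) ^ (-b)) (Ioo 0 τ) := by
  refine ⟨Measurable.aestronglyMeasurable (by fun_prop), ?_⟩
  rw [hasFiniteIntegral_iff_ofReal]
  · exact (profile_ne_top ha hab hs).lt_top
  · filter_upwards [ae_restrict_mem measurableSet_Ioo] with c hc
    have := hc.1
    positivity

lemma profile_eq_ofReal {a b s τ : ℝ} (ha : 0 < a) (hab : a < b) (hs : 0 < s) (hτ : 0 ≤ τ) :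
    profile a b s τ = ENNReal.ofReal (∫ c in (0 : ℝ)..τ, c ^ (a - 1) * (s + c) ^ (-b)) := by
  rw [intervalIntegral.integral_of_le hτ, ← integral_Ioc_eq_integral_Ioo.symm,
    ofReal_integral_eq_lintegral_ofReal (integrableOn_profile ha hab hs), profile]
  filter_upwards [ae_restrict_mem measurableSet_Ioo] with c hc
  have := hc.1
  positivity

/-- The kernel `profile` evaluated at `|x - y|²` and `4 xₙ yₙ`. -/
noncomputable def kern {d : ℕ} (a b : ℝ) (x y : EuclideanSpace ℝ (Fin (d + 1))) : ℝ≥0∞ :=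
  profile a b (‖x - y‖ ^ 2) (4 * x (Fin.last d) * y (Fin.last d))

section

variable {d : ℕ} {a b : ℝ}

lemma measurable_kern : Measurable (Function.uncurry (kern (d := d) a b)) := by
  have h : Function.uncurry (kern (d := d) a b) = (fun q : ℝ × ℝ => profile a b q.1 q.2) ∘
      fun z : EuclideanSpace ℝ (Fin (d + 1)) × EuclideanSpace ℝ (Fin (d + 1)) =>
        (‖z.1 - z.2‖ ^ 2, 4 * z.1 (Fin.last d) * z.2 (Fin.last d)) := rfl
  rw [h]
  exact (measurable_profile a b).comp (by fun_prop)

lemma kern_pos (ha : 0 < a) (hb : 0 ≤ b) {x y : EuclideanSpace ℝ (Fin (d + 1))}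
    (hx : x ∈ upper d) (hy : y ∈ upper d) : 0 < kern a b x y := by
  have hx' : 0 < x (Fin.last d) := hx
  have hy' : 0 < y (Fin.last d) := hy
  exact profile_pos ha hb (by positivity) (by positivity)

lemma norm_sub_sq_eq (x y : EuclideanSpace ℝ (Fin (d + 1))) :
    ‖x - y‖ ^ 2 = ∑ i : Fin d, (x i.castSucc - y i.castSucc) ^ 2
      + (x (Fin.last d) - y (Fin.last d)) ^ 2 := by
  rw [EuclideanSpace.real_norm_sq_eq, Fin.sum_univ_castSucc]
  simp

lemma norm_reflect_sub_sq (x y : EuclideanSpace ℝ (Fin (d + 1))) :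
    ‖reflect x - y‖ ^ 2 = ‖x - y‖ ^ 2 + 4 * x (Fin.last d) * y (Fin.last d) := by
  rw [norm_sub_sq_eq, norm_sub_sq_eq]
  have : ∀ i : Fin d, reflect x i.castSucc = x i.castSucc := fun i => by
    simp [reflect, (Fin.castSucc_lt_last i).ne]
  simp only [this]
  have : reflect x (Fin.last d) = -x (Fin.last d) := by simp [reflect]
  rw [this]
  ring

lemma profile_one {ν s τ : ℝ} (hν : 0 < ν) (hs : 0 < s) (hτ : 0 ≤ τ) :
    profile 1 (ν + 1) s τ = ENNReal.ofReal ((s ^ (-ν) - (s + τ) ^ (-ν)) / ν) := by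
  rw [profile_eq_ofReal one_pos (by linarith) hs hτ]
  congr 1
  simp only [sub_self, Real.rpow_zero, one_mul]
  rw [intervalIntegral.integral_comp_add_left (fun c => c ^ (-(ν + 1))), integral_rpow]
  · rw [show -(ν + 1) + 1 = -ν by ring, add_zero, div_neg, ← neg_div, neg_sub]
  · right
    refine ⟨by linarith, ?_⟩
    rw [uIcc_of_le (by linarith)]
    intro h
    linarith [h.1]

/-- Since |x*-y|² = |x-y|² + 4xₙyₙ, the difference of the two powers is the integral of a derivative
between s and s + τ, which is the profile with a = 1. -/
lemma ofReal_greenPoly {m : ℕ} (hdim : 2 * m < d + 1)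
    {x y : EuclideanSpace ℝ (Fin (d + 1))} (hx : x ∈ upper d) (hy : y ∈ upper d) (hxy : x ≠ y) :
    ENNReal.ofReal (greenPoly m x y) =
      ENNReal.ofReal (Real.Gamma (((d + 1 : ℕ) : ℝ) / 2 - m) /
        (4 ^ m * Real.pi ^ (((d + 1 : ℕ) : ℝ) / 2) * Real.Gamma m) * (((d + 1 : ℕ) : ℝ) / 2 - m)) *
      kern 1 (((d + 1 : ℕ) : ℝ) / 2 - m + 1) x y := by
  have hx' : 0 < x (Fin.last d) := hx
  have hy' : 0 < y (Fin.last d) := hy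
  have hr : 0 < ‖x - y‖ := norm_pos_iff.2 (sub_ne_zero.2 hxy)
  set n : ℝ := ((d + 1 : ℕ) : ℝ) with hn
  have hν : 0 < n / 2 - m := by
    have : (2 * m : ℝ) < n := by rw [hn]; exact_mod_cast hdim
    linarith
  have e1 : ‖x - y‖ ^ (2 * (m : ℝ) - n) = (‖x - y‖ ^ 2) ^ (-(n / 2 - m)) := by
    rw [← Real.rpow_natCast, ← Real.rpow_mul (norm_nonneg _)]
    congr 1
    push_cast
    ring
  have e2 : ‖reflect x - y‖ ^ (2 * (m : ℝ) - n)
      = (‖x - y‖ ^ 2 + 4 * x (Fin.last d) * y (Fin.last d)) ^ (-(n / 2 - m)) := by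
    rw [← norm_reflect_sub_sq, ← Real.rpow_natCast, ← Real.rpow_mul (norm_nonneg _)]
    congr 1
    push_cast
    ring
  have hΓm : 0 ≤ Real.Gamma m := Real.Gamma_nonneg_of_nonneg (by positivity)
  have hΓ : 0 < Real.Gamma (n / 2 - m) := Real.Gamma_pos_of_pos hν
  rw [kern, profile_one hν (by positivity) (by positivity), ← ENNReal.ofReal_mul (by positivity),
    greenPoly, ← hn, e1, e2]
  congr 1
  rw [mul_assoc (_ / _) (n / 2 - (m : ℝ)), mul_div_cancel₀ _ hν.ne']

/-- The substitution c = s·b turns the integral up to τ/s into the profile and absorbs the power of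
|x-y|. -/
lemma ofReal_greenFrac {α : ℝ} (hα : 0 < α) (hαn : α < ((d + 1 : ℕ) : ℝ))
    {x y : EuclideanSpace ℝ (Fin (d + 1))} (hx : x ∈ upper d) (hy : y ∈ upper d) (hxy : x ≠ y) :
    ENNReal.ofReal (greenFrac α x y) =
      ENNReal.ofReal (Real.Gamma (((d + 1 : ℕ) : ℝ) / 2) /
        (2 ^ α * Real.pi ^ (((d + 1 : ℕ) : ℝ) / 2) * Real.Gamma (α / 2) ^ 2)) *
      kern (α / 2) (((d + 1 : ℕ) : ℝ) / 2) x y := by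
  have hx' : 0 < x (Fin.last d) := hx
  have hy' : 0 < y (Fin.last d) := hy
  have hr : 0 < ‖x - y‖ := norm_pos_iff.2 (sub_ne_zero.2 hxy)
  set n : ℝ := ((d + 1 : ℕ) : ℝ) with hn
  have hn0 : 0 < n := hα.trans hαn
  set s := ‖x - y‖ ^ 2 with hs
  have hs0 : 0 < s := by positivity
  set τ := 4 * x (Fin.last d) * y (Fin.last d) with hτ
  have hτ0 : 0 < τ := by positivity
  have e1 : ‖x - y‖ ^ (α - n) = s ^ (α / 2 - n / 2) := by
    rw [hs, ← Real.rpow_natCast, ← Real.rpow_mul (norm_nonneg _)]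
    congr 1
    push_cast
    ring
  have e2 : ∫ c in (0 : ℝ)..τ, c ^ (α / 2 - 1) * (s + c) ^ (-(n / 2))
      = s ^ (α / 2 - n / 2) * ∫ b in (0 : ℝ)..(τ / s), b ^ (α / 2 - 1) / (1 + b) ^ (n / 2) := by
    have h := intervalIntegral.integral_comp_mul_left (a := 0) (b := τ / s)
      (fun c => c ^ (α / 2 - 1) * (s + c) ^ (-(n / 2))) hs0.ne'
    rw [mul_zero, mul_div_cancel₀ _ hs0.ne', smul_eq_mul] at h
    rw [← mul_inv_cancel_left₀ hs0.ne' (∫ c in (0 : ℝ)..τ, c ^ (α / 2 - 1) * (s + c) ^ (-(n / 2))),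
      ← h, ← intervalIntegral.integral_const_mul, ← intervalIntegral.integral_const_mul]
    apply intervalIntegral.integral_congr
    intro c hc
    rw [uIcc_of_le (by positivity)] at hc
    have hc0 : 0 ≤ c := hc.1
    dsimp only
    have e3 : s + s * c = s * (1 + c) := by ring
    rw [e3, Real.mul_rpow hs0.le hc0, Real.mul_rpow hs0.le (by positivity), Real.rpow_sub_one hs0.ne',
      Real.rpow_neg (by positivity : 0 ≤ 1 + c), sub_eq_add_neg (α / 2) (n / 2), Real.rpow_add hs0]
    field_simp
  have hΓ : 0 < Real.Gamma (n / 2) := Real.Gamma_pos_of_pos (by positivity)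
  rw [kern, profile_eq_ofReal (by positivity) (by linarith) hs0 hτ0.le, e2,
    ← ENNReal.ofReal_mul (by positivity), greenFrac, e1]
  congr 1
  ring

end

end HalfSpace

namespace HalfSpace

/-! ### Comparison of kernels and potentials under reflection in xₙ = l -/

section Reflection

variable {d : ℕ} {a b : ℝ}

/-- The reflection in the hyperplane `xₙ = l`. -/
noncomputable def reflectAt (l : ℝ) (x : EuclideanSpace ℝ (Fin (d + 1))) : EuclideanSpace ℝ (Fin (d + 1)) :=
  reflect x + EuclideanSpace.single (Fin.last d) (2 * l)

/-- The strip `0 < xₙ < l`. -/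
def strip (d : ℕ) (l : ℝ) : Set (EuclideanSpace ℝ (Fin (d + 1))) :=
  {x | 0 < x (Fin.last d) ∧ x (Fin.last d) < l}

@[simp] lemma reflectAt_last (l : ℝ) (x : EuclideanSpace ℝ (Fin (d + 1))) :
    reflectAt l x (Fin.last d) = 2 * l - x (Fin.last d) := by
  simp [reflectAt, reflect]; ring

@[simp] lemma reflectAt_castSucc (l : ℝ) (x : EuclideanSpace ℝ (Fin (d + 1))) (i : Fin d) :
    reflectAt l x i.castSucc = x i.castSucc := by
  simp [reflectAt, reflect, (Fin.castSucc_lt_last i).ne]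

lemma ext_last {x y : EuclideanSpace ℝ (Fin (d + 1))} (h : ∀ i : Fin d, x i.castSucc = y i.castSucc)
    (hl : x (Fin.last d) = y (Fin.last d)) : x = y := by
  ext i
  refine Fin.lastCases hl h i

@[simp] lemma reflectAt_reflectAt (l : ℝ) (x : EuclideanSpace ℝ (Fin (d + 1))) :
    reflectAt l (reflectAt l x) = x :=
  ext_last (by simp) (by simp)

lemma measurePreserving_reflectAt (l : ℝ) :
    MeasurePreserving (reflectAt l : EuclideanSpace ℝ (Fin (d + 1)) → _) volume volume := by
  have h1 : MeasurePreserving (reflect : EuclideanSpace ℝ (Fin (d + 1)) → _) volume volume := by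
    have e : (reflect : EuclideanSpace ℝ (Fin (d + 1)) → _)
        = LinearIsometryEquiv.piLpCongrRight 2 (fun i : Fin (d + 1) =>
          if i = Fin.last d then LinearIsometryEquiv.neg ℝ (E := ℝ)
          else LinearIsometryEquiv.refl ℝ ℝ) := by
      funext x
      ext i
      by_cases h : i = Fin.last d <;> simp [reflect, h]
    rw [e]
    exact LinearIsometryEquiv.measurePreserving _
  exact (measurePreserving_add_right volume
    (EuclideanSpace.single (Fin.last d) (2 * l))).comp h1

lemma continuous_reflectAt (l : ℝ) :
    Continuous (reflectAt l : EuclideanSpace ℝ (Fin (d + 1)) → _) := by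
  have : Continuous (reflect : EuclideanSpace ℝ (Fin (d + 1)) → _) := by
    refine (PiLp.continuous_toLp 2 _).comp (continuous_pi fun i => ?_)
    by_cases h : i = Fin.last d
    · simp only [h, if_true]; fun_prop
    · simp only [h, if_false]; fun_prop
  exact this.add continuous_const

lemma isOpen_upper : IsOpen (upper d) := isOpen_lt continuous_const (by fun_prop)

lemma isOpen_strip (l : ℝ) : IsOpen (strip d l) :=
  IsOpen.inter (isOpen_upper (d := d))
    (isOpen_lt (f := fun x : EuclideanSpace ℝ (Fin (d + 1)) => x (Fin.last d)) (by fun_prop)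
      continuous_const)

lemma strip_subset_upper {l : ℝ} : strip d l ⊆ upper d := fun _ hx => hx.1

lemma reflectAt_mem_upper {l : ℝ} {x : EuclideanSpace ℝ (Fin (d + 1))} (hx : x ∈ strip d l) :
    reflectAt l x ∈ upper d := by
  change 0 < reflectAt l x (Fin.last d)
  rw [reflectAt_last]
  linarith [hx.1, hx.2]

lemma norm_reflectAt_sub_sq (l : ℝ) (x y : EuclideanSpace ℝ (Fin (d + 1))) :
    ‖reflectAt l x - y‖ ^ 2
      = ‖x - y‖ ^ 2 + 4 * (l - x (Fin.last d)) * (l - y (Fin.last d)) := by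
  rw [norm_sub_sq_eq, norm_sub_sq_eq]
  simp
  ring

lemma norm_sub_reflectAt_sq (l : ℝ) (x y : EuclideanSpace ℝ (Fin (d + 1))) :
    ‖x - reflectAt l y‖ ^ 2
      = ‖x - y‖ ^ 2 + 4 * (l - x (Fin.last d)) * (l - y (Fin.last d)) := by
  rw [norm_sub_sq_eq, norm_sub_sq_eq]
  simp
  ring

/-- Reflecting one point raises |x-y|² by 4(l-xₙ)(l-yₙ); reflecting both leaves it unchanged.
Reflecting either point increases the product of the heights, so `profile_add_le_add` applies. -/
lemma kern_reflectAt_add_le (hb : 0 ≤ b) {l : ℝ} {x y : EuclideanSpace ℝ (Fin (d + 1))}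
    (hx : x ∈ strip d l) (hy : y ∈ strip d l) :
    kern a b x y + kern a b x (reflectAt l y)
      ≤ kern a b (reflectAt l x) y + kern a b (reflectAt l x) (reflectAt l y) := by
  obtain ⟨hx0, hx1⟩ := hx
  obtain ⟨hy0, hy1⟩ := hy
  have e : ‖reflectAt l x - reflectAt l y‖ ^ 2 = ‖x - y‖ ^ 2 := by
    rw [norm_reflectAt_sub_sq, norm_sub_reflectAt_sq, reflectAt_last]; ring
  simp only [kern, e, norm_reflectAt_sub_sq, norm_sub_reflectAt_sq, reflectAt_last]
  have h1 := mul_pos (sub_pos.2 hx1) (sub_pos.2 hy1)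
  have h2 := mul_pos hx0 hy0
  have h3 := mul_pos hx0 (sub_pos.2 hy1)
  have h4 := mul_pos hy0 (sub_pos.2 hx1)
  apply profile_add_le_add hb (by positivity) <;> nlinarith

lemma kern_le_kern_reflectAt (hb : 0 ≤ b) {l : ℝ} {x y : EuclideanSpace ℝ (Fin (d + 1))}
    (hx : x ∈ strip d l) (hy : l ≤ y (Fin.last d)) :
    kern a b x y ≤ kern a b (reflectAt l x) y := by
  obtain ⟨hx0, hx1⟩ := hx
  have h1 := mul_nonneg (sub_pos.2 hx1).le (sub_nonneg.2 hy)
  refine profile_mono hb (by positivity) ?_ ?_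
  · rw [norm_reflectAt_sub_sq]; linarith
  · rw [reflectAt_last]; nlinarith

/-- Strictness comes from the heights alone, since the distances agree when yₙ = l. -/
lemma kern_lt_kern_reflectAt (ha : 0 < a) (hab : a < b) {l : ℝ}
    {x y : EuclideanSpace ℝ (Fin (d + 1))}
    (hx : x ∈ strip d l) (hy : l ≤ y (Fin.last d)) :
    kern a b x y < kern a b (reflectAt l x) y := by
  obtain ⟨hx0, hx1⟩ := hx
  have h1 := mul_nonneg (sub_pos.2 hx1).le (sub_nonneg.2 hy)
  have hy0 : 0 < y (Fin.last d) := by linarith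
  refine profile_lt (by linarith) (by positivity) ?_ (by positivity) ?_ ?_
  · rw [norm_reflectAt_sub_sq]; linarith
  · rw [reflectAt_last]; nlinarith
  · refine profile_ne_top ha hab ?_
    have : x ≠ y := by rintro rfl; linarith
    have := norm_pos_iff.2 (sub_ne_zero.2 this)
    positivity

/-- The part of the half-space that is neither in the strip `0 < xₙ < l` nor in its reflection. -/
def remainder (d : ℕ) (l : ℝ) : Set (EuclideanSpace ℝ (Fin (d + 1))) :=
  upper d \ (strip d l ∪ reflectAt l ⁻¹' strip d l)

lemma le_of_mem_remainder {l : ℝ} {y : EuclideanSpace ℝ (Fin (d + 1))} (hy : y ∈ remainder d l) :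
    l ≤ y (Fin.last d) := by
  by_contra h
  exact hy.2 (Or.inl ⟨hy.1, not_le.1 h⟩)

lemma measurableSet_remainder (l : ℝ) : MeasurableSet (remainder d l) :=
  isOpen_upper.measurableSet.diff ((isOpen_strip l).measurableSet.union
    ((continuous_reflectAt l).measurable (isOpen_strip l).measurableSet))

/-- The mirror image of the strip is folded back onto it, so that the four-point inequality can be
used under a single integral. -/
lemma setLIntegral_upper_eq (l : ℝ) {g : EuclideanSpace ℝ (Fin (d + 1)) → ℝ≥0∞}
    (hg : Measurable g) :
    ∫⁻ y in upper d, g y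
      = (∫⁻ y in strip d l, (g y + g (reflectAt l y))) + ∫⁻ y in remainder d l, g y := by
  have hS := (isOpen_strip (d := d) l).measurableSet
  have hS' : MeasurableSet (reflectAt l ⁻¹' strip d l) :=
    (continuous_reflectAt l).measurable hS
  have hsub : strip d l ∪ reflectAt l ⁻¹' strip d l ⊆ upper d := by
    rintro y (hy | hy)
    · exact hy.1
    · have := reflectAt_mem_upper hy
      rwa [reflectAt_reflectAt] at this
  have h1 : ∫⁻ y in reflectAt l ⁻¹' strip d l, g y = ∫⁻ y in strip d l, g (reflectAt l y) := by
    have h := (measurePreserving_reflectAt l).setLIntegral_comp_preimage hS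
      (hg.comp (continuous_reflectAt l).measurable)
    simpa using h
  rw [lintegral_add_left hg, ← h1, ← lintegral_union hS', ← lintegral_union
    (measurableSet_remainder l), remainder, union_sdiff_cancel hsub]
  · exact disjoint_sdiff_right
  · rw [Set.disjoint_left]
    intro y hy hy'
    have h2 : reflectAt l y (Fin.last d) < l := hy'.2
    rw [reflectAt_last] at h2
    linarith [hy.2]

/-- Subtraction is truncated, so F - F' is a positive part. If F ≤ F', the surplus of F' meets k₂ ≤
k₄; otherwise the surplus of F is paid for by the last term. -/
lemma add_mul_le_of_add_le_add {k₁ k₂ k₃ k₄ F F' : ℝ≥0∞} (h : k₁ + k₂ ≤ k₃ + k₄)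
    (h24 : k₂ ≤ k₄) : k₁ * F + k₂ * F' ≤ k₃ * F + k₄ * F' + k₁ * (F - F') := by
  rcases le_total F F' with h1 | h1
  · obtain ⟨δ, rfl⟩ := exists_add_of_le h1
    calc k₁ * F + k₂ * (F + δ) = (k₁ + k₂) * F + k₂ * δ := by ring
      _ ≤ (k₃ + k₄) * F + k₄ * δ := by gcongr
      _ = k₃ * F + k₄ * (F + δ) := by ring
      _ ≤ _ := le_self_add
  · rcases eq_or_ne F' ∞ with h2 | h2
    · have h3 : F = ∞ := top_le_iff.1 (h2 ▸ h1)
      rw [h2, h3, ← add_mul, ← add_mul]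
      exact (mul_le_mul_left h _).trans le_self_add
    · obtain ⟨δ, rfl⟩ := exists_add_of_le h1
      rw [ENNReal.add_sub_cancel_left h2]
      calc k₁ * (F' + δ) + k₂ * F' = (k₁ + k₂) * F' + k₁ * δ := by ring
        _ ≤ (k₃ + k₄) * F' + k₁ * δ := by gcongr
        _ ≤ (k₃ + k₄) * F' + k₁ * δ + k₃ * δ := le_self_add
        _ = _ := by ring

/-- The half-space potential of `f` with kernel `kern a b`. -/
noncomputable def pot (a b : ℝ) (f : EuclideanSpace ℝ (Fin (d + 1)) → ℝ≥0∞)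
    (x : EuclideanSpace ℝ (Fin (d + 1))) : ℝ≥0∞ :=
  ∫⁻ y in upper d, kern a b x y * f y

lemma measurable_pot {f : EuclideanSpace ℝ (Fin (d + 1)) → ℝ≥0∞} (hf : Measurable f) :
    Measurable (pot a b f) :=
  Measurable.lintegral_prod_right (f := fun x y => kern a b x y * f y)
    (measurable_kern.mul (hf.comp measurable_snd))

lemma pot_mono {f g : EuclideanSpace ℝ (Fin (d + 1)) → ℝ≥0∞} (h : ∀ y ∈ upper d, f y ≤ g y)
    (x : EuclideanSpace ℝ (Fin (d + 1))) : pot a b f x ≤ pot a b g x :=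
  setLIntegral_mono' isOpen_upper.measurableSet fun y hy => mul_le_mul_right (h y hy) _

lemma measurable_kern_left (x : EuclideanSpace ℝ (Fin (d + 1))) : Measurable (kern a b x) :=
  measurable_kern.comp measurable_prodMk_left

lemma measurable_kern_mul {f : EuclideanSpace ℝ (Fin (d + 1)) → ℝ≥0∞} (hf : Measurable f)
    (x : EuclideanSpace ℝ (Fin (d + 1))) : Measurable fun y => kern a b x y * f y :=
  (measurable_kern_left x).mul hf

/-- Comparison of a potential at a point and at its reflection. -/
lemma pot_le_pot_reflectAt_add (hb : 0 ≤ b) {l : ℝ}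
    {f : EuclideanSpace ℝ (Fin (d + 1)) → ℝ≥0∞} (hf : Measurable f)
    {x : EuclideanSpace ℝ (Fin (d + 1))} (hx : x ∈ strip d l) :
    pot a b f x ≤ pot a b f (reflectAt l x)
      + pot a b ((strip d l).indicator fun y => f y - f (reflectAt l y)) x := by
  have hfr : Measurable fun y => f (reflectAt l y) := hf.comp (continuous_reflectAt l).measurable
  have hS := (isOpen_strip (d := d) l).measurableSet
  have e : pot a b ((strip d l).indicator fun y => f y - f (reflectAt l y)) x
      = ∫⁻ y in strip d l, kern a b x y * (f y - f (reflectAt l y)) := by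
    have : ∀ y, kern a b x y * (strip d l).indicator (fun y => f y - f (reflectAt l y)) y
        = (strip d l).indicator (fun y => kern a b x y * (f y - f (reflectAt l y))) y := by
      intro y
      by_cases hy : y ∈ strip d l <;> simp [hy]
    simp only [pot, this]
    rw [setLIntegral_indicator hS, inter_eq_left.2 strip_subset_upper]
  rw [e, pot, pot, setLIntegral_upper_eq l (measurable_kern_mul hf _),
    setLIntegral_upper_eq l (measurable_kern_mul hf _), add_right_comm,
    ← lintegral_add_right _ (measurable_kern_mul (f := fun y => f y - f (reflectAt l y))
      (hf.sub hfr) x)]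
  refine add_le_add (setLIntegral_mono' hS fun y hy => ?_)
    (setLIntegral_mono' (measurableSet_remainder l) fun y hy => ?_)
  · refine add_mul_le_of_add_le_add (kern_reflectAt_add_le hb hx hy)
      (kern_le_kern_reflectAt hb hx ?_)
    rw [reflectAt_last]
    linarith [hy.2]
  · exact mul_le_mul_left (kern_le_kern_reflectAt hb hx (le_of_mem_remainder hy)) _

/-- Strict comparison of a potential at a point and at its reflection. -/
lemma pot_lt_pot_reflectAt (ha : 0 < a) (hab : a < b) {l : ℝ}
    {f : EuclideanSpace ℝ (Fin (d + 1)) → ℝ≥0∞} (hf : Measurable f)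
    (hpos : ∀ y ∈ upper d, 0 < f y) (hle : ∀ y ∈ strip d l, f y ≤ f (reflectAt l y))
    {x : EuclideanSpace ℝ (Fin (d + 1))} (hx : x ∈ strip d l) (hfin : pot a b f x ≠ ∞) :
    pot a b f x < pot a b f (reflectAt l x) := by
  have hb : 0 ≤ b := by linarith
  have hS := (isOpen_strip (d := d) l).measurableSet
  have hsplit := setLIntegral_upper_eq l (measurable_kern_mul (a := a) (b := b) hf x)
  have hfin' : ∫⁻ y in upper d, kern a b x y * f y ≠ ∞ := hfin
  rw [pot, pot, setLIntegral_upper_eq l (measurable_kern_mul hf _),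
    setLIntegral_upper_eq l (measurable_kern_mul hf _)]
  rw [hsplit] at hfin'
  have hfinR := (ENNReal.add_ne_top.1 hfin').2
  refine ENNReal.add_lt_add_of_le_of_lt (ENNReal.add_ne_top.1 hfin').1
    (setLIntegral_mono' hS fun y hy => ?_) ?_
  · have h1 := add_mul_le_of_add_le_add (F := f y) (F' := f (reflectAt l y))
      (kern_reflectAt_add_le (a := a) hb hx hy)
      (kern_le_kern_reflectAt hb hx (by rw [reflectAt_last]; linarith [hy.2]))
    rwa [tsub_eq_zero_of_le (hle y hy), mul_zero, add_zero] at h1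
  · have hlt : ∀ y ∈ remainder d l, f y ≠ ∞ →
        kern a b x y * f y < kern a b (reflectAt l x) y * f y := fun y hy hy' =>
      ENNReal.mul_lt_mul_left (hpos y hy.1).ne' hy'
        (kern_lt_kern_reflectAt ha hab hx (le_of_mem_remainder hy))
    -- Points with yₙ > 2l have no mirror image in the half-space; this region of positive measure
    -- makes the inequality strict.
    have hR0 : volume (remainder d l) ≠ 0 := by
      have hsub : {y : EuclideanSpace ℝ (Fin (d + 1)) | 2 * l < y (Fin.last d)}
          ⊆ remainder d l := by
        intro y hy
        have hy' : 2 * l < y (Fin.last d) := hy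
        have hl : 0 < l := hx.1.trans hx.2
        refine ⟨by change 0 < y (Fin.last d); linarith, ?_⟩
        rintro (h | h)
        · linarith [h.2]
        · have h2 : 0 < reflectAt l y (Fin.last d) := h.1
          rw [reflectAt_last] at h2
          linarith
      have hopen : IsOpen {y : EuclideanSpace ℝ (Fin (d + 1)) | 2 * l < y (Fin.last d)} :=
        isOpen_lt continuous_const (by fun_prop)
      refine fun h0 => (hopen.measure_pos volume ⟨EuclideanSpace.single (Fin.last d) (2 * l + 1),
        ?_⟩).ne' (measure_mono_null hsub h0)
      simp
    have hae : ∀ᵐ y ∂(volume.restrict (remainder d l)), f y ≠ ∞ := by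
      have h1 := ae_lt_top (measurable_kern_mul hf x) hfinR
      filter_upwards [h1, ae_restrict_mem (measurableSet_remainder l)] with y hy hyR hytop
      rw [hytop, ENNReal.mul_top (kern_pos ha hb hx.1 hyR.1).ne'] at hy
      exact lt_irrefl _ hy
    refine lintegral_strict_mono (μ := volume.restrict (remainder d l)) (by simpa using hR0)
      (measurable_kern_mul hf _).aemeasurable hfinR ?_
    filter_upwards [hae, ae_restrict_mem (measurableSet_remainder l)] with y hy hyR
    exact hlt y hyR hy

end Reflection

end HalfSpace

namespace HalfSpace

/-! ### Riesz bounds for the half-space kernels and the smallness principle -/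

section Bounds

variable {d : ℕ} {a b : ℝ}

lemma abs_last_sub_le (x y : EuclideanSpace ℝ (Fin (d + 1))) :
    |x (Fin.last d) - y (Fin.last d)| ≤ ‖x - y‖ := by
  simpa using PiLp.norm_apply_le (x - y) (Fin.last d)

/-- Each kernel is thereby controlled by a Riesz kernel of order n + 2(a-b). On the diagonal the
right side is ∞, as 2(a-b) < 0. -/
lemma kern_le_riesz (ha : 0 < a) (hab : a < b) (x y : EuclideanSpace ℝ (Fin (d + 1))) :
    kern a b x y ≤ ENNReal.ofReal (1 / a + 1 / (b - a)) * ‖x - y‖ₑ ^ (2 * (a - b)) := by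
  have hba : 0 < b - a := by linarith
  rcases eq_or_ne x y with rfl | hxy
  · rw [sub_self, enorm_zero, ENNReal.zero_rpow_of_neg (by linarith), ENNReal.mul_top]
    · exact le_top
    · simp only [ne_eq, ENNReal.ofReal_eq_zero, not_le]; positivity
  · have hr : 0 < ‖x - y‖ := norm_pos_iff.2 (sub_ne_zero.2 hxy)
    refine (profile_le_right ha hab (by positivity)).trans (le_of_eq ?_)
    rw [ENNReal.ofReal_mul (by positivity), ← ofReal_norm, ENNReal.ofReal_rpow_of_pos hr,
      ← Real.rpow_natCast, ← Real.rpow_mul hr.le]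
    norm_cast

lemma kern_eq_zero {x y : EuclideanSpace ℝ (Fin (d + 1))} (hx : x ∉ upper d) (hy : y ∈ upper d) :
    kern a b x y = 0 := by
  have hx' : x (Fin.last d) ≤ 0 := not_lt.1 hx
  have hy' : 0 < y (Fin.last d) := hy
  have : 4 * x (Fin.last d) * y (Fin.last d) ≤ 0 := by nlinarith
  simp [kern, profile, Ioo_eq_empty_of_le this]

/-- The kernel gains a power of the distance to the boundary. -/
lemma exists_kern_le_weighted (ha : 0 < a) (hab : a < b) {φ : ℝ} (hφ0 : 0 ≤ φ) (hφ : φ ≤ a) :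
    ∃ C : ℝ≥0∞, C ≠ ∞ ∧ ∀ x y : EuclideanSpace ℝ (Fin (d + 1)), y ∈ upper d →
      kern a b x y
        ≤ C * (‖x - y‖ₑ ^ (2 * (a - b) - φ) * ENNReal.ofReal (y (Fin.last d)) ^ φ) := by
  have hba : 0 < b - a := by linarith
  set C₁ := 1 / a + 1 / (b - a) with hC₁
  refine ⟨ENNReal.ofReal (C₁ + 8 ^ a / a), ENNReal.ofReal_ne_top, fun x y hy => ?_⟩
  have hy' : 0 < y (Fin.last d) := hy
  by_cases hx : x ∈ upper d
  swap
  · rw [kern_eq_zero hx hy]; exact zero_le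
  have hx' : 0 < x (Fin.last d) := hx
  rcases eq_or_ne x y with rfl | hxy
  · rw [sub_self, enorm_zero, ENNReal.zero_rpow_of_neg (by linarith), ENNReal.top_mul,
      ENNReal.mul_top]
    · exact le_top
    · simp only [ne_eq, ENNReal.ofReal_eq_zero, not_le]; positivity
    · simp [ENNReal.rpow_eq_zero_iff, hy', not_lt.2 hφ0]
  have hr : 0 < ‖x - y‖ := norm_pos_iff.2 (sub_ne_zero.2 hxy)
  set r := ‖x - y‖ with hrdef
  set h := y (Fin.last d) with hh
  rw [← ofReal_norm, ← hrdef, ENNReal.ofReal_rpow_of_pos hr, ENNReal.ofReal_rpow_of_pos hy',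
    ← ENNReal.ofReal_mul (by positivity), ← ENNReal.ofReal_mul (by positivity)]
  -- For r ≤ h the factor r^φ is replaced by h^φ. For h ≤ r one has xₙ ≤ r + h ≤ 2r, so τ ≤ 8rh, and
  -- h^(a-φ) ≤ r^(a-φ).
  rcases le_total r h with hrh | hrh
  · refine (profile_le_right ha hab (by positivity)).trans (ENNReal.ofReal_le_ofReal ?_)
    have e1 : (r ^ 2) ^ (a - b) = r ^ (2 * (a - b) - φ) * r ^ φ := by
      rw [← Real.rpow_add hr, ← Real.rpow_natCast, ← Real.rpow_mul hr.le]
      norm_num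
    rw [← hC₁, e1]
    have : 0 ≤ C₁ := by positivity
    gcongr
    have : 0 ≤ 8 ^ a / a := by positivity
    linarith
  · refine (profile_le_left ha (by linarith) (by positivity) (by positivity)).trans
      (ENNReal.ofReal_le_ofReal ?_)
    have hxr : x (Fin.last d) ≤ 2 * r := by
      have := (abs_le.1 (abs_last_sub_le x y)).2
      linarith
    have e2 : (4 * x (Fin.last d) * h) ^ a ≤ 8 ^ a * (r ^ a * (r ^ (a - φ) * h ^ φ)) := by
      calc (4 * x (Fin.last d) * h) ^ a ≤ (8 * (r * h)) ^ a := by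
            apply Real.rpow_le_rpow (by positivity) _ ha.le
            nlinarith
        _ = 8 ^ a * (r ^ a * (h ^ (a - φ) * h ^ φ)) := by
            rw [← Real.rpow_add hy', sub_add_cancel, Real.mul_rpow (by positivity) (by positivity),
              Real.mul_rpow hr.le hy'.le]
        _ ≤ _ := by
            gcongr
    have e3 : (r ^ 2) ^ (-b) = r ^ (-(2 * b)) := by
      rw [← Real.rpow_natCast, ← Real.rpow_mul hr.le]
      norm_num
    have e4 : r ^ (2 * (a - b) - φ) = r ^ a * r ^ (a - φ) * r ^ (-(2 * b)) := by
      rw [← Real.rpow_add hr, ← Real.rpow_add hr]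
      congr 1
      ring
    calc (4 * x (Fin.last d) * h) ^ a * (r ^ 2) ^ (-b) / a
        ≤ 8 ^ a * (r ^ a * (r ^ (a - φ) * h ^ φ)) * r ^ (-(2 * b)) / a := by
          rw [e3]; gcongr
      _ = 8 ^ a / a * (r ^ (2 * (a - b) - φ) * h ^ φ) := by rw [e4]; ring
      _ ≤ _ := by
          gcongr
          have : 0 ≤ C₁ := by positivity
          linarith

/-- Hardy–Littlewood–Sobolev estimate for the composition of two half-space potentials. -/
lemma exists_setLIntegral_pot_pot_le {a₁ b₁ a₂ b₂ φ e : ℝ} (ha₁ : 0 < a₁) (hab₁ : a₁ < b₁)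
    (ha₂ : 0 < a₂) (hab₂ : a₂ < b₂) (hφ0 : 0 ≤ φ) (hφ : φ ≤ a₂) {β₁ β₂ : ℝ} (hβ₁0 : 0 < β₁)
    (hβ₂0 : 0 < β₂) (hβ₁ : β₁ = ((d + 1 : ℕ) : ℝ) + 2 * (a₁ - b₁))
    (hβ₂ : β₂ = ((d + 1 : ℕ) : ℝ) + 2 * (a₂ - b₂) - φ) (he : 0 < e)
    (heβ : e + (β₁ + β₂) / ((d + 1 : ℕ) : ℝ) < 1) :
    ∃ C : ℝ≥0∞, C ≠ ∞ ∧ ∀ (g : EuclideanSpace ℝ (Fin (d + 1)) → ℝ≥0∞) (A : ℝ≥0∞), Measurable g →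
      A ≠ 0 →
      (∀ E, MeasurableSet E →
        ∫⁻ y in E, ENNReal.ofReal (y (Fin.last d)) ^ φ * g y ≤ A * volume E ^ e) →
      ∀ E : Set (EuclideanSpace ℝ (Fin (d + 1))), MeasurableSet E → volume E ≠ ∞ →
        ∫⁻ x in E, pot a₁ b₁ (pot a₂ b₂ g) x
          ≤ C * A * volume E ^ (e + (β₁ + β₂) / ((d + 1 : ℕ) : ℝ)) := by
  set n : ℝ := ((d + 1 : ℕ) : ℝ) with hn
  have hn0 : 0 < n := by rw [hn]; positivity
  have hfr : (Module.finrank ℝ (EuclideanSpace ℝ (Fin (d + 1))) : ℝ) = n := by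
    rw [finrank_euclideanSpace_fin]
  have hdim : 1 ≤ Module.finrank ℝ (EuclideanSpace ℝ (Fin (d + 1))) := by
    rw [finrank_euclideanSpace_fin]; omega
  have hsum : (β₁ + β₂) / n = β₁ / n + β₂ / n := add_div _ _ _
  have h1n : 0 < β₁ / n := by positivity
  have h2n : 0 < β₂ / n := by positivity
  obtain ⟨C₂, hC₂, hC₂0, H₂⟩ := exists_setLIntegral_riesz_potential_le
    (volume : Measure (EuclideanSpace ℝ (Fin (d + 1)))) (β := β₂) (a := e) hβ₂0 he
    (by rw [hfr]; linarith) hdim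
  obtain ⟨C₁, hC₁, hC₁0, H₁⟩ := exists_setLIntegral_riesz_potential_le
    (volume : Measure (EuclideanSpace ℝ (Fin (d + 1)))) (β := β₁) (a := e + β₂ / n) hβ₁0
    (by positivity) (by rw [hfr]; linarith) hdim
  obtain ⟨D₂, hD₂, K₂⟩ := exists_kern_le_weighted (d := d) ha₂ hab₂ hφ0 hφ
  set D₁ := ENNReal.ofReal (1 / a₁ + 1 / (b₁ - a₁)) with hD₁
  refine ⟨D₁ * D₂ * (C₁ * C₂), ENNReal.mul_ne_top (ENNReal.mul_ne_top ENNReal.ofReal_ne_top hD₂)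
    (ENNReal.mul_ne_top hC₁ hC₂), fun g A hg hA hgA E hE hEfin => ?_⟩
  rw [hfr] at H₁ H₂
  set G : EuclideanSpace ℝ (Fin (d + 1)) → ℝ≥0∞ :=
    fun y => ENNReal.ofReal (y (Fin.last d)) ^ φ * g y with hG
  have hGm : Measurable G := by
    refine Measurable.mul (Measurable.pow_const ?_ _) hg
    fun_prop
  set F : EuclideanSpace ℝ (Fin (d + 1)) → ℝ≥0∞ :=
    fun z => ∫⁻ y, ‖z - y‖ₑ ^ (β₂ - n) * G y with hF
  have hFm : Measurable F := by
    refine Measurable.lintegral_prod_right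
      (f := fun z y : EuclideanSpace ℝ (Fin (d + 1)) => ‖z - y‖ₑ ^ (β₂ - n) * G y) ?_
    simp only [Function.uncurry_def]
    fun_prop
  have hpot₂ : ∀ z, pot a₂ b₂ g z ≤ D₂ * F z := by
    intro z
    rw [hF, ← lintegral_const_mul _ (by fun_prop)]
    refine (setLIntegral_mono' isOpen_upper.measurableSet fun y hy => ?_).trans
      (setLIntegral_le_lintegral _ _)
    calc kern a₂ b₂ z y * g y ≤ _ := mul_le_mul_left (K₂ z y hy) _
      _ = _ := by
        rw [hG, show 2 * (a₂ - b₂) - φ = β₂ - n by rw [hβ₂]; ring]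
        ring
  have hFA : ∀ E, MeasurableSet E → ∫⁻ z in E, F z ≤ C₂ * A * volume E ^ (e + β₂ / n) := by
    intro E hE
    rcases eq_or_ne (volume E) ∞ with h | h
    · rw [h, ENNReal.top_rpow_of_pos (by positivity), ENNReal.mul_top (mul_ne_zero hC₂0 hA)]
      exact le_top
    · exact H₂ G A hGm hgA E hE h
  have hpot₁ : ∀ x, pot a₁ b₁ (pot a₂ b₂ g) x
      ≤ D₁ * D₂ * ∫⁻ z, ‖x - z‖ₑ ^ (β₁ - n) * F z := by
    intro x
    rw [← lintegral_const_mul _ (by fun_prop)]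
    refine (lintegral_mono fun z => ?_).trans (setLIntegral_le_lintegral _ _)
    calc kern a₁ b₁ x z * pot a₂ b₂ g z
        ≤ (D₁ * ‖x - z‖ₑ ^ (2 * (a₁ - b₁))) * (D₂ * F z) :=
          mul_le_mul' (kern_le_riesz ha₁ hab₁ x z) (hpot₂ z)
      _ = _ := by
        rw [show 2 * (a₁ - b₁) = β₁ - n by rw [hβ₁]; ring]
        ring
  calc ∫⁻ x in E, pot a₁ b₁ (pot a₂ b₂ g) x
      ≤ ∫⁻ x in E, D₁ * D₂ * ∫⁻ z, ‖x - z‖ₑ ^ (β₁ - n) * F z :=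
        lintegral_mono fun x => hpot₁ x
    _ = D₁ * D₂ * ∫⁻ x in E, ∫⁻ z, ‖x - z‖ₑ ^ (β₁ - n) * F z :=
        lintegral_const_mul' _ _ (ENNReal.mul_ne_top ENNReal.ofReal_ne_top hD₂)
    _ ≤ D₁ * D₂ * (C₁ * (C₂ * A) * volume E ^ (e + β₂ / n + β₁ / n)) := by
        gcongr
        exact H₁ F _ hFm hFA E hE hEfin
    _ = _ := by
        rw [hsum, show e + β₂ / n + β₁ / n = e + (β₁ / n + β₂ / n) by ring]
        ring

/-- A nonnegative function dominated by the potential of its product with a small weight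
vanishes. -/
lemma exists_ae_eq_zero_of_le_pot_pot {a₁ b₁ a₂ b₂ φ s : ℝ} (ha₁ : 0 < a₁) (hab₁ : a₁ < b₁)
    (ha₂ : 0 < a₂) (hab₂ : a₂ < b₂) (hφ0 : 0 ≤ φ) (hφ : φ ≤ a₂) {β₁ β₂ : ℝ} (hβ₁0 : 0 < β₁)
    (hβ₂0 : 0 < β₂) (hβ₁ : β₁ = ((d + 1 : ℕ) : ℝ) + 2 * (a₁ - b₁))
    (hβ₂ : β₂ = ((d + 1 : ℕ) : ℝ) + 2 * (a₂ - b₂) - φ) (hs : 0 < s)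
    (hsβ : 1 / s + (β₁ + β₂) / ((d + 1 : ℕ) : ℝ) < 1) {C₀ : ℝ≥0∞} (hC₀ : C₀ ≠ ∞) :
    ∃ ε : ℝ≥0∞, ε ≠ 0 ∧ ∀ V W : EuclideanSpace ℝ (Fin (d + 1)) → ℝ≥0∞, Measurable V →
      Measurable W → (∀ x, V x ≠ ∞) →
      ∫⁻ y, (ENNReal.ofReal (y (Fin.last d)) ^ φ * V y) ^ (((d + 1 : ℕ) : ℝ) / (β₁ + β₂)) ≤ ε →
      ∫⁻ x, W x ^ s ≠ ∞ →
      (∀ x, W x ≤ C₀ * pot a₁ b₁ (pot a₂ b₂ fun y => V y * W y) x) →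
      W =ᵐ[volume] 0 := by
  set n : ℝ := ((d + 1 : ℕ) : ℝ) with hn
  have hn0 : 0 < n := by rw [hn]; positivity
  set θ := β₁ + β₂ with hθ
  have hθ0 : 0 < θ := by positivity
  set q := n / θ with hq
  have hq0 : 0 < q := by positivity
  have h1q : 1 / q = θ / n := by rw [hq, one_div_div]
  -- By Hölder, 1 - 1/s is the Marcinkiewicz exponent of a function in L^s. Multiplying by the
  -- weight lowers it by 1/q = θ/n, and the two potentials raise it back by θ/n.
  set A' := 1 - 1 / s with hA'
  have hA'0 : 0 < A' := by
    have : 0 < θ / n := by positivity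
    linarith
  have hs1 : 1 < s := by
    have : 1 / s < 1 := by linarith
    rwa [div_lt_one hs] at this
  have he : 0 < A' - 1 / q := by rw [h1q]; linarith
  have hqa : 1 < q * A' := by
    have := mul_pos hq0 he
    rw [mul_sub, mul_one_div_cancel hq0.ne'] at this
    linarith
  have hes : A' - 1 / q + θ / n = A' := by rw [h1q]; ring
  obtain ⟨C, hC, H⟩ := exists_setLIntegral_pot_pot_le (d := d) (e := A' - 1 / q) ha₁ hab₁ ha₂ hab₂
    hφ0 hφ hβ₁0 hβ₂0 hβ₁ hβ₂ he (by
      rw [← hn, ← hθ, hes]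
      have : 0 < 1 / s := by positivity
      linarith)
  rw [← hn, ← hθ, hes] at H
  set B := C₀ * (C * ENNReal.ofReal (1 + 1 / (q * A' - 1))) with hB
  have hBfin : B ≠ ∞ := ENNReal.mul_ne_top hC₀ (ENNReal.mul_ne_top hC ENNReal.ofReal_ne_top)
  -- With δ the size of the weight in L^q, one pass through the product and potential estimates
  -- halves the Marcinkiewicz constant of W.
  obtain ⟨δ, hδ0, hδ⟩ : ∃ δ : ℝ≥0∞, δ ≠ 0 ∧ δ ≠ ∞ ∧ B * δ ≤ 1 / 2 := by
    refine ⟨(1 / 2) / (B + 1), ?_, ?_, ?_⟩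
    · simp [hBfin]
    · exact ENNReal.div_ne_top (by simp) (by simp)
    · rw [← mul_div_assoc, mul_comm, mul_div_assoc]
      exact mul_le_of_le_one_right' (ENNReal.div_le_of_le_mul (by rw [one_mul]; exact le_self_add))
  obtain ⟨hδfin, hδB⟩ := hδ
  have hδq : (δ ^ q) ^ (1 / q) = δ := by
    rw [← ENNReal.rpow_mul, mul_one_div_cancel hq0.ne', ENNReal.rpow_one]
  have hδq0 : δ ^ q ≠ 0 := by simp [ENNReal.rpow_eq_zero_iff, hδ0, hδfin]
  have hδqfin : δ ^ q ≠ ∞ := ENNReal.rpow_ne_top_of_nonneg hq0.le hδfin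
  refine ⟨δ ^ q, hδq0, fun V W hV hW hVfin hVε hWs hWle => ?_⟩
  have hVφ : Measurable fun y : EuclideanSpace ℝ (Fin (d + 1)) =>
      ENNReal.ofReal (y (Fin.last d)) ^ φ * V y := by fun_prop
  have hstep : ∀ A : ℝ≥0∞, A ≠ 0 →
      (∀ E, MeasurableSet E → ∫⁻ x in E, W x ≤ A * volume E ^ A') →
      ∀ E, MeasurableSet E → ∫⁻ x in E, W x ≤ A / 2 * volume E ^ A' := by
    intro A hA hWA E hE
    rcases eq_or_ne (volume E) ∞ with h | h
    · rw [h, ENNReal.top_rpow_of_pos hA'0, ENNReal.mul_top (by simp [hA])]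
      exact le_top
    have hc : ENNReal.ofReal (1 + 1 / (q * A' - 1)) ≠ 0 := by
      have : 0 < q * A' - 1 := by linarith
      simp only [ne_eq, ENNReal.ofReal_eq_zero, not_le]
      positivity
    have h1 := H (fun y => V y * W y) (ENNReal.ofReal (1 + 1 / (q * A' - 1)) * δ * A)
      (hV.mul hW) (mul_ne_zero (mul_ne_zero hc hδ0) hA) (fun E hE => by
        rcases eq_or_ne (volume E) ∞ with h | h
        · rw [h, ENNReal.top_rpow_of_pos he,
            ENNReal.mul_top (mul_ne_zero (mul_ne_zero hc hδ0) hA)]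
          exact le_top
        · have h2 := setLIntegral_mul_le_of_marcinkiewicz hVφ hW
            (fun x => ENNReal.mul_ne_top
              (ENNReal.rpow_ne_top_of_nonneg hφ0 ENNReal.ofReal_ne_top) (hVfin x))
            hq0 hA'0 hqa hVε hδq0 hδqfin hWA hE h
          rw [hδq] at h2
          simpa only [mul_assoc] using h2) E hE h
    calc ∫⁻ x in E, W x
        ≤ ∫⁻ x in E, C₀ * pot a₁ b₁ (pot a₂ b₂ fun y => V y * W y) x :=
          lintegral_mono fun x => hWle x
      _ = C₀ * ∫⁻ x in E, pot a₁ b₁ (pot a₂ b₂ fun y => V y * W y) x :=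
          lintegral_const_mul' _ _ hC₀
      _ ≤ C₀ * (C * (ENNReal.ofReal (1 + 1 / (q * A' - 1)) * δ * A) * volume E ^ A') := by
          gcongr
      _ = (B * δ) * (A * volume E ^ A') := by rw [hB]; ring
      _ ≤ 1 / 2 * (A * volume E ^ A') := by gcongr
      _ = A / 2 * volume E ^ A' := by rw [one_div, div_eq_mul_inv]; ring
  set M := (∫⁻ x, W x ^ s) ^ (1 / s) + 1 with hM
  have hM0 : M ≠ 0 := by simp [hM]
  have hMfin : M ≠ ∞ := by
    rw [hM]
    exact ENNReal.add_ne_top.2 ⟨ENNReal.rpow_ne_top_of_nonneg (by positivity) hWs, by simp⟩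
  -- W ∈ L^s supplies a finite constant to start from; repeated halving drives it to 0.
  have hall : ∀ k : ℕ, ∀ E, MeasurableSet E → ∫⁻ x in E, W x ≤ M / 2 ^ k * volume E ^ A' := by
    intro k
    induction k with
    | zero =>
      intro E hE
      have hconj : s.HolderConjugate (1 / A') := by
        rw [Real.holderConjugate_iff]
        refine ⟨hs1, ?_⟩
        rw [one_div, inv_inv, hA', one_div]
        ring
      have h1 := ENNReal.lintegral_mul_le_Lp_mul_Lq (volume.restrict E) hconj hW.aemeasurable
        (g := fun _ => 1) aemeasurable_const
      simp only [Pi.mul_apply, mul_one, ENNReal.one_rpow, lintegral_const, one_mul,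
        Measure.restrict_apply_univ, one_div_one_div] at h1
      refine h1.trans ?_
      simp only [pow_zero, div_one]
      gcongr
      refine le_trans ?_ le_self_add
      gcongr
      exact Measure.restrict_le_self
    | succ k ih =>
      intro E hE
      have := hstep _ (by simp [hM0]) ih E hE
      refine this.trans (le_of_eq ?_)
      rw [pow_succ, ENNReal.div_eq_inv_mul, ENNReal.div_eq_inv_mul, ENNReal.div_eq_inv_mul,
        ENNReal.mul_inv (by simp) (by simp)]
      ring
  have hzero : ∀ E, MeasurableSet E → volume E < ∞ → ∫⁻ x in E, W x = 0 := by
    intro E hE hEfin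
    have hlim : Filter.Tendsto (fun k : ℕ => M / 2 ^ k * volume E ^ A') Filter.atTop (nhds 0) := by
      have h2 : Filter.Tendsto (fun k : ℕ => (2⁻¹ : ℝ≥0∞) ^ k) Filter.atTop (nhds 0) :=
        ENNReal.tendsto_pow_atTop_nhds_zero_of_lt_one (by simp)
      have h3 := ENNReal.Tendsto.const_mul (a := M * volume E ^ A') h2 (Or.inr
        (ENNReal.mul_ne_top hMfin (ENNReal.rpow_ne_top_of_nonneg hA'0.le hEfin.ne)))
      rw [mul_zero] at h3
      refine h3.congr fun k => ?_
      rw [div_eq_mul_inv, ENNReal.inv_pow]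
      ring
    exact le_antisymm (ge_of_tendsto' hlim fun k => hall k E hE) zero_le
  refine ae_eq_of_forall_setLIntegral_eq_of_sigmaFinite hW measurable_const fun E hE hEfin => ?_
  rw [hzero E hE hEfin]
  simp

end Bounds

end HalfSpace

namespace HalfSpace

/-! ### The method of moving planes -/

section MovingPlanes

open Filter Topology

variable {d : ℕ}

/-- `U` is a continuous, finite solution of `U = C ∫ K₁ ∫ K₂ U^p` on the half-space with
`U ∈ L^s`, extended by zero. -/
structure IsPotSol (a₁ b₁ a₂ b₂ p s : ℝ) (C : ℝ≥0∞)
    (U : EuclideanSpace ℝ (Fin (d + 1)) → ℝ≥0∞) : Prop where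
  meas : Measurable U
  fin : ∀ x, U x ≠ ∞
  off : ∀ x, x ∉ upper d → U x = 0
  cont : ContinuousOn U (upper d)
  int : ∫⁻ x, U x ^ s ≠ ∞
  eq : ∀ x ∈ upper d, U x = C * pot a₁ b₁ (pot a₂ b₂ fun y => U y ^ p) x

/-- Convexity of t^p, in the form of Bernoulli's inequality for y/x; it linearises the nonlinearity
in the gap. -/
lemma rpow_sub_rpow_le {p : ℝ} (hp : 1 ≤ p) {x y : ℝ≥0∞} (hx : x ≠ ∞) :
    x ^ p - y ^ p ≤ ENNReal.ofReal p * (x ^ (p - 1) * (x - y)) := by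
  have hp0 : 0 ≤ p := by linarith
  rcases le_total x y with h | h
  · rw [tsub_eq_zero_of_le (ENNReal.rpow_le_rpow h hp0)]
    exact zero_le
  have hy : y ≠ ∞ := (h.trans_lt hx.lt_top).ne
  lift x to NNReal using hx
  lift y to NNReal using hy
  have h' : (y : ℝ) ≤ x := by exact_mod_cast h
  rcases eq_or_ne x 0 with rfl | hx0
  · have : y = 0 := le_antisymm (by exact_mod_cast h) zero_le
    simp [this]
  have hx0' : (0 : ℝ) < x := by positivity
  have hreal : (x : ℝ) ^ p - (y : ℝ) ^ p ≤ p * ((x : ℝ) ^ (p - 1) * (x - y)) := by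
    have hb := one_add_mul_self_le_rpow_one_add (s := (y : ℝ) / x - 1) (by
      have : 0 ≤ (y : ℝ) / x := by positivity
      linarith) hp
    rw [add_sub_cancel, Real.div_rpow y.coe_nonneg x.coe_nonneg, le_div_iff₀ (by positivity)] at hb
    rw [Real.rpow_sub_one hx0'.ne']
    calc (x : ℝ) ^ p - (y : ℝ) ^ p ≤ (x : ℝ) ^ p - (1 + p * ((y : ℝ) / x - 1)) * (x : ℝ) ^ p := by
          linarith
      _ = _ := by field_simp; ring
  have e1 : (x : ℝ≥0∞) = ENNReal.ofReal x := (ENNReal.ofReal_coe_nnreal).symm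
  have e2 : (y : ℝ≥0∞) = ENNReal.ofReal y := (ENNReal.ofReal_coe_nnreal).symm
  rw [e1, e2, ENNReal.ofReal_rpow_of_nonneg y.coe_nonneg hp0, ENNReal.ofReal_rpow_of_nonneg x.coe_nonneg hp0,
    ENNReal.ofReal_rpow_of_pos hx0', ← ENNReal.ofReal_sub _ y.coe_nonneg,
    ← ENNReal.ofReal_sub _ (Real.rpow_nonneg y.coe_nonneg _), ← ENNReal.ofReal_mul (by positivity),
    ← ENNReal.ofReal_mul hp0]
  exact ENNReal.ofReal_le_ofReal hreal

lemma pot_const_mul {a b : ℝ} {c : ℝ≥0∞} (hc : c ≠ ∞)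
    (f : EuclideanSpace ℝ (Fin (d + 1)) → ℝ≥0∞) (x : EuclideanSpace ℝ (Fin (d + 1))) :
    pot a b (fun y => c * f y) x = c * pot a b f x := by
  rw [pot, pot, ← lintegral_const_mul' _ _ hc]
  refine lintegral_congr fun y => ?_
  ring

lemma pot_pos {a b : ℝ} (ha : 0 < a) (hb : 0 ≤ b)
    {f : EuclideanSpace ℝ (Fin (d + 1)) → ℝ≥0∞} (hf : Measurable f)
    {O : Set (EuclideanSpace ℝ (Fin (d + 1)))} (hO : IsOpen O) (hne : O.Nonempty)
    (hsub : O ⊆ upper d) (hpos : ∀ y ∈ O, 0 < f y)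
    {x : EuclideanSpace ℝ (Fin (d + 1))} (hx : x ∈ upper d) : 0 < pot a b f x := by
  rw [pot, setLIntegral_pos_iff (measurable_kern_mul hf x)]
  refine (hO.measure_pos volume hne).trans_le (measure_mono fun y hy => ⟨?_, hsub hy⟩)
  exact (ENNReal.mul_pos (kern_pos ha hb hx (hsub hy)).ne' (hpos y hy).ne').ne'

/-- The positive part of `U - U ∘ reflectAt l` in the strip `0 < xₙ < l`. -/
noncomputable def gap (U : EuclideanSpace ℝ (Fin (d + 1)) → ℝ≥0∞) (l : ℝ) :
    EuclideanSpace ℝ (Fin (d + 1)) → ℝ≥0∞ :=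
  (strip d l).indicator fun x => U x - U (reflectAt l x)

lemma volume_last_eq (c : ℝ) :
    volume {x : EuclideanSpace ℝ (Fin (d + 1)) | x (Fin.last d) = c} = 0 := by
  have h := (PiLp.volume_preserving_ofLp (Fin (d + 1))).measure_preimage
    (s := {f : Fin (d + 1) → ℝ | f (Fin.last d) = c})
    (measurableSet_eq_fun (by fun_prop) measurable_const).nullMeasurableSet
  have h2 : volume {f : Fin (d + 1) → ℝ | f (Fin.last d) = c} = 0 := by
    rw [volume_pi]
    exact Measure.pi_hyperplane (α := fun _ : Fin (d + 1) => ℝ) (fun _ => volume) (Fin.last d) c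
  rw [h2] at h
  exact h

namespace IsPotSol

variable {a₁ b₁ a₂ b₂ p s : ℝ} {C : ℝ≥0∞} {U : EuclideanSpace ℝ (Fin (d + 1)) → ℝ≥0∞}

lemma meas_gap (h : IsPotSol a₁ b₁ a₂ b₂ p s C U) (l : ℝ) : Measurable (gap U l) :=
  (h.meas.sub (h.meas.comp (continuous_reflectAt l).measurable)).indicator
    (isOpen_strip l).measurableSet

lemma meas_pow (h : IsPotSol a₁ b₁ a₂ b₂ p s C U) (r : ℝ) : Measurable fun y => U y ^ r :=
  h.meas.pow_const r

/-- The reflection comparison is applied to the outer and then to the inner potential;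
`rpow_sub_rpow_le` bounds the innermost error by p U^(p-1) times the gap. -/
lemma gap_le (h : IsPotSol a₁ b₁ a₂ b₂ p s C U) (hb₁ : 0 ≤ b₁) (hb₂ : 0 ≤ b₂) (hp : 1 ≤ p)
    (l : ℝ) (x : EuclideanSpace ℝ (Fin (d + 1))) :
    gap U l x ≤ C * ENNReal.ofReal p *
      pot a₁ b₁ (pot a₂ b₂ fun y => U y ^ (p - 1) * gap U l y) x := by
  by_cases hx : x ∈ strip d l
  swap
  · simp [gap, hx]
  have hmf := measurable_pot (a := a₂) (b := b₂) (h.meas_pow p)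
  have h1 := pot_le_pot_reflectAt_add (a := a₁) hb₁ hmf hx
  have h2 : ∀ z ∈ upper d, (strip d l).indicator (fun z => pot a₂ b₂ (fun y => U y ^ p) z
      - pot a₂ b₂ (fun y => U y ^ p) (reflectAt l z)) z
      ≤ ENNReal.ofReal p * pot a₂ b₂ (fun y => U y ^ (p - 1) * gap U l y) z := by
    intro z _
    by_cases hz : z ∈ strip d l
    swap
    · simp [hz]
    rw [indicator_of_mem hz, tsub_le_iff_left]
    refine (pot_le_pot_reflectAt_add hb₂ (h.meas_pow p) hz).trans ?_
    gcongr
    rw [← pot_const_mul ENNReal.ofReal_ne_top]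
    refine pot_mono (fun y _ => ?_) z
    by_cases hy : y ∈ strip d l
    swap
    · simp [hy]
    rw [gap, indicator_of_mem hy, indicator_of_mem hy]
    exact rpow_sub_rpow_le hp (h.fin y)
  rw [gap, indicator_of_mem hx, tsub_le_iff_left, h.eq x (strip_subset_upper hx),
    h.eq _ (reflectAt_mem_upper hx), mul_assoc C, ← mul_add]
  gcongr
  refine h1.trans ?_
  gcongr
  rw [← pot_const_mul ENNReal.ofReal_ne_top]
  exact pot_mono h2 x

/-- By continuity U is positive on an open set, and the positive kernels spread this to the whole
half-space. -/
lemma pos (h : IsPotSol a₁ b₁ a₂ b₂ p s C U) (ha₁ : 0 < a₁) (hab₁ : a₁ < b₁)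
    (ha₂ : 0 < a₂) (hab₂ : a₂ < b₂) (hC0 : C ≠ 0)
    {x₁ : EuclideanSpace ℝ (Fin (d + 1))} (hx₁ : x₁ ∈ upper d) (hU : U x₁ ≠ 0) :
    (∀ z ∈ upper d, 0 < pot a₂ b₂ (fun y => U y ^ p) z) ∧ ∀ x ∈ upper d, 0 < U x := by
  have hO : IsOpen (upper d ∩ U ⁻¹' Ioi 0) := h.cont.isOpen_inter_preimage isOpen_upper isOpen_Ioi
  have hf : ∀ z ∈ upper d, 0 < pot a₂ b₂ (fun y => U y ^ p) z := fun z hz =>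
    pot_pos ha₂ (by linarith) (h.meas_pow p) hO ⟨x₁, hx₁, pos_iff_ne_zero.2 hU⟩ inter_subset_left
      (fun y hy => ENNReal.rpow_pos hy.2 (h.fin y)) hz
  refine ⟨hf, fun x hx => ?_⟩
  rw [h.eq x hx]
  exact ENNReal.mul_pos hC0 (pot_pos ha₁ (by linarith) (measurable_pot (h.meas_pow p)) isOpen_upper
    ⟨x₁, hx₁⟩ subset_rfl hf hx).ne'

/-- A strong maximum principle: the weak inequality passes to the inner potential, and the outer
potential makes it strict. -/
lemma lt_reflectAt (h : IsPotSol a₁ b₁ a₂ b₂ p s C U) (ha₁ : 0 < a₁) (hab₁ : a₁ < b₁)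
    (ha₂ : 0 < a₂) (hab₂ : a₂ < b₂) (hp : 1 < p) (hC0 : C ≠ 0) (hC : C ≠ ∞)
    (hpos : ∀ z ∈ upper d, 0 < pot a₂ b₂ (fun y => U y ^ p) z) {l : ℝ}
    (hl : ∀ x ∈ strip d l, U x ≤ U (reflectAt l x)) {x : EuclideanSpace ℝ (Fin (d + 1))}
    (hx : x ∈ strip d l) : U x < U (reflectAt l x) := by
  have hfle : ∀ z ∈ strip d l, pot a₂ b₂ (fun y => U y ^ p) z
      ≤ pot a₂ b₂ (fun y => U y ^ p) (reflectAt l z) := by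
    intro z hz
    have h1 := pot_le_pot_reflectAt_add (a := a₂) (b := b₂) (by linarith) (h.meas_pow p) hz
    have h2 : ((strip d l).indicator fun y => U y ^ p - U (reflectAt l y) ^ p) = fun _ => 0 := by
      funext y
      by_cases hy : y ∈ strip d l
      · rw [indicator_of_mem hy]
        exact tsub_eq_zero_of_le (ENNReal.rpow_le_rpow (hl y hy) (by linarith))
      · simp [hy]
    rw [h2] at h1
    simpa [pot] using h1
  have hxu := strip_subset_upper hx
  have hfin : pot a₁ b₁ (pot a₂ b₂ fun y => U y ^ p) x ≠ ∞ := by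
    intro htop
    have := h.eq x hxu
    rw [htop, ENNReal.mul_top hC0] at this
    exact h.fin x this
  rw [h.eq x hxu, h.eq _ (reflectAt_mem_upper hx)]
  exact ENNReal.mul_lt_mul_right hC0 hC (pot_lt_pot_reflectAt ha₁ hab₁ (measurable_pot (h.meas_pow p)) hpos
    hfle hx hfin)

lemma continuousOn_reflectAt (h : IsPotSol a₁ b₁ a₂ b₂ p s C U) (l : ℝ) :
    ContinuousOn (fun x => U (reflectAt l x)) (strip d l) :=
  h.cont.comp (continuous_reflectAt l).continuousOn fun _ hx => reflectAt_mem_upper hx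

lemma tendsto_reflectAt (h : IsPotSol a₁ b₁ a₂ b₂ p s C U) {l : ℝ}
    {x : EuclideanSpace ℝ (Fin (d + 1))} (hx : reflectAt l x ∈ upper d) :
    Tendsto (fun l' => U (reflectAt l' x)) (𝓝 l) (𝓝 (U (reflectAt l x))) := by
  have h1 : ContinuousAt U (reflectAt l x) := h.cont.continuousAt (isOpen_upper.mem_nhds hx)
  have h2 : Continuous fun l' : ℝ => reflectAt l' x := by
    have : Continuous fun l' : ℝ => EuclideanSpace.single (𝕜 := ℝ) (Fin.last d) (2 * l') := by
      refine (PiLp.continuous_toLp 2 _).comp (continuous_pi fun i => ?_)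
      by_cases hi : i = Fin.last d
      · subst hi; simp only [Pi.single_eq_same]; fun_prop
      · simp only [Pi.single_eq_of_ne hi]; fun_prop
    exact continuous_const.add this
  exact h1.tendsto.comp h2.continuousAt

/-- The planes can be moved a little further to the right. -/
lemma eventually_le_reflectAt (h : IsPotSol a₁ b₁ a₂ b₂ p s C U) (ha₁ : 0 < a₁) (hab₁ : a₁ < b₁)
    (ha₂ : 0 < a₂) (hab₂ : a₂ < b₂) {φ : ℝ} (hφ0 : 0 ≤ φ) (hφ : φ ≤ a₂) {β₁ β₂ : ℝ} (hβ₁0 : 0 < β₁)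
    (hβ₂0 : 0 < β₂) (hβ₁ : β₁ = ((d + 1 : ℕ) : ℝ) + 2 * (a₁ - b₁))
    (hβ₂ : β₂ = ((d + 1 : ℕ) : ℝ) + 2 * (a₂ - b₂) - φ) (hs : 0 < s)
    (hsβ : 1 / s + (β₁ + β₂) / ((d + 1 : ℕ) : ℝ) < 1) (hp : 1 < p) (hC : C ≠ ∞)
    (hQ : ∫⁻ y, (ENNReal.ofReal (y (Fin.last d)) ^ φ * U y ^ (p - 1)) ^
      (((d + 1 : ℕ) : ℝ) / (β₁ + β₂)) ≠ ∞) {l₀ : ℝ}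
    (hl₀ : ∀ x ∈ strip d l₀, U x < U (reflectAt l₀ x)) :
    ∀ᶠ l in 𝓝[>] l₀, ∀ x ∈ strip d l, U x ≤ U (reflectAt l x) := by
  obtain ⟨ε, hε, H⟩ := exists_ae_eq_zero_of_le_pot_pot (d := d) (C₀ := C * ENNReal.ofReal p) ha₁ hab₁
    ha₂ hab₂ hφ0 hφ hβ₁0 hβ₂0 hβ₁ hβ₂ hs hsβ (ENNReal.mul_ne_top hC ENNReal.ofReal_ne_top)
  set q := ((d + 1 : ℕ) : ℝ) / (β₁ + β₂) with hq
  have hq0 : 0 < q := by positivity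
  set Q : EuclideanSpace ℝ (Fin (d + 1)) → ℝ≥0∞ :=
    fun y => (ENNReal.ofReal (y (Fin.last d)) ^ φ * U y ^ (p - 1)) ^ q with hQdef
  have hUm := h.meas
  have hQm : Measurable Q := by fun_prop
  have hsupp : ∀ l, MeasurableSet {y | gap U l y ≠ 0} := fun l =>
    (measurableSet_eq_fun (h.meas_gap l) measurable_const).compl
  -- Strictness at l₀ and continuity of U make almost every point leave the support of the gap as l
  -- ↓ l₀, so the weighted integral over that support tends to 0.
  have hlim : Tendsto (fun l => ∫⁻ y, {y | gap U l y ≠ 0}.indicator Q y) (𝓝[>] l₀)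
      (𝓝 (∫⁻ _ : EuclideanSpace ℝ (Fin (d + 1)), 0)) := by
    refine tendsto_lintegral_filter_of_dominated_convergence Q
      (Eventually.of_forall fun l => hQm.indicator (hsupp l))
      (Eventually.of_forall fun l => Eventually.of_forall fun y => indicator_le_self _ _ _) hQ ?_
    -- Points on the plane xₙ = l₀ enter every later strip with no strict inequality to start from,
    -- but they form a null set.
    have hne : ∀ᵐ y : EuclideanSpace ℝ (Fin (d + 1)), y (Fin.last d) ≠ l₀ := by
      rw [ae_iff]
      simpa using volume_last_eq l₀
    filter_upwards [hne] with y hy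
    refine tendsto_const_nhds.congr' ?_
    have hev : ∀ᶠ l in 𝓝[>] l₀, gap U l y = 0 := by
      by_cases hyu : y ∈ upper d
      swap
      · exact Eventually.of_forall fun l => indicator_of_notMem (fun hys => hyu hys.1) _
      rcases lt_or_gt_of_ne hy with h1 | h1
      · have hys : y ∈ strip d l₀ := ⟨hyu, h1⟩
        have h2 := (h.tendsto_reflectAt (reflectAt_mem_upper hys)).eventually_const_lt (hl₀ y hys)
        filter_upwards [nhdsWithin_le_nhds h2] with l hl
        by_cases hyl : y ∈ strip d l
        · rw [gap, indicator_of_mem hyl]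
          exact tsub_eq_zero_of_le hl.le
        · exact indicator_of_notMem hyl _
      · filter_upwards [nhdsWithin_le_nhds (eventually_lt_nhds h1)] with l hl
        exact indicator_of_notMem (fun hys => absurd hys.2 (not_lt.2 hl.le)) _
    filter_upwards [hev] with l hl
    simp [hl]
  rw [lintegral_zero] at hlim
  filter_upwards [hlim.eventually_le_const (pos_iff_ne_zero.2 hε)] with l hl
  -- Cutting U^(p-1) off to the support of the gap leaves the product unchanged and makes the weight
  -- small.
  have hgap0 : gap U l =ᵐ[volume] 0 := by
    refine H ({y | gap U l y ≠ 0}.indicator fun y => U y ^ (p - 1)) (gap U l)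
      ((h.meas_pow _).indicator (hsupp l)) (h.meas_gap l) (fun x => ?_) ?_ ?_ fun x => ?_
    · by_cases hx : gap U l x = 0
      · simp [hx]
      · simp only [ne_eq, mem_ofPred_eq, hx, not_false_eq_true, indicator_of_mem]
        exact ENNReal.rpow_ne_top_of_nonneg (by linarith) (h.fin x)
    · refine le_trans (le_of_eq (lintegral_congr fun y => ?_)) hl
      by_cases hx : gap U l y = 0
      · simp [hx, hq0]
      · simp [hx, hQdef]
    · refine ((lintegral_mono fun x => ?_).trans_lt h.int.lt_top).ne
      refine ENNReal.rpow_le_rpow ?_ hs.le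
      refine indicator_le' (fun y _ => tsub_le_self) (fun y _ => zero_le) x
    · refine (h.gap_le (by linarith) (by linarith) hp.le l x).trans (le_of_eq ?_)
      congr 3
      funext y
      by_cases hx : gap U l y = 0
      · simp [hx]
      · simp [hx]
  have hopen : IsOpen (strip d l ∩ {x | U (reflectAt l x) < U x}) := by
    have := ((h.continuousOn_reflectAt l).prodMk
      (h.cont.mono strip_subset_upper)).isOpen_inter_preimage (isOpen_strip l)
      (isOpen_lt (continuous_fst (X := ℝ≥0∞) (Y := ℝ≥0∞)) continuous_snd)
    exact this
  intro x hx
  by_contra hcon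
  have hnull : volume (strip d l ∩ {x | U (reflectAt l x) < U x}) = 0 := by
    refine measure_mono_null (fun y hy => ?_) (ae_iff.1 hgap0)
    simp only [mem_ofPred_eq, Pi.zero_apply]
    rw [gap, indicator_of_mem hy.1]
    exact (tsub_pos_of_lt hy.2).ne'
  exact (hopen.measure_pos volume ⟨x, hx, not_le.1 hcon⟩).ne' hnull

/-- Tails of the integral of `U^s` in the normal direction are small. -/
lemma tendsto_tail (h : IsPotSol a₁ b₁ a₂ b₂ p s C U) :
    Tendsto (fun R : ℝ => ∫⁻ x in {x : EuclideanSpace ℝ (Fin (d + 1)) | R < x (Fin.last d)},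
      U x ^ s) atTop (𝓝 0) := by
  have hm : ∀ R : ℝ, MeasurableSet {x : EuclideanSpace ℝ (Fin (d + 1)) | R < x (Fin.last d)} :=
    fun R => measurableSet_lt measurable_const (by fun_prop)
  have hlim : Tendsto (fun R : ℝ => ∫⁻ x,
      {x : EuclideanSpace ℝ (Fin (d + 1)) | R < x (Fin.last d)}.indicator (fun x => U x ^ s) x) atTop
      (𝓝 (∫⁻ _ : EuclideanSpace ℝ (Fin (d + 1)), 0)) := by
    refine tendsto_lintegral_filter_of_dominated_convergence (fun x => U x ^ s)
      (Eventually.of_forall fun R => (h.meas_pow s).indicator (hm R))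
      (Eventually.of_forall fun R => Eventually.of_forall fun y => indicator_le_self _ _ _) h.int ?_
    refine Eventually.of_forall fun x => tendsto_const_nhds.congr' ?_
    filter_upwards [eventually_ge_atTop (x (Fin.last d))] with R hR
    rw [indicator_of_notMem]
    exact not_lt.2 hR
  rw [lintegral_zero] at hlim
  refine hlim.congr fun R => lintegral_indicator (hm R) _

/-- The admissible l form a closed set, open to the right, containing 0 because the strip is then
empty; so all l ≥ 0 are admissible and U is nondecreasing in xₙ. Translating by R·eₙ shows that the
integral of U^s over xₙ > R does not decay in R, although the tails must tend to 0. -/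
theorem eq_zero_of_weighted (h : IsPotSol a₁ b₁ a₂ b₂ p s C U) (ha₁ : 0 < a₁) (hab₁ : a₁ < b₁)
    (ha₂ : 0 < a₂) (hab₂ : a₂ < b₂) {φ : ℝ} (hφ0 : 0 ≤ φ) (hφ : φ ≤ a₂) {β₁ β₂ : ℝ} (hβ₁0 : 0 < β₁)
    (hβ₂0 : 0 < β₂) (hβ₁ : β₁ = ((d + 1 : ℕ) : ℝ) + 2 * (a₁ - b₁))
    (hβ₂ : β₂ = ((d + 1 : ℕ) : ℝ) + 2 * (a₂ - b₂) - φ) (hs : 0 < s)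
    (hsβ : 1 / s + (β₁ + β₂) / ((d + 1 : ℕ) : ℝ) < 1) (hp : 1 < p) (hC0 : C ≠ 0) (hC : C ≠ ∞)
    (hQ : ∫⁻ y, (ENNReal.ofReal (y (Fin.last d)) ^ φ * U y ^ (p - 1)) ^
      (((d + 1 : ℕ) : ℝ) / (β₁ + β₂)) ≠ ∞) :
    ∀ x ∈ upper d, U x = 0 := by
  intro x₁ hx₁
  by_contra hUx₁
  obtain ⟨hpos, hUpos⟩ := h.pos ha₁ hab₁ ha₂ hab₂ hC0 hx₁ hUx₁
  have hall : ∀ l > 0, ∀ x ∈ strip d l, U x ≤ U (reflectAt l x) := by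
    intro L hL
    set S : Set ℝ := {l | ∀ x ∈ strip d l, U x ≤ U (reflectAt l x)} with hS
    have hclosed : IsClosed (S ∩ Icc 0 L) := by
      refine IsClosed.inter ?_ isClosed_Icc
      rw [← closure_subset_iff_isClosed]
      intro l hl x hx
      by_contra hcon
      have h1 := (h.tendsto_reflectAt (reflectAt_mem_upper hx)).eventually_lt_const (not_le.1 hcon)
      have h2 : ∀ᶠ l' in 𝓝 l, x (Fin.last d) < l' := eventually_gt_nhds hx.2
      obtain ⟨l', hl'S, hl'1, hl'2⟩ := ((mem_closure_iff_frequently.1 hl).and_eventually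
        (h1.and h2)).exists
      exact absurd (hl'S x ⟨hx.1, hl'2⟩) (not_le.2 hl'1)
    have hsub : Icc 0 L ⊆ S := by
      refine hclosed.Icc_subset_of_forall_mem_nhdsWithin ?_ fun l hl => ?_
      · intro x hx
        linarith [hx.1, hx.2]
      · exact h.eventually_le_reflectAt ha₁ hab₁ ha₂ hab₂ hφ0 hφ hβ₁0 hβ₂0 hβ₁ hβ₂ hs hsβ hp hC hQ
          fun x hx => h.lt_reflectAt ha₁ hab₁ ha₂ hab₂ hp hC0 hC hpos hl.1 hx
    exact hsub ⟨hL.le, le_rfl⟩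
  have hmono : ∀ x ∈ upper d, ∀ R > 0, U x ≤ U (x + EuclideanSpace.single (Fin.last d) R) := by
    intro x hx R hR
    have hx' : 0 < x (Fin.last d) := hx
    have h1 := hall (x (Fin.last d) + R / 2) (by linarith) x ⟨hx, by linarith⟩
    have h2 : reflectAt (x (Fin.last d) + R / 2) x = x + EuclideanSpace.single (Fin.last d) R := by
      refine ext_last (fun i => ?_) ?_
      · simp
      · simp; ring
    rwa [h2] at h1
  set I := ∫⁻ x in upper d, U x ^ s with hI
  have hI0 : 0 < I := by
    rw [hI, setLIntegral_pos_iff (h.meas_pow s)]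
    refine (isOpen_upper.measure_pos volume ⟨x₁, hx₁⟩).trans_le (measure_mono fun y hy => ⟨?_, hy⟩)
    exact (ENNReal.rpow_pos (hUpos y hy) (h.fin y)).ne'
  have hge : ∀ R > 0, I ≤ ∫⁻ x in {x : EuclideanSpace ℝ (Fin (d + 1)) | R < x (Fin.last d)},
      U x ^ s := by
    intro R hR
    have hm : MeasurableSet {x : EuclideanSpace ℝ (Fin (d + 1)) | R < x (Fin.last d)} :=
      measurableSet_lt measurable_const (by fun_prop)
    have h1 := (measurePreserving_add_right volume
      (EuclideanSpace.single (Fin.last d) R)).setLIntegral_comp_preimage hm (h.meas_pow s)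
    rw [← h1]
    have h2 : (fun x : EuclideanSpace ℝ (Fin (d + 1)) => x + EuclideanSpace.single (Fin.last d) R) ⁻¹'
        {x | R < x (Fin.last d)} = upper d := by
      ext x
      simp [upper]
    rw [h2]
    exact setLIntegral_mono' isOpen_upper.measurableSet fun x hx =>
      ENNReal.rpow_le_rpow (hmono x hx R hR) hs.le
  have := ge_of_tendsto h.tendsto_tail ((eventually_gt_atTop 0).mono hge)
  exact absurd hI0 (not_lt.2 this)

end IsPotSol

end MovingPlanes

end HalfSpace

namespace HalfSpace

/-! ### Local upper bounds, Harnack inequality and lower bounds for the double potential -/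

section Interior

open Filter Topology Metric

variable {d : ℕ}

lemma volume_ball_eq (x : EuclideanSpace ℝ (Fin (d + 1))) {r : ℝ} (hr : 0 < r) :
    volume (ball x r) = ENNReal.ofReal (r ^ ((d + 1 : ℕ) : ℝ))
      * volume (ball (0 : EuclideanSpace ℝ (Fin (d + 1))) 1) := by
  rw [Measure.addHaar_ball _ _ hr.le, finrank_euclideanSpace_fin, Real.rpow_natCast]

/-- The volume of the unit ball, as a real number. -/
noncomputable def unitVol (d : ℕ) : ℝ :=
  (volume (ball (0 : EuclideanSpace ℝ (Fin (d + 1))) 1)).toReal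

lemma unitVol_pos : 0 < unitVol d :=
  ENNReal.toReal_pos (measure_ball_pos volume _ one_pos).ne' measure_ball_lt_top.ne

lemma volume_ball_eq_ofReal (x : EuclideanSpace ℝ (Fin (d + 1))) {r : ℝ} (hr : 0 < r) :
    volume (ball x r) = ENNReal.ofReal (r ^ ((d + 1 : ℕ) : ℝ) * unitVol d) := by
  rw [volume_ball_eq x hr, ENNReal.ofReal_mul (by positivity), unitVol,
    ENNReal.ofReal_toReal measure_ball_lt_top.ne]

lemma last_le_of_mem_ball {x y : EuclideanSpace ℝ (Fin (d + 1))} {r : ℝ} (h : y ∈ ball x r) :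
    |y (Fin.last d) - x (Fin.last d)| < r :=
  (abs_last_sub_le y x).trans_lt (by rwa [mem_ball, dist_eq_norm] at h)

/-- Lower bound for the kernel at points whose distance is at most comparable to their distance to
the boundary. -/
lemma le_kern {a b : ℝ} (ha : 0 < a) (hb : 0 ≤ b) {h : ℝ} (hh : 0 < h)
    {x y : EuclideanSpace ℝ (Fin (d + 1))} (hxy : ‖x - y‖ ≤ h) (hx : h / 2 ≤ x (Fin.last d))
    (hy : h / 2 ≤ y (Fin.last d)) :
    ENNReal.ofReal (2 ^ (-b) / a * h ^ (2 * (a - b))) ≤ kern a b x y := by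
  have h1 : profile a b (h ^ 2) (h ^ 2) ≤ kern a b x y := by
    refine profile_mono hb (by positivity) (by gcongr) ?_
    nlinarith [mul_le_mul hx hy (by positivity) (by linarith)]
  refine le_trans (le_of_eq ?_) ((le_profile ha hb (by positivity) (by positivity)).trans h1)
  congr 1
  have e : h ^ 2 + h ^ 2 = 2 * h ^ 2 := by ring
  have e2 : h ^ (2 * (a - b)) = (h ^ 2) ^ a * (h ^ 2) ^ (-b) := by
    rw [← Real.rpow_add (by positivity), ← Real.rpow_natCast, ← Real.rpow_mul hh.le]
    congr 1
  rw [e, Real.mul_rpow (by positivity) (by positivity), e2]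
  ring

/-- The kernel depends on the squared distance and linearly on the height inside the profile; hence
3 for distances against 9 = 3² for heights. -/
lemma kern_le_mul {a b : ℝ} (hb : 0 ≤ b) {x x' y : EuclideanSpace ℝ (Fin (d + 1))}
    (hy : y ∈ upper d) (hs : ‖x' - y‖ ≤ 3 * ‖x - y‖)
    (hl : x (Fin.last d) ≤ 9 * x' (Fin.last d)) :
    kern a b x y ≤ ENNReal.ofReal (9 ^ (a + b)) * kern a b x' y := by
  have hy' : 0 < y (Fin.last d) := hy
  refine profile_le_mul hb (by norm_num) (by positivity) (by positivity) ?_ ?_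
  · nlinarith [norm_nonneg (x' - y), norm_nonneg (x - y)]
  · nlinarith

variable {a₁ b₁ a₂ b₂ : ℝ}

/-- Potential of the indicator function of a small ball at its center. -/
lemma exists_pot_pot_ball_le (ha₁ : 0 < a₁) (hab₁ : a₁ < b₁)
    (ha₂ : 0 < a₂) (hab₂ : a₂ < b₂) {φ β₁ β₂ : ℝ} (hφ0 : 0 ≤ φ) (hφ : φ ≤ a₂) (hβ₁0 : 0 < β₁)
    (hβ₂0 : 0 < β₂) (hβ₁ : β₁ = ((d + 1 : ℕ) : ℝ) + 2 * (a₁ - b₁))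
    (hβ₂ : β₂ = ((d + 1 : ℕ) : ℝ) + 2 * (a₂ - b₂) - φ) (hθ : β₁ + β₂ < ((d + 1 : ℕ) : ℝ)) :
    ∃ C : ℝ, 0 < C ∧ ∀ (x : EuclideanSpace ℝ (Fin (d + 1))) (σ h : ℝ), 0 < σ → 0 ≤ h →
      (∀ y ∈ ball x σ, y (Fin.last d) ≤ h) →
      pot a₁ b₁ (pot a₂ b₂ ((ball x σ).indicator 1)) x
        ≤ ENNReal.ofReal (C * h ^ φ * σ ^ (β₁ + β₂)) := by
  set n : ℝ := ((d + 1 : ℕ) : ℝ) with hn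
  have hn0 : 0 < n := by rw [hn]; positivity
  have hfr : (Module.finrank ℝ (EuclideanSpace ℝ (Fin (d + 1))) : ℝ) = n := by
    rw [finrank_euclideanSpace_fin]
  have hdim : 1 ≤ Module.finrank ℝ (EuclideanSpace ℝ (Fin (d + 1))) := by
    rw [finrank_euclideanSpace_fin]; omega
  obtain ⟨C₁, hC₁, -, H₁⟩ := exists_setLIntegral_riesz_le
    (volume : Measure (EuclideanSpace ℝ (Fin (d + 1)))) hβ₁0 (by rw [hfr]; linarith)
  obtain ⟨C₂, hC₂, H₂⟩ := exists_lintegral_mul_riesz_le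
    (volume : Measure (EuclideanSpace ℝ (Fin (d + 1)))) (β := β₂) (a := β₁ / n) hβ₂0
    (by positivity) (by rw [hfr, ← add_div, div_lt_one hn0]; exact hθ) hdim
  obtain ⟨D₂, hD₂, K₂⟩ := exists_kern_le_weighted (d := d) ha₂ hab₂ hφ0 hφ
  set D₁ := ENNReal.ofReal (1 / a₁ + 1 / (b₁ - a₁)) with hD₁
  rw [hfr] at H₁ H₂
  set B := D₁ * D₂ * (C₂ * C₁) with hB
  have hBfin : B ≠ ∞ := ENNReal.mul_ne_top (ENNReal.mul_ne_top ENNReal.ofReal_ne_top hD₂)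
    (ENNReal.mul_ne_top hC₂ hC₁)
  have hv := unitVol_pos (d := d)
  refine ⟨(B.toReal + 1) * unitVol d ^ ((β₁ + β₂) / n), by positivity,
    fun x σ h hσ hh hball => ?_⟩
  have hpot₂ : ∀ z, pot a₂ b₂ ((ball x σ).indicator 1) z
      ≤ D₂ * ENNReal.ofReal h ^ φ * ∫⁻ y in ball x σ, ‖z - y‖ₑ ^ (β₂ - n) := by
    intro z
    rw [← lintegral_const_mul _ (by fun_prop), ← lintegral_indicator measurableSet_ball]
    refine (setLIntegral_mono' isOpen_upper.measurableSet fun y hy => ?_).trans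
      (setLIntegral_le_lintegral _ _)
    by_cases hyb : y ∈ ball x σ
    · rw [indicator_of_mem hyb, indicator_of_mem hyb, Pi.one_apply, mul_one]
      refine (K₂ z y hy).trans ?_
      rw [show 2 * (a₂ - b₂) - φ = β₂ - n by rw [hβ₂]; ring, mul_comm (_ ^ _), ← mul_assoc]
      gcongr
      exact hball y hyb
    · simp [hyb]
  have hmain : pot a₁ b₁ (pot a₂ b₂ ((ball x σ).indicator 1)) x
      ≤ D₁ * D₂ * ENNReal.ofReal h ^ φ *
        ∫⁻ z, ‖x - z‖ₑ ^ (β₁ - n) * ∫⁻ y in ball x σ, ‖z - y‖ₑ ^ (β₂ - n) := by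
    rw [← lintegral_const_mul' _ _ (ENNReal.mul_ne_top (ENNReal.mul_ne_top ENNReal.ofReal_ne_top hD₂)
      (ENNReal.rpow_ne_top_of_nonneg hφ0 ENNReal.ofReal_ne_top))]
    refine (lintegral_mono fun z => ?_).trans (setLIntegral_le_lintegral _ _)
    calc _ ≤ (D₁ * ‖x - z‖ₑ ^ (2 * (a₁ - b₁))) * (D₂ * ENNReal.ofReal h ^ φ *
            ∫⁻ y in ball x σ, ‖z - y‖ₑ ^ (β₂ - n)) :=
          mul_le_mul' (kern_le_riesz ha₁ hab₁ x z) (hpot₂ z)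
      _ = _ := by
        rw [show 2 * (a₁ - b₁) = β₁ - n by rw [hβ₁]; ring]
        ring
  -- The outer Riesz kernel is itself a Marcinkiewicz function of exponent β₁/n, so it can play the
  -- role of g in the dual estimate.
  have h2 := H₂ (fun z => ‖x - z‖ₑ ^ (β₁ - n)) C₁ (by fun_prop) (fun E hE => H₁ x E hE)
    (ball x σ) measurableSet_ball measure_ball_lt_top.ne
  refine (hmain.trans (mul_le_mul_right h2 _)).trans ?_
  have hvol : volume (ball x σ) ^ ((β₁ + β₂) / n)
      = ENNReal.ofReal (σ ^ (β₁ + β₂) * unitVol d ^ ((β₁ + β₂) / n)) := by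
    rw [volume_ball_eq_ofReal x hσ, ← hn,
      ENNReal.ofReal_rpow_of_nonneg (by positivity) (by positivity),
      Real.mul_rpow (by positivity) hv.le, ← Real.rpow_mul hσ.le, mul_div_cancel₀ _ hn0.ne']
  rw [← add_div, hvol, ENNReal.ofReal_rpow_of_nonneg hh hφ0]
  have hBle : B ≤ ENNReal.ofReal (B.toReal + 1) := by
    rw [ENNReal.ofReal_add ENNReal.toReal_nonneg zero_le_one, ENNReal.ofReal_toReal hBfin]
    exact le_self_add
  calc D₁ * D₂ * ENNReal.ofReal (h ^ φ) * (C₂ * C₁ *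
        ENNReal.ofReal (σ ^ (β₁ + β₂) * unitVol d ^ ((β₁ + β₂) / n)))
      = B * (ENNReal.ofReal (h ^ φ) *
        ENNReal.ofReal (σ ^ (β₁ + β₂) * unitVol d ^ ((β₁ + β₂) / n))) := by rw [hB]; ring
    _ ≤ ENNReal.ofReal (B.toReal + 1) * (ENNReal.ofReal (h ^ φ) *
        ENNReal.ofReal (σ ^ (β₁ + β₂) * unitVol d ^ ((β₁ + β₂) / n))) := by gcongr
    _ = _ := by
      rw [← ENNReal.ofReal_mul (by positivity), ← ENNReal.ofReal_mul (by positivity)]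
      congr 1
      ring

/-- Harnack inequality for potentials of functions vanishing near the point. -/
lemma exists_pot_pot_far_le (ha₁ : 0 < a₁) (hab₁ : a₁ < b₁)
    (ha₂ : 0 < a₂) (hab₂ : a₂ < b₂) {β₁ : ℝ} (hβ₁0 : 0 < β₁)
    (hβ₁ : β₁ = ((d + 1 : ℕ) : ℝ) + 2 * (a₁ - b₁)) :
    ∃ C : ℝ, 0 < C ∧ ∀ (x x' : EuclideanSpace ℝ (Fin (d + 1))) (σ : ℝ), 0 < σ →
      σ ≤ x (Fin.last d) / 2 → x' ∈ ball x (σ / 4) →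
      ∀ g : EuclideanSpace ℝ (Fin (d + 1)) → ℝ≥0∞, Measurable g → (∀ y ∈ ball x σ, g y = 0) →
      pot a₁ b₁ (pot a₂ b₂ g) x ≤ ENNReal.ofReal C * pot a₁ b₁ (pot a₂ b₂ g) x' := by
  set n : ℝ := ((d + 1 : ℕ) : ℝ) with hn
  have hn0 : 0 < n := by rw [hn]; positivity
  have hfr : (Module.finrank ℝ (EuclideanSpace ℝ (Fin (d + 1))) : ℝ) = n := by
    rw [finrank_euclideanSpace_fin]
  obtain ⟨C₁, hC₁, hC₁0, H₁⟩ := exists_setLIntegral_riesz_le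
    (volume : Measure (EuclideanSpace ℝ (Fin (d + 1)))) hβ₁0 (by rw [hfr]; linarith)
  rw [hfr] at H₁
  set D₁ : ℝ := 1 / a₁ + 1 / (b₁ - a₁) with hD₁
  have hba₁ : 0 < b₁ - a₁ := by linarith
  have hD₁0 : 0 < D₁ := by positivity
  have hv := unitVol_pos (d := d)
  set M₁ : ℝ := 9 ^ (a₁ + b₁) with hM₁
  set M₂ : ℝ := 9 ^ (a₂ + b₂) with hM₂
  set c : ℝ := 2 ^ (-b₁) / a₁ with hc
  have hc0 : 0 < c := by positivity
  set γ : ℝ := C₁.toReal with hγ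
  have hγ0 : 0 < γ := ENNReal.toReal_pos hC₁0 hC₁
  set w : ℝ := unitVol d / 2 ^ n with hw
  have hw0 : 0 < w := by positivity
  set K : ℝ := M₂ * M₂ * (D₁ * (γ * w ^ (β₁ / n))) / (c * w) with hK
  have hM₁0 : 0 < M₁ := by positivity
  have hM₂0 : 0 < M₂ := by positivity
  have hK0 : 0 < K := by positivity
  refine ⟨M₁ + K, by positivity, fun x x' σ hσ hσx hx' g hg hg0 => ?_⟩
  set F := pot a₂ b₂ g with hF
  have hFm : Measurable F := measurable_pot hg
  have hx'n := abs_lt.1 (last_le_of_mem_ball hx')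
  have hxx' : ‖x' - x‖ < σ / 4 := by rwa [mem_ball, dist_eq_norm] at hx'
  -- For y outside ball x σ, the distances from z and z' to y differ by a factor of at most 3, so
  -- the inner potential is almost constant on the half ball.
  have hFle : ∀ z z', z ∈ ball x (σ / 2) → z' ∈ ball x (σ / 2) →
      F z ≤ ENNReal.ofReal M₂ * F z' := by
    intro z z' hz hz'
    have hzn := abs_lt.1 (last_le_of_mem_ball hz)
    have hz'n := abs_lt.1 (last_le_of_mem_ball hz')
    rw [hF, pot, pot, ← lintegral_const_mul' _ _ ENNReal.ofReal_ne_top]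
    refine setLIntegral_mono' isOpen_upper.measurableSet fun y hy => ?_
    by_cases hyb : y ∈ ball x σ
    · simp [hg0 y hyb]
    rw [← mul_assoc]
    gcongr
    refine kern_le_mul (by linarith) hy ?_ (by linarith)
    have h1 : σ ≤ ‖y - x‖ := by rw [← dist_eq_norm]; exact not_lt.1 hyb
    have h2 : ‖z - x‖ < σ / 2 := by rwa [mem_ball, dist_eq_norm] at hz
    have h3 : ‖z' - x‖ < σ / 2 := by rwa [mem_ball, dist_eq_norm] at hz'
    have h4 : ‖y - x‖ ≤ ‖z - y‖ + ‖z - x‖ := by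
      have := norm_sub_le (z - x) (z - y)
      rw [show z - x - (z - y) = y - x by abel] at this
      linarith
    have h5 : ‖z' - y‖ ≤ ‖z - y‖ + ‖z - x‖ + ‖z' - x‖ := by
      have e : z' - y = (z - y) - (z - x) + (z' - x) := by abel
      rw [e]
      exact (norm_add_le _ _).trans (add_le_add (norm_sub_le _ _) le_rfl)
    linarith
  set B := ball x (σ / 2) with hB
  have hBm : MeasurableSet B := measurableSet_ball
  have hBu : B ⊆ upper d := by
    intro z hz
    have := abs_lt.1 (last_le_of_mem_ball hz)
    change 0 < z (Fin.last d)
    linarith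
  have hvolB : volume B = ENNReal.ofReal (σ ^ n * w) := by
    rw [hB, volume_ball_eq_ofReal x (by positivity), ← hn, Real.div_rpow hσ.le (by norm_num), hw]
    congr 1
    ring
  have hxB : x ∈ B := mem_ball_self (by positivity)
  have hx'B : x' ∈ B := ball_subset_ball (by linarith) hx'
  -- Inside B the outer kernel is singular and has no pointwise comparison. The integral at x is
  -- bounded above, and that at x' below, by multiples of σ^β₁ F(x); outside B the kernels compare
  -- pointwise.
  have hin : ∫⁻ z in B, kern a₁ b₁ x z * F z
      ≤ ENNReal.ofReal K * ∫⁻ z in B, kern a₁ b₁ x' z * F z := by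
    have up : ∫⁻ z in B, kern a₁ b₁ x z * F z
        ≤ ENNReal.ofReal (M₂ * (D₁ * (γ * w ^ (β₁ / n))) * σ ^ β₁) * F x := by
      calc ∫⁻ z in B, kern a₁ b₁ x z * F z
          ≤ ∫⁻ z in B, (ENNReal.ofReal D₁ * (ENNReal.ofReal M₂ * F x)) * ‖x - z‖ₑ ^ (β₁ - n) := by
            refine setLIntegral_mono' hBm fun z hz => ?_
            calc _ ≤ (ENNReal.ofReal D₁ * ‖x - z‖ₑ ^ (2 * (a₁ - b₁))) *
                  (ENNReal.ofReal M₂ * F x) :=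
                mul_le_mul' (kern_le_riesz ha₁ hab₁ x z) (hFle z x hz hxB)
              _ = _ := by
                rw [show 2 * (a₁ - b₁) = β₁ - n by rw [hβ₁]; ring]
                ring
        _ = (ENNReal.ofReal D₁ * (ENNReal.ofReal M₂ * F x)) * ∫⁻ z in B, ‖x - z‖ₑ ^ (β₁ - n) :=
            lintegral_const_mul _ (by fun_prop)
        _ ≤ (ENNReal.ofReal D₁ * (ENNReal.ofReal M₂ * F x)) * (C₁ * volume B ^ (β₁ / n)) := by
            gcongr
            exact H₁ x B hBm
        _ = _ := by
            rw [hvolB, ENNReal.ofReal_rpow_of_nonneg (by positivity) (by positivity),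
              Real.mul_rpow (by positivity) hw0.le, ← Real.rpow_mul hσ.le,
              mul_div_cancel₀ _ hn0.ne', ← ENNReal.ofReal_toReal hC₁, ← hγ,
              ← ENNReal.ofReal_mul hγ0.le]
            rw [show ∀ p q r f : ℝ≥0∞, p * (q * f) * r = (q * (p * r)) * f from
              fun p q r f => by ring, ← ENNReal.ofReal_mul hD₁0.le, ← ENNReal.ofReal_mul hM₂0.le]
            congr 2
            ring
    have low : ENNReal.ofReal (c * w * σ ^ β₁) * F x
        ≤ ENNReal.ofReal M₂ * ∫⁻ z in B, kern a₁ b₁ x' z * F z := by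
      calc ENNReal.ofReal (c * w * σ ^ β₁) * F x
          = ∫⁻ z in B, ENNReal.ofReal (c * σ ^ (2 * (a₁ - b₁))) * F x := by
            rw [setLIntegral_const, hvolB, mul_right_comm (ENNReal.ofReal _), ← ENNReal.ofReal_mul (by positivity)]
            congr 2
            rw [show β₁ = n + 2 * (a₁ - b₁) from hβ₁, Real.rpow_add hσ]
            ring
        _ ≤ ∫⁻ z in B, ENNReal.ofReal M₂ * (kern a₁ b₁ x' z * F z) := by
            refine setLIntegral_mono' hBm fun z hz => ?_
            have hzn := abs_lt.1 (last_le_of_mem_ball hz)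
            have hzx : ‖z - x‖ < σ / 2 := by rwa [hB, mem_ball, dist_eq_norm] at hz
            have h1 := le_kern ha₁ (by linarith : 0 ≤ b₁) hσ (x := x') (y := z) (by
              rw [show x' - z = (x' - x) - (z - x) by abel]
              exact (norm_sub_le _ _).trans (by linarith)) (by linarith) (by linarith)
            calc _ ≤ kern a₁ b₁ x' z * (ENNReal.ofReal M₂ * F z) :=
                  mul_le_mul' h1 (hFle x z hxB hz)
              _ = _ := by ring
        _ = _ := lintegral_const_mul' _ _ ENNReal.ofReal_ne_top
    have e : M₂ * (D₁ * (γ * w ^ (β₁ / n))) * σ ^ β₁ = K / M₂ * (c * w * σ ^ β₁) := by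
      rw [hK]; field_simp
    rw [e, ENNReal.ofReal_mul (by positivity), mul_assoc] at up
    refine (up.trans (mul_le_mul_right low _)).trans (le_of_eq ?_)
    rw [← mul_assoc, ← ENNReal.ofReal_mul (by positivity), div_mul_cancel₀ _ hM₂0.ne']
  have hout : ∫⁻ z in upper d \ B, kern a₁ b₁ x z * F z
      ≤ ENNReal.ofReal M₁ * ∫⁻ z in upper d \ B, kern a₁ b₁ x' z * F z := by
    rw [← lintegral_const_mul' _ _ ENNReal.ofReal_ne_top]
    refine setLIntegral_mono' (isOpen_upper.measurableSet.diff hBm) fun z hz => ?_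
    rw [← mul_assoc]
    gcongr
    refine kern_le_mul (by linarith) hz.1 ?_ (by linarith)
    have h1 : σ / 2 ≤ ‖x - z‖ := by
      rw [← dist_eq_norm, dist_comm]; exact not_lt.1 hz.2
    rw [show x' - z = (x' - x) + (x - z) by abel]
    exact (norm_add_le _ _).trans (by linarith)
  have hsplit : ∀ ξ, pot a₁ b₁ F ξ
      = (∫⁻ z in B, kern a₁ b₁ ξ z * F z) + ∫⁻ z in upper d \ B, kern a₁ b₁ ξ z * F z := by
    intro ξ
    rw [pot, ← lintegral_inter_add_sdiff _ _ hBm, inter_eq_right.2 hBu]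
  rw [hsplit x, hsplit x', mul_add]
  refine add_le_add (hin.trans ?_) (hout.trans ?_) <;> gcongr <;> linarith

/-- Lower bound for potentials on a ball well inside the half-space. -/
lemma exists_le_pot_pot (ha₁ : 0 < a₁) (hab₁ : a₁ < b₁) (ha₂ : 0 < a₂) (hab₂ : a₂ < b₂) :
    ∃ C : ℝ, 0 < C ∧ ∀ c ∈ upper d, ∀ x ∈ ball c (c (Fin.last d) / 2),
      ∀ g : EuclideanSpace ℝ (Fin (d + 1)) → ℝ≥0∞, Measurable g →
      ENNReal.ofReal (C * c (Fin.last d) ^ (((d + 1 : ℕ) : ℝ) + 2 * (a₁ - b₁) + 2 * (a₂ - b₂))) *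
        ∫⁻ y in ball c (c (Fin.last d) / 2), g y ≤ pot a₁ b₁ (pot a₂ b₂ g) x := by
  set n : ℝ := ((d + 1 : ℕ) : ℝ) with hn
  have hn0 : 0 < n := by rw [hn]; positivity
  have hv := unitVol_pos (d := d)
  set c₁ : ℝ := 2 ^ (-b₁) / a₁ with hc₁
  set c₂ : ℝ := 2 ^ (-b₂) / a₂ with hc₂
  have hc₁0 : 0 < c₁ := by positivity
  have hc₂0 : 0 < c₂ := by positivity
  refine ⟨c₁ * c₂ * (unitVol d / 2 ^ n), by positivity, fun c hc x hx g hg => ?_⟩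
  have hh : 0 < c (Fin.last d) := hc
  set h := c (Fin.last d) with hhdef
  set B := ball c (h / 2) with hB
  have hBm : MeasurableSet B := measurableSet_ball
  have hlast : ∀ z ∈ B, h / 2 ≤ z (Fin.last d) := by
    intro z hz
    have := abs_lt.1 (last_le_of_mem_ball hz)
    linarith
  have hBu : B ⊆ upper d := by
    intro z hz
    have := hlast z hz
    change 0 < z (Fin.last d)
    linarith
  have hdist : ∀ y ∈ B, ∀ z ∈ B, ‖y - z‖ ≤ h := by
    intro y hy z hz
    rw [← dist_eq_norm]
    have h1 := mem_ball.1 hy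
    have h2 := mem_ball.1 hz
    have := dist_triangle_right y z c
    linarith
  have h2 : ∀ z ∈ B, ENNReal.ofReal (c₂ * h ^ (2 * (a₂ - b₂))) * ∫⁻ y in B, g y
      ≤ pot a₂ b₂ g z := by
    intro z hz
    rw [← lintegral_const_mul _ hg]
    refine le_trans (setLIntegral_mono' hBm fun y hy => ?_) (lintegral_mono_set hBu)
    exact mul_le_mul_left (le_kern ha₂ (by linarith) hh (hdist z hz y hy) (hlast z hz)
      (hlast y hy)) _
  have hvolB : volume B = ENNReal.ofReal (h ^ n * (unitVol d / 2 ^ n)) := by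
    rw [hB, volume_ball_eq_ofReal c (by positivity), ← hn, Real.div_rpow hh.le (by norm_num)]
    congr 1
    ring
  calc _ = ∫⁻ z in B, ENNReal.ofReal (c₁ * h ^ (2 * (a₁ - b₁))) *
        (ENNReal.ofReal (c₂ * h ^ (2 * (a₂ - b₂))) * ∫⁻ y in B, g y) := by
        rw [setLIntegral_const, hvolB, ← mul_assoc, ← ENNReal.ofReal_mul (by positivity),
          mul_right_comm (ENNReal.ofReal _) (∫⁻ y in B, g y), ← ENNReal.ofReal_mul (by positivity)]
        congr 2
        rw [Real.rpow_add hh, Real.rpow_add hh]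
        ring
    _ ≤ ∫⁻ z in B, kern a₁ b₁ x z * pot a₂ b₂ g z := by
        refine setLIntegral_mono' hBm fun z hz => ?_
        exact mul_le_mul' (le_kern ha₁ (by linarith) hh (hdist x hx z hz) (hlast x hx)
          (hlast z hz)) (h2 z hz)
    _ ≤ _ := lintegral_mono_set hBu

end Interior

end HalfSpace

namespace HalfSpace

/-! ### The interior estimate under small local L^s mass -/

section InteriorBound

open Filter Topology Metric

variable {d : ℕ}

/-- Selection of a point at which a function is comparable to its supremum over a ball whose radius
is comparable to the distance to the boundary. -/
lemma exists_doubling_point {E : Type*} [MetricSpace E] [ProperSpace E] {u : E → ℝ} {c : E}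
    {r γ : ℝ} (hr : 0 < r) (hγ : 0 < γ) (hu : ContinuousOn u (closedBall c r))
    (hu0 : ∀ x, 0 ≤ u x) (hc : 0 < u c) :
    ∃ x₀ ρ, 0 < ρ ∧ dist x₀ c = r - 2 * ρ ∧ r ^ γ * u c ≤ (2 * ρ) ^ γ * u x₀ ∧
      ∀ x ∈ ball x₀ ρ, u x ≤ 2 ^ γ * u x₀ := by
  -- x₀ will maximise this weighted function, with 2ρ = r - dist x₀ c. On ball x₀ ρ the base of the
  -- weight is at least ρ, which costs the factor 2^γ.
  have hcont : ContinuousOn (fun x => (r - dist x c) ^ γ * u x) (closedBall c r) := by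
    refine ContinuousOn.mul (Continuous.continuousOn ?_) hu
    exact (continuous_const.sub (continuous_id.dist continuous_const)).rpow_const
      fun x => Or.inr hγ.le
  obtain ⟨x₀, hx₀, hmax⟩ := (isCompact_closedBall c r).exists_isMaxOn
    ⟨c, mem_closedBall_self hr.le⟩ hcont
  have h1 : r ^ γ * u c ≤ (r - dist x₀ c) ^ γ * u x₀ := by
    simpa using hmax (mem_closedBall_self hr.le)
  have hlt : 0 < r - dist x₀ c := by
    have h2 : 0 ≤ r - dist x₀ c := sub_nonneg.2 (mem_closedBall.1 hx₀)
    refine h2.lt_of_ne fun h3 => ?_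
    rw [← h3, Real.zero_rpow hγ.ne', zero_mul] at h1
    exact absurd h1 (not_le.2 (by positivity))
  have e : 2 * ((r - dist x₀ c) / 2) = r - dist x₀ c := by ring
  refine ⟨x₀, (r - dist x₀ c) / 2, by positivity, by ring, by rwa [e], fun x hx => ?_⟩
  set ρ := (r - dist x₀ c) / 2 with hρ
  have hρ0 : 0 < ρ := by positivity
  have hx1 : ρ ≤ r - dist x c := by
    have := dist_triangle x x₀ c
    rw [mem_ball] at hx
    linarith
  have h4 : (r - dist x c) ^ γ * u x ≤ (r - dist x₀ c) ^ γ * u x₀ :=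
    hmax (mem_closedBall.2 (by linarith))
  rw [← e, Real.mul_rpow (by norm_num) hρ0.le] at h4
  have h5 : ρ ^ γ * u x ≤ (r - dist x c) ^ γ * u x :=
    mul_le_mul_of_nonneg_right (Real.rpow_le_rpow hρ0.le hx1 hγ.le) (hu0 x)
  have h6 : 0 < ρ ^ γ := by positivity
  nlinarith

/-- The choice s = n(p-1)/T makes v^s h^n = (h^T v^(p-1))^(n/T), and `hrel` expresses this through X
alone. What remains is a constant times X to the power (n/T)((n-θ)(p-1)-θ) ≤ 0, with X ≤ 1. -/
lemma scaling_lower_bound {h v X Λ κ p n T θ s : ℝ} (hh : 0 < h) (hv : 0 < v) (hX : 0 < X)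
    (hX1 : X ≤ 1) (hΛ : 0 < Λ) (hκ : 0 < κ) (hT : 0 < T) (hs : s = n * (p - 1) / T)
    (hn : 0 < n) (hθp : (n - θ) * (p - 1) ≤ θ)
    (hrel : 2 * Λ * X ^ θ * (h ^ T * v ^ (p - 1)) = 1) :
    (κ / (2 * Λ)) ^ s * (1 / (2 * Λ)) ^ (n / T) ≤ (κ * (h ^ T * X ^ n * v ^ p)) ^ s * h ^ n := by
  set y := h ^ T * v ^ (p - 1) with hy
  have hy0 : 0 < y := by positivity
  have hXθ : 0 < X ^ θ := by positivity
  have hyX : y = 1 / (2 * Λ) * X ^ (-θ) := by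
    rw [Real.rpow_neg hX.le]
    field_simp
    linarith
  have e1 : κ * (h ^ T * X ^ n * v ^ p) = κ / (2 * Λ) * X ^ (n - θ) * v := by
    have : v ^ p = v ^ (p - 1) * v := by
      rw [← Real.rpow_add_one hv.ne', sub_add_cancel]
    rw [this, show n - θ = n + -θ from sub_eq_add_neg _ _, Real.rpow_add hX,
      show κ * (h ^ T * X ^ n * (v ^ (p - 1) * v)) = κ * y * X ^ n * v by rw [hy]; ring, hyX]
    ring
  have e2 : v ^ s * h ^ n = y ^ (n / T) := by
    rw [hy, Real.mul_rpow (by positivity) (by positivity), ← Real.rpow_mul hh.le,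
      ← Real.rpow_mul hv.le, mul_div_cancel₀ _ hT.ne', hs, mul_comm]
    congr 2
    ring
  have e3 : (κ * (h ^ T * X ^ n * v ^ p)) ^ s * h ^ n
      = (κ / (2 * Λ)) ^ s * (1 / (2 * Λ)) ^ (n / T) * X ^ ((n - θ) * s + -θ * (n / T)) := by
    rw [e1, Real.mul_rpow (by positivity) hv.le, Real.mul_rpow (by positivity) (by positivity),
      mul_assoc, e2, hyX, Real.mul_rpow (by positivity) (by positivity), ← Real.rpow_mul hX.le,
      ← Real.rpow_mul hX.le, Real.rpow_add hX]
    ring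
  rw [e3]
  refine le_mul_of_one_le_right (by positivity) ?_
  refine Real.one_le_rpow_of_pos_of_le_one_of_nonpos hX hX1 ?_
  have : (n - θ) * s + -θ * (n / T) = n / T * ((n - θ) * (p - 1) - θ) := by rw [hs]; ring
  rw [this]
  exact mul_nonpos_of_nonneg_of_nonpos (by positivity) (by linarith)

lemma pot_add {a b : ℝ} {f g : EuclideanSpace ℝ (Fin (d + 1)) → ℝ≥0∞} (hf : Measurable f)
    (x : EuclideanSpace ℝ (Fin (d + 1))) :
    pot a b (fun y => f y + g y) x = pot a b f x + pot a b g x := by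
  rw [pot, pot, pot, ← lintegral_add_left (measurable_kern_mul hf x)]
  exact lintegral_congr fun y => mul_add _ _ _

namespace IsPotSol

variable {a₁ b₁ a₂ b₂ p s : ℝ} {C : ℝ≥0∞} {U : EuclideanSpace ℝ (Fin (d + 1)) → ℝ≥0∞}

/-- At a doubling point x₀ with value v, let σ be the radius whose ball contributes at most v/2. If
the doubling ball is smaller, the bound is immediate. Otherwise v/2 comes from afar, Harnack keeps U
comparable to v on ball x₀ (σ/4), and the resulting mass of U^p makes U so large on the whole ball
about c that its L^s mass cannot be small. -/
lemma exists_bound_of_setLIntegral_lt (h : IsPotSol a₁ b₁ a₂ b₂ p s C U) (ha₁ : 0 < a₁)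
    (hab₁ : a₁ < b₁) (ha₂ : 0 < a₂) (hab₂ : a₂ < b₂) {β₁ T φ θ : ℝ} (hβ₁0 : 0 < β₁)
    (hβ₁ : β₁ = ((d + 1 : ℕ) : ℝ) + 2 * (a₁ - b₁))
    (hT : T = β₁ + (((d + 1 : ℕ) : ℝ) + 2 * (a₂ - b₂))) (hφ0 : 0 ≤ φ) (hφ : φ ≤ a₂)
    (hθβ : β₁ < θ) (hθn : θ < ((d + 1 : ℕ) : ℝ)) (hθT : θ + φ = T) (hp : 1 < p)
    (hs : s = ((d + 1 : ℕ) : ℝ) * (p - 1) / T)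
    (hθp : (((d + 1 : ℕ) : ℝ) - θ) * (p - 1) ≤ θ) (hC0 : C ≠ 0) (hC : C ≠ ∞) :
    ∃ K ε : ℝ, 0 < ε ∧ ∀ c ∈ upper d,
      ∫⁻ x in ball c (c (Fin.last d) / 2), U x ^ s < ENNReal.ofReal ε →
      c (Fin.last d) ^ T * (U c).toReal ^ (p - 1) ≤ K := by
  set n : ℝ := ((d + 1 : ℕ) : ℝ) with hn
  have hn0 : 0 < n := by rw [hn]; positivity
  have hθ0 : 0 < θ := hβ₁0.trans hθβ
  have hT0 : 0 < T := by linarith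
  have hp1 : 0 < p - 1 := by linarith
  have hs0 : 0 < s := by rw [hs]; positivity
  have hv := unitVol_pos (d := d)
  obtain ⟨Cb, hCb, Hb⟩ := exists_pot_pot_ball_le (d := d) ha₁ hab₁ ha₂ hab₂ (β₂ := θ - β₁) hφ0 hφ
    hβ₁0 (by linarith) hβ₁ (by linarith) (by linarith)
  obtain ⟨Ch, hCh, Hh⟩ := exists_pot_pot_far_le (d := d) ha₁ hab₁ ha₂ hab₂ hβ₁0 hβ₁
  obtain ⟨Cl, hCl, Hl⟩ := exists_le_pot_pot (d := d) ha₁ hab₁ ha₂ hab₂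
  rw [add_sub_cancel] at Hb
  rw [← hn] at Hl
  set k := C.toReal with hk
  have hk0 : 0 < k := ENNReal.toReal_pos hC0 hC
  have hCk : C = ENNReal.ofReal k := (ENNReal.ofReal_toReal hC).symm
  -- Chosen so that the (p-1)-th power of the selection inequality carries the radii to the power θ.
  set γ := θ / (p - 1) with hγ
  have hγ0 : 0 < γ := by positivity
  set Λ := k * ((2 ^ γ) ^ p * (Cb * 2 ^ φ)) with hΛ
  have hΛ0 : 0 < Λ := by positivity
  set κ := k * (Cl * ((1 / (2 * Ch)) ^ p * (unitVol d / 4 ^ n))) with hκ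
  have hκ0 : 0 < κ := by positivity
  refine ⟨4 ^ θ / (2 * Λ), (κ / (2 * Λ)) ^ s * (1 / (2 * Λ)) ^ (n / T) * (unitVol d / 2 ^ n),
    by positivity, fun c hc hint => ?_⟩
  have hh : 0 < c (Fin.last d) := hc
  set η := c (Fin.last d) with hη
  set u : EuclideanSpace ℝ (Fin (d + 1)) → ℝ := fun x => (U x).toReal with hu
  have hUu : ∀ x, U x = ENNReal.ofReal (u x) := fun x => (ENNReal.ofReal_toReal (h.fin x)).symm
  have hu0 : ∀ x, 0 ≤ u x := fun x => ENNReal.toReal_nonneg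
  change η ^ T * u c ^ (p - 1) ≤ _
  rcases (hu0 c).eq_or_lt with huc | huc
  · rw [← huc, Real.zero_rpow hp1.ne', mul_zero]
    positivity
  have hballu : closedBall c (η / 2) ⊆ upper d := by
    intro x hx
    rw [mem_closedBall, dist_eq_norm] at hx
    have h1 := (abs_le.1 ((abs_last_sub_le x c).trans hx)).1
    change 0 < x (Fin.last d)
    linarith
  have hucont : ContinuousOn u (closedBall c (η / 2)) := fun x hx =>
    (ENNReal.tendsto_toReal (h.fin x)).comp ((h.cont x (hballu hx)).mono hballu)
  obtain ⟨x₀, ρ, hρ0, hx₀c, hsel, hdoub⟩ :=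
    exists_doubling_point (by positivity) hγ0 hucont hu0 huc
  have hux₀ : 0 < u x₀ := by
    refine (hu0 x₀).lt_of_ne fun h1 => ?_
    rw [← h1, mul_zero] at hsel
    exact absurd hsel (not_le.2 (by positivity))
  set v := u x₀ with hvdef
  have hρη : ρ ≤ η / 4 := by have := dist_nonneg (x := x₀) (y := c); linarith
  have hx₀last : η / 2 < x₀ (Fin.last d) := by
    have h1 : x₀ ∈ ball c (η / 2) := by rw [mem_ball]; linarith
    have := abs_lt.1 (last_le_of_mem_ball h1)
    linarith
  have hx₀le : ∀ y ∈ ball x₀ ρ, y (Fin.last d) ≤ 2 * η := by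
    intro y hy
    have h1 : y ∈ ball c (η / 2) := by
      rw [mem_ball] at hy ⊢
      have := dist_triangle y x₀ c
      linarith
    have := abs_lt.1 (last_le_of_mem_ball h1)
    linarith
  set A := Λ * η ^ φ * v ^ (p - 1) with hA
  have hA0 : 0 < A := by positivity
  -- The contribution of ball x₀ σ is bounded by A σ^θ v, which this radius makes equal to v/2.
  set σ := (1 / (2 * A)) ^ (1 / θ) with hσ
  have hσ0 : 0 < σ := by positivity
  have hσθ : σ ^ θ = 1 / (2 * A) := by
    rw [hσ, ← Real.rpow_mul (by positivity), one_div_mul_cancel hθ0.ne', Real.rpow_one]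
  rcases le_or_gt ρ σ with hρσ | hρσ
  · have h1 : ρ ^ θ ≤ 1 / (2 * A) := hσθ ▸ Real.rpow_le_rpow hρ0.le hρσ hθ0.le
    have h2 := Real.rpow_le_rpow (by positivity) hsel hp1.le
    rw [Real.mul_rpow (by positivity) huc.le, Real.mul_rpow (by positivity) hux₀.le,
      ← Real.rpow_mul (by positivity), ← Real.rpow_mul (by positivity), hγ,
      div_mul_cancel₀ _ hp1.ne', Real.div_rpow hh.le (by norm_num),
      Real.mul_rpow (by norm_num) hρ0.le] at h2
    rw [le_div_iff₀ (by positivity)] at h1 ⊢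
    have h4 : (4 : ℝ) ^ θ = 2 ^ θ * 2 ^ θ := by
      rw [← Real.mul_rpow (by norm_num) (by norm_num)]; norm_num
    have h5 : η ^ T = η ^ φ * η ^ θ := by rw [← Real.rpow_add hh, ← hθT, add_comm]
    have h6 : η ^ θ * u c ^ (p - 1) ≤ 2 ^ θ * 2 ^ θ * ρ ^ θ * v ^ (p - 1) := by
      have h7 : (0 : ℝ) < 2 ^ θ := by positivity
      rw [div_mul_eq_mul_div, div_le_iff₀ h7] at h2
      linarith
    calc η ^ T * u c ^ (p - 1) * (2 * Λ)
        = (2 * Λ * η ^ φ) * (η ^ θ * u c ^ (p - 1)) := by rw [h5]; ring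
      _ ≤ (2 * Λ * η ^ φ) * (2 ^ θ * 2 ^ θ * ρ ^ θ * v ^ (p - 1)) := by gcongr
      _ = 4 ^ θ * (ρ ^ θ * (2 * A)) := by rw [h4, hA]; ring
      _ ≤ 4 ^ θ * 1 := by gcongr
      _ = 4 ^ θ := mul_one _
  exfalso
  refine absurd hint (not_lt.2 ?_)
  set f : EuclideanSpace ℝ (Fin (d + 1)) → ℝ≥0∞ := fun y => U y ^ p with hf
  have hfm : Measurable f := h.meas_pow p
  set S := ball x₀ σ with hS
  have hSm : MeasurableSet S := measurableSet_ball
  have hSρ : S ⊆ ball x₀ ρ := ball_subset_ball hρσ.le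
  -- the part of the potential coming from `S` is at most half of the value
  have hlocal : C * pot a₁ b₁ (pot a₂ b₂ (S.indicator f)) x₀ ≤ ENNReal.ofReal (v / 2) := by
    have h1 : ∀ y, S.indicator f y ≤ ENNReal.ofReal ((2 ^ γ * v) ^ p) * S.indicator 1 y := by
      intro y
      by_cases hy : y ∈ S
      · rw [indicator_of_mem hy, indicator_of_mem hy, Pi.one_apply, mul_one, hf]
        change U y ^ p ≤ _
        rw [hUu y, ENNReal.ofReal_rpow_of_nonneg (hu0 y) (by linarith)]
        exact ENNReal.ofReal_le_ofReal (Real.rpow_le_rpow (hu0 y) (hdoub y (hSρ hy)) (by linarith))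
      · simp [hy]
    have h2 : pot a₁ b₁ (pot a₂ b₂ (S.indicator f)) x₀ ≤ ENNReal.ofReal ((2 ^ γ * v) ^ p) *
        pot a₁ b₁ (pot a₂ b₂ (S.indicator 1)) x₀ := by
      rw [← pot_const_mul ENNReal.ofReal_ne_top]
      refine pot_mono (fun z _ => ?_) x₀
      rw [← pot_const_mul ENNReal.ofReal_ne_top]
      exact pot_mono (fun y _ => h1 y) z
    have h3 := Hb x₀ σ (2 * η) hσ0 (by positivity) fun y hy => hx₀le y (hSρ hy)
    calc _ ≤ ENNReal.ofReal k * (ENNReal.ofReal ((2 ^ γ * v) ^ p) *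
          ENNReal.ofReal (Cb * (2 * η) ^ φ * σ ^ θ)) := by
          rw [hCk]
          gcongr
          exact h2.trans (mul_le_mul_right h3 _)
      _ = ENNReal.ofReal (v / 2) := by
          rw [← ENNReal.ofReal_mul (by positivity), ← ENNReal.ofReal_mul hk0.le]
          congr 1
          rw [hσθ, Real.mul_rpow (by positivity) hux₀.le, Real.mul_rpow (by norm_num) hh.le]
          have e : v ^ p = v ^ (p - 1) * v := by
            rw [← Real.rpow_add_one hux₀.ne', sub_add_cancel]
          calc _ = A * v * (1 / (2 * A)) := by rw [hA, hΛ, e]; ring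
            _ = v / 2 := by field_simp
  have hfar : ENNReal.ofReal (v / 2) ≤ C * pot a₁ b₁ (pot a₂ b₂ (Sᶜ.indicator f)) x₀ := by
    have h1 : U x₀ = C * pot a₁ b₁ (pot a₂ b₂ (S.indicator f)) x₀
        + C * pot a₁ b₁ (pot a₂ b₂ (Sᶜ.indicator f)) x₀ := by
      have hx₀u : x₀ ∈ upper d := by
        change 0 < x₀ (Fin.last d)
        linarith
      rw [h.eq x₀ hx₀u, ← mul_add, ← pot_add (measurable_pot (hfm.indicator hSm))]
      congr 2
      funext z
      rw [← pot_add (hfm.indicator hSm)]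
      congr 1
      exact (indicator_self_add_compl S f).symm
    rw [hUu, show u x₀ = v / 2 + v / 2 by rw [← hvdef]; ring,
      ENNReal.ofReal_add (by positivity) (by positivity)] at h1
    by_contra hcon
    exact absurd h1 (ENNReal.add_lt_add_of_le_of_lt
      (ne_top_of_le_ne_top ENNReal.ofReal_ne_top hlocal) hlocal (not_le.1 hcon)).ne'
  have hharn : ∀ x' ∈ ball x₀ (σ / 4), ENNReal.ofReal (v / (2 * Ch)) ≤ U x' := by
    intro x' hx'
    have hx'u : x' ∈ upper d := by
      have := abs_lt.1 (last_le_of_mem_ball hx')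
      change 0 < x' (Fin.last d)
      linarith
    have h1 := Hh x₀ x' σ hσ0 (by linarith) hx' (Sᶜ.indicator f) (hfm.indicator hSm.compl)
      fun y hy => indicator_of_notMem (not_not.2 hy) _
    have h2 : C * pot a₁ b₁ (pot a₂ b₂ (Sᶜ.indicator f)) x' ≤ U x' := by
      rw [h.eq x' hx'u]
      gcongr
      refine pot_mono (fun z _ => pot_mono (fun y _ => ?_) z) x'
      exact indicator_le_self _ _ _
    have h3 : ENNReal.ofReal (v / 2) ≤ ENNReal.ofReal Ch * U x' := by
      refine hfar.trans ((mul_le_mul_right h1 C).trans ?_)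
      rw [mul_left_comm]
      exact mul_le_mul_right h2 _
    rw [hUu, ← ENNReal.ofReal_mul hCh.le] at h3
    rw [hUu]
    have h4 := (ENNReal.ofReal_le_ofReal_iff (mul_nonneg hCh.le (hu0 x'))).1 h3
    refine ENNReal.ofReal_le_ofReal ?_
    rw [div_le_iff₀ (by positivity)]
    linarith
  have hsub : ball x₀ (σ / 4) ⊆ ball c (η / 2) := by
    intro y hy
    rw [mem_ball] at hy ⊢
    have := dist_triangle y x₀ c
    linarith
  set L := v / (2 * Ch) with hL
  have hL0 : 0 < L := by positivity
  have hmass : ENNReal.ofReal (L ^ p * ((σ / 4) ^ n * unitVol d))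
      ≤ ∫⁻ y in ball c (η / 2), f y := by
    calc _ = ∫⁻ _ in ball x₀ (σ / 4), ENNReal.ofReal (L ^ p) := by
          rw [setLIntegral_const, volume_ball_eq_ofReal x₀ (by positivity),
            ENNReal.ofReal_mul (by positivity)]
      _ ≤ ∫⁻ y in ball x₀ (σ / 4), f y := by
          refine setLIntegral_mono' measurableSet_ball fun y hy => ?_
          rw [← ENNReal.ofReal_rpow_of_pos hL0]
          exact ENNReal.rpow_le_rpow (hharn y hy) (by linarith)
      _ ≤ _ := lintegral_mono_set hsub
  set W := κ * (η ^ T * (σ / η) ^ n * v ^ p) with hW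
  have hW0 : 0 < W := by positivity
  have hWle : ∀ x ∈ ball c (η / 2), ENNReal.ofReal W ≤ U x := by
    intro x hx
    rw [h.eq x (hballu (ball_subset_closedBall hx))]
    refine le_trans ?_ (mul_le_mul_right ((mul_le_mul_right hmass _).trans (Hl c hc x hx f hfm)) C)
    rw [hCk, ← ENNReal.ofReal_mul (by positivity), ← ENNReal.ofReal_mul hk0.le]
    refine ENNReal.ofReal_le_ofReal (le_of_eq ?_)
    have e1 : n + 2 * (a₁ - b₁) + 2 * (a₂ - b₂) = T - n := by rw [hT, hβ₁]; ring
    rw [← hη, e1, hW, hκ, hL, Real.rpow_sub hh, Real.div_rpow hσ0.le hh.le,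
      Real.div_rpow hσ0.le (by norm_num), Real.div_rpow hux₀.le (by positivity),
      Real.div_rpow one_pos.le (by positivity), Real.one_rpow]
    ring
  have hscale := scaling_lower_bound (X := σ / η) (p := p) (θ := θ) hh hux₀ (by positivity)
    ((div_le_one hh).2 (by linarith)) hΛ0 hκ0 hT0 hs hn0 hθp (by
      rw [Real.div_rpow hσ0.le hh.le, hσθ, ← hθT, Real.rpow_add hh, hA]
      field_simp)
  rw [← hW] at hscale
  calc _ ≤ ENNReal.ofReal (W ^ s * η ^ n * (unitVol d / 2 ^ n)) :=
        ENNReal.ofReal_le_ofReal (mul_le_mul_of_nonneg_right hscale (by positivity))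
    _ = ∫⁻ _ in ball c (η / 2), ENNReal.ofReal (W ^ s) := by
        rw [setLIntegral_const, volume_ball_eq_ofReal c (by positivity),
          ← ENNReal.ofReal_mul (by positivity), ← hn, Real.div_rpow hh.le (by norm_num)]
        congr 1
        ring
    _ ≤ _ := by
        refine setLIntegral_mono' measurableSet_ball fun y hy => ?_
        rw [← ENNReal.ofReal_rpow_of_pos hW0]
        exact ENNReal.rpow_le_rpow (hWle y hy) hs0.le

end IsPotSol

end InteriorBound

end HalfSpace

namespace HalfSpace

/-! ### From the interior estimate to the vanishing of solutions -/

section Liouville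

open Filter Topology Metric

variable {d : ℕ}

lemma norm_single_last (R : ℝ) :
    ‖(EuclideanSpace.single (Fin.last d) R : EuclideanSpace ℝ (Fin (d + 1)))‖ = |R| := by
  rw [PiLp.norm_single, Real.norm_eq_abs]

namespace IsPotSol

variable {a₁ b₁ a₂ b₂ p s : ℝ} {C : ℝ≥0∞} {U : EuclideanSpace ℝ (Fin (d + 1)) → ℝ≥0∞}

/-- Each point of the half-space eventually leaves these sets, and U vanishes elsewhere. This gives
small local mass near the boundary and near infinity. -/
lemma tendsto_outer (h : IsPotSol a₁ b₁ a₂ b₂ p s C U) (hs : 0 < s) :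
    Tendsto (fun j : ℕ => ∫⁻ x in {x : EuclideanSpace ℝ (Fin (d + 1)) |
      x (Fin.last d) < 1 / ((j : ℝ) + 1) ∨ (j : ℝ) < ‖x‖}, U x ^ s) atTop (𝓝 0) := by
  have hm : ∀ j : ℕ, MeasurableSet {x : EuclideanSpace ℝ (Fin (d + 1)) |
      x (Fin.last d) < 1 / ((j : ℝ) + 1) ∨ (j : ℝ) < ‖x‖} := fun j =>
    MeasurableSet.union 
      (s₁ := {x : EuclideanSpace ℝ (Fin (d + 1)) | x (Fin.last d) < 1 / ((j : ℝ) + 1)})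
      (s₂ := {x | (j : ℝ) < ‖x‖})
      (measurableSet_lt (by fun_prop) measurable_const)
      (measurableSet_lt measurable_const (by fun_prop))
  have hlim : Tendsto (fun j : ℕ => ∫⁻ x, {x : EuclideanSpace ℝ (Fin (d + 1)) |
      x (Fin.last d) < 1 / ((j : ℝ) + 1) ∨ (j : ℝ) < ‖x‖}.indicator (fun x => U x ^ s) x) atTop
      (𝓝 (∫⁻ _ : EuclideanSpace ℝ (Fin (d + 1)), 0)) := by
    refine tendsto_lintegral_of_dominated_convergence (fun x => U x ^ s)
      (fun j => (h.meas_pow s).indicator (hm j))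
      (fun j => Eventually.of_forall fun y => indicator_le_self _ _ _) h.int ?_
    refine Eventually.of_forall fun x => tendsto_const_nhds.congr' ?_
    by_cases hx : x ∈ upper d
    · have hx' : 0 < x (Fin.last d) := hx
      filter_upwards [(tendsto_one_div_add_atTop_nhds_zero_nat (𝕜 := ℝ)).eventually_lt_const hx',
        tendsto_natCast_atTop_atTop.eventually_ge_atTop ‖x‖] with j h1 h2
      rw [indicator_of_notMem]
      rintro (h3 | h3)
      · exact absurd h1 (not_lt.2 h3.le)
      · exact absurd h3 (not_lt.2 h2)
    · refine Eventually.of_forall fun j => ?_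
      refine (indicator_apply_eq_zero.2 fun _ => ?_).symm
      rw [h.off x hx, ENNReal.zero_rpow_of_pos hs]
  rw [lintegral_zero] at hlim
  exact hlim.congr fun j => lintegral_indicator (hm j) _

/-- The interior estimate `xₙ^T U^(p-1) ≤ K`. -/
lemma exists_bound (h : IsPotSol a₁ b₁ a₂ b₂ p s C U) (ha₁ : 0 < a₁)
    (hab₁ : a₁ < b₁) (ha₂ : 0 < a₂) (hab₂ : a₂ < b₂) {β₁ T φ θ : ℝ} (hβ₁0 : 0 < β₁)
    (hβ₁ : β₁ = ((d + 1 : ℕ) : ℝ) + 2 * (a₁ - b₁))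
    (hT : T = β₁ + (((d + 1 : ℕ) : ℝ) + 2 * (a₂ - b₂))) (hφ0 : 0 ≤ φ) (hφ : φ ≤ a₂)
    (hθβ : β₁ < θ) (hθn : θ < ((d + 1 : ℕ) : ℝ)) (hθT : θ + φ = T) (hp : 1 < p)
    (hs : s = ((d + 1 : ℕ) : ℝ) * (p - 1) / T)
    (hθp : (((d + 1 : ℕ) : ℝ) - θ) * (p - 1) ≤ θ) (hC0 : C ≠ 0) (hC : C ≠ ∞) :
    ∃ K : ℝ, ∀ c ∈ upper d, c (Fin.last d) ^ T * (U c).toReal ^ (p - 1) ≤ K := by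
  obtain ⟨K, ε, hε, H⟩ := h.exists_bound_of_setLIntegral_lt ha₁ hab₁ ha₂ hab₂ hβ₁0 hβ₁ hT hφ0 hφ
    hθβ hθn hθT hp hs hθp hC0 hC
  have hT0 : 0 < T := by linarith
  have hp1 : 0 < p - 1 := by linarith
  have hs0 : 0 < s := by rw [hs]; positivity
  obtain ⟨j, hj⟩ := ((h.tendsto_outer hs0).eventually_lt_const (ENNReal.ofReal_pos.2 hε)).exists
  set δ : ℝ := 1 / ((j : ℝ) + 1) with hδ
  have hδ0 : 0 < δ := by positivity
  -- On this compact set continuity gives the bound. For c in the half-space outside it, the ball of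
  -- radius cₙ/2 lies in the region of small mass: either cₙ < δ/2, or ‖c‖ > 2j and the ball stays
  -- beyond norm j.
  set S : Set (EuclideanSpace ℝ (Fin (d + 1))) :=
    closedBall 0 (2 * j) ∩ {x | δ / 2 ≤ x (Fin.last d)} with hS
  have hSc : IsCompact S := (isCompact_closedBall _ _).inter_right
    (isClosed_le continuous_const (by fun_prop))
  have hSu : S ⊆ upper d := fun x hx => (half_pos hδ0).trans_le hx.2
  have hcont : ContinuousOn (fun x => x (Fin.last d) ^ T * (U x).toReal ^ (p - 1)) S := by
    refine ContinuousOn.mul (ContinuousOn.rpow_const (Continuous.continuousOn (by fun_prop))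
      fun x _ => Or.inr hT0.le) (ContinuousOn.rpow_const (fun x hx => ?_) fun x _ => Or.inr hp1.le)
    exact (ENNReal.tendsto_toReal (h.fin x)).comp ((h.cont x (hSu hx)).mono hSu)
  obtain ⟨K', hK'⟩ := hSc.bddAbove_image hcont
  refine ⟨max K K', fun c hc => ?_⟩
  have hc0 : 0 < c (Fin.last d) := hc
  by_cases hcS : c ∈ S
  · exact (hK' (mem_image_of_mem _ hcS)).trans (le_max_right _ _)
  refine (H c hc ((lintegral_mono_set fun x hx => ?_).trans_lt hj)).trans (le_max_left _ _)
  have hx1 := abs_lt.1 (last_le_of_mem_ball hx)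
  by_cases h1 : δ / 2 ≤ c (Fin.last d)
  · right
    have h2 : 2 * (j : ℝ) < ‖c‖ := by
      by_contra hcon
      exact hcS ⟨mem_closedBall_zero_iff.2 (not_lt.1 hcon), h1⟩
    have h3 : c (Fin.last d) ≤ ‖c‖ := (le_abs_self _).trans (by
      simpa using abs_last_sub_le c 0)
    have h4 : ‖x - c‖ < c (Fin.last d) / 2 := by rwa [mem_ball, dist_eq_norm] at hx
    have h5 := norm_sub_norm_le c x
    rw [norm_sub_rev] at h5
    linarith
  · left
    linarith

/-- A nontrivial solution is bounded below by a power of `xₙ` in a cone around the normal axis,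
which is incompatible with integrability for small exponents. -/
lemma eq_zero_of_le (h : IsPotSol a₁ b₁ a₂ b₂ p s C U) (ha₁ : 0 < a₁)
    (hab₁ : a₁ < b₁) (ha₂ : 0 < a₂) (hab₂ : a₂ < b₂) (hs : 0 < s) (hC0 : C ≠ 0) (hC : C ≠ ∞)
    (hsn : 0 ≤ s * (((d + 1 : ℕ) : ℝ) + 2 * (a₁ - b₁) + (a₂ - 2 * b₂)) + ((d + 1 : ℕ) : ℝ)) :
    ∀ x ∈ upper d, U x = 0 := by
  intro y₀ hy₀
  by_contra hUy₀
  have hUpos := (h.pos ha₁ hab₁ ha₂ hab₂ hC0 hy₀ hUy₀).2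
  set n : ℝ := ((d + 1 : ℕ) : ℝ) with hn
  have hn0 : 0 < n := by rw [hn]; positivity
  have hv := unitVol_pos (d := d)
  -- R^(a₂-2b₂) is the size of the inner kernel between a fixed ball and points near R·eₙ;
  -- integrating the outer kernel over a ball of radius R/4 adds R^(n+2(a₁-b₁)).
  set κ := n + 2 * (a₁ - b₁) + (a₂ - 2 * b₂) with hκ
  have hy₀' : 0 < y₀ (Fin.last d) := hy₀
  set k := y₀ (Fin.last d) / 2 with hk
  have hk0 : 0 < k := half_pos hy₀'
  have hlast : ∀ y ∈ ball y₀ k, k < y (Fin.last d) := by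
    intro y hy
    have := abs_lt.1 (last_le_of_mem_ball hy)
    linarith
  have hsub : ball y₀ k ⊆ upper d := fun y hy => hk0.trans (hlast y hy)
  have hJ : ∫⁻ y in ball y₀ k, U y ^ p ≠ 0 := by
    refine ((setLIntegral_pos_iff (h.meas_pow p)).2 ?_).ne'
    refine (measure_ball_pos volume y₀ hk0).trans_le (measure_mono fun y hy => ⟨?_, hy⟩)
    exact (ENNReal.rpow_pos (hUpos y (hsub hy)) (h.fin y)).ne'
  obtain ⟨J, hJ0, hJle⟩ : ∃ J : ℝ, 0 < J ∧ ENNReal.ofReal J ≤ ∫⁻ y in ball y₀ k, U y ^ p := by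
    obtain ⟨J, h1, h2⟩ := ENNReal.lt_iff_exists_nnreal_btwn.1 (pos_iff_ne_zero.2 hJ)
    refine ⟨J, by exact_mod_cast h1, ?_⟩
    rw [ENNReal.ofReal_coe_nnreal]
    exact h2.le
  set c := C.toReal with hc
  have hc0 : 0 < c := ENNReal.toReal_pos hC0 hC
  have hCc : C = ENNReal.ofReal c := (ENNReal.ofReal_toReal hC).symm
  set c₁ : ℝ := 2 ^ (-b₁) / a₁ with hc₁
  have hc₁0 : 0 < c₁ := by positivity
  set c₂ : ℝ := k ^ a₂ * (4 + k) ^ (-b₂) / a₂ with hc₂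
  have hc₂0 : 0 < c₂ := by positivity
  set Γ := c * (c₁ * (c₂ * J) * (unitVol d / 4 ^ n)) with hΓ
  have hΓ0 : 0 < Γ := by positivity
  have key : ∀ R : ℝ, 1 ≤ R → 4 * (‖y₀‖ + k) ≤ R →
      ENNReal.ofReal (Γ ^ s * (unitVol d / 4 ^ n))
        ≤ ∫⁻ x in {x : EuclideanSpace ℝ (Fin (d + 1)) | R / 2 < x (Fin.last d)}, U x ^ s := by
    intro R hR1 hR
    have hR0 : 0 < R := by linarith
    set e : EuclideanSpace ℝ (Fin (d + 1)) := EuclideanSpace.single (Fin.last d) R with he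
    have he1 : e (Fin.last d) = R := by simp [he]
    have hen : ‖e‖ = R := by rw [he, norm_single_last, abs_of_pos hR0]
    set B := ball e (R / 4) with hB
    have hBm : MeasurableSet B := measurableSet_ball
    have hBlast : ∀ z ∈ B, R / 2 < z (Fin.last d) := by
      intro z hz
      have := abs_lt.1 (last_le_of_mem_ball hz)
      linarith
    have hBu : B ⊆ upper d := fun z hz => (half_pos hR0).trans (hBlast z hz)
    have hvolB : volume B = ENNReal.ofReal (R ^ n * (unitVol d / 4 ^ n)) := by
      rw [hB, volume_ball_eq_ofReal e (by positivity), ← hn, Real.div_rpow hR0.le (by norm_num)]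
      congr 1
      ring
    have h2 : ∀ z ∈ B, ENNReal.ofReal (c₂ * R ^ (a₂ - 2 * b₂) * J)
        ≤ pot a₂ b₂ (fun y => U y ^ p) z := by
      intro z hz
      have hz' := hBlast z hz
      calc _ ≤ ENNReal.ofReal (c₂ * R ^ (a₂ - 2 * b₂)) * ∫⁻ y in ball y₀ k, U y ^ p := by
            rw [ENNReal.ofReal_mul (by positivity)]
            gcongr
        _ = ∫⁻ y in ball y₀ k, ENNReal.ofReal (c₂ * R ^ (a₂ - 2 * b₂)) * U y ^ p :=
            (lintegral_const_mul _ (h.meas_pow p)).symm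
        _ ≤ ∫⁻ y in ball y₀ k, kern a₂ b₂ z y * U y ^ p := by
            refine setLIntegral_mono' measurableSet_ball fun y hy => ?_
            gcongr
            have hyl := hlast y hy
            have hd : ‖z - y‖ ≤ 2 * R := by
              rw [mem_ball, dist_eq_norm] at hy
              rw [hB, mem_ball, dist_eq_norm] at hz
              have e1 : z - y = (z - e) + e - (y - y₀) - y₀ := by abel
              rw [e1]
              have i1 := norm_sub_le ((z - e) + e - (y - y₀)) y₀
              have i2 := norm_sub_le ((z - e) + e) (y - y₀)
              have i3 := norm_add_le (z - e) e
              linarith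
            have h3 : profile a₂ b₂ ((2 * R) ^ 2) (k * R) ≤ kern a₂ b₂ z y := by
              refine profile_mono (by linarith) (by positivity) (by gcongr) ?_
              nlinarith [mul_lt_mul'' hz' hyl (by positivity) (by positivity), mul_pos hk0 hR0]
            refine le_trans ?_ ((le_profile ha₂ (by linarith) (by positivity)
              (by positivity)).trans h3)
            refine ENNReal.ofReal_le_ofReal ?_
            have h4 : ((4 + k) * R ^ 2) ^ (-b₂) ≤ ((2 * R) ^ 2 + k * R) ^ (-b₂) := by
              refine Real.rpow_le_rpow_of_nonpos (by positivity) ?_ (by linarith)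
              nlinarith [mul_nonneg hk0.le (mul_nonneg hR0.le (sub_nonneg.2 hR1))]
            have h5 : (R ^ 2) ^ (-b₂) = R ^ (-2 * b₂) := by
              rw [← Real.rpow_natCast, ← Real.rpow_mul hR0.le]
              congr 1
              push_cast
              ring
            rw [Real.mul_rpow (by positivity) (by positivity), h5] at h4
            rw [Real.mul_rpow hk0.le hR0.le, hc₂, sub_eq_add_neg, Real.rpow_add hR0, ← neg_mul]
            calc _ = k ^ a₂ * R ^ a₂ * ((4 + k) ^ (-b₂) * R ^ (-2 * b₂)) / a₂ := by ring
              _ ≤ _ := by gcongr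
        _ ≤ _ := lintegral_mono_set hsub
    have h1 : ∀ x ∈ B, ENNReal.ofReal (Γ * R ^ κ) ≤ U x := by
      intro x hx
      rw [h.eq x (hBu hx), hCc]
      calc _ = ENNReal.ofReal c * ∫⁻ z in B, ENNReal.ofReal (c₁ * R ^ (2 * (a₁ - b₁))) *
            ENNReal.ofReal (c₂ * R ^ (a₂ - 2 * b₂) * J) := by
            rw [setLIntegral_const, hvolB, ← ENNReal.ofReal_mul (by positivity),
              ← ENNReal.ofReal_mul (by positivity), ← ENNReal.ofReal_mul hc0.le]
            congr 1
            rw [hκ, Real.rpow_add hR0, Real.rpow_add hR0, hΓ]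
            ring
        _ ≤ ENNReal.ofReal c * ∫⁻ z in B, kern a₁ b₁ x z * pot a₂ b₂ (fun y => U y ^ p) z := by
            refine mul_le_mul_right (setLIntegral_mono' hBm fun z hz =>
              mul_le_mul' ?_ (h2 z hz)) _
            refine le_kern ha₁ (by linarith) hR0 ?_ (hBlast x hx).le (hBlast z hz).le
            rw [← dist_eq_norm]
            have i1 := mem_ball.1 hx
            have i2 := mem_ball.1 hz
            have := dist_triangle_right x z e
            linarith
        _ ≤ _ := by
            gcongr
            exact lintegral_mono_set hBu
    calc _ ≤ ENNReal.ofReal ((Γ * R ^ κ) ^ s * (R ^ n * (unitVol d / 4 ^ n))) := by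
          refine ENNReal.ofReal_le_ofReal ?_
          rw [Real.mul_rpow hΓ0.le (by positivity), ← Real.rpow_mul hR0.le]
          have : (1 : ℝ) ≤ R ^ (κ * s) * R ^ n := by
            rw [← Real.rpow_add hR0]
            exact Real.one_le_rpow hR1 (by rwa [mul_comm κ])
          calc _ = Γ ^ s * 1 * (unitVol d / 4 ^ n) := by ring
            _ ≤ Γ ^ s * (R ^ (κ * s) * R ^ n) * (unitVol d / 4 ^ n) := by gcongr
            _ = _ := by ring
      _ = ∫⁻ _ in B, ENNReal.ofReal ((Γ * R ^ κ) ^ s) := by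
          rw [setLIntegral_const, hvolB, ← ENNReal.ofReal_mul (by positivity)]
      _ ≤ ∫⁻ x in B, U x ^ s := by
          refine setLIntegral_mono' hBm fun x hx => ?_
          rw [← ENNReal.ofReal_rpow_of_pos (by positivity)]
          exact ENNReal.rpow_le_rpow (h1 x hx) hs.le
      _ ≤ _ := lintegral_mono_set hBlast
  have hlim := h.tendsto_tail.comp (tendsto_id.atTop_div_const (two_pos : (0 : ℝ) < 2))
  have hle := ge_of_tendsto hlim (((eventually_ge_atTop 1).and
    (eventually_ge_atTop (4 * (‖y₀‖ + k)))).mono fun R hR => key R hR.1 hR.2)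
  exact absurd hle (not_le.2 (ENNReal.ofReal_pos.2 (by positivity)))

/-- With V = U^(p-1), factor yₙ^φ V = (yₙ^T V)^(φ/T) · V^(θ/T). The first factor is bounded by the
interior estimate, and the n/θ power of the second is U^s. -/
lemma lintegral_weighted_ne_top (h : IsPotSol a₁ b₁ a₂ b₂ p s C U) {φ θ T K : ℝ}
    (hφ0 : 0 ≤ φ) (hθ0 : 0 < θ) (hT : θ + φ = T) (hp : 1 < p)
    (hs : s = ((d + 1 : ℕ) : ℝ) * (p - 1) / T)
    (hK : ∀ c ∈ upper d, c (Fin.last d) ^ T * (U c).toReal ^ (p - 1) ≤ K) :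
    ∫⁻ y, (ENNReal.ofReal (y (Fin.last d)) ^ φ * U y ^ (p - 1)) ^ (((d + 1 : ℕ) : ℝ) / θ) ≠ ∞ := by
  set n : ℝ := ((d + 1 : ℕ) : ℝ) with hn
  have hn0 : 0 < n := by rw [hn]; positivity
  have hT0 : 0 < T := by linarith
  have hp1 : 0 < p - 1 := by linarith
  have hq : 0 < n / θ := by positivity
  set M : ℝ≥0∞ := (ENNReal.ofReal K ^ (φ / T)) ^ (n / θ) with hM
  have hMfin : M ≠ ∞ := ENNReal.rpow_ne_top_of_nonneg hq.le
    (ENNReal.rpow_ne_top_of_nonneg (by positivity) ENNReal.ofReal_ne_top)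
  refine ne_top_of_le_ne_top (ENNReal.mul_ne_top hMfin h.int) ?_
  rw [← lintegral_const_mul' _ _ hMfin]
  refine lintegral_mono fun y => ?_
  change _ ≤ M * U y ^ s
  by_cases hy : y ∈ upper d
  swap
  · rw [h.off y hy, ENNReal.zero_rpow_of_pos hp1, mul_zero, ENNReal.zero_rpow_of_pos hq]
    exact zero_le
  have hy' : 0 < y (Fin.last d) := hy
  set V := U y ^ (p - 1) with hV
  have hVK : ENNReal.ofReal (y (Fin.last d)) ^ T * V ≤ ENNReal.ofReal K := by
    rw [hV, ← ENNReal.ofReal_toReal (h.fin y),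
      ENNReal.ofReal_rpow_of_nonneg ENNReal.toReal_nonneg hp1.le, ENNReal.ofReal_rpow_of_pos hy',
      ← ENNReal.ofReal_mul (by positivity)]
    exact ENNReal.ofReal_le_ofReal (hK y hy)
  have e1 : V = V ^ (φ / T) * V ^ (θ / T) := by
    rw [← ENNReal.rpow_add_of_nonneg _ _ (by positivity) (by positivity), ← add_div, add_comm φ,
      hT, div_self hT0.ne', ENNReal.rpow_one]
  have e2 : ENNReal.ofReal (y (Fin.last d)) ^ φ * V
      = (ENNReal.ofReal (y (Fin.last d)) ^ T * V) ^ (φ / T) * V ^ (θ / T) := by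
    rw [ENNReal.mul_rpow_of_nonneg _ _ (by positivity), ← ENNReal.rpow_mul,
      mul_div_cancel₀ _ hT0.ne', mul_assoc, ← e1]
  have e3 : (V ^ (θ / T)) ^ (n / θ) = U y ^ s := by
    have : (p - 1) * (θ / T) * (n / θ) = s := by
      rw [hs]
      field_simp
    rw [hV, ← ENNReal.rpow_mul, ← ENNReal.rpow_mul, ← mul_assoc, this]
  rw [e2, ENNReal.mul_rpow_of_nonneg _ _ hq.le, e3, hM]
  gcongr

theorem eq_zero (h : IsPotSol a₁ b₁ a₂ b₂ p s C U) (ha₁ : 0 < a₁) (hab₁ : a₁ < b₁)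
    (ha₂ : 0 < a₂) (hab₂ : a₂ < b₂) {T : ℝ} (hβ₁ : 0 < ((d + 1 : ℕ) : ℝ) + 2 * (a₁ - b₁))
    (hβ₂ : a₂ < ((d + 1 : ℕ) : ℝ) + 2 * (a₂ - b₂))
    (hT : T = ((d + 1 : ℕ) : ℝ) + 2 * (a₁ - b₁) + (((d + 1 : ℕ) : ℝ) + 2 * (a₂ - b₂)))
    (hTn : T - a₂ < ((d + 1 : ℕ) : ℝ)) (hp : 1 < p)
    (hs : s = ((d + 1 : ℕ) : ℝ) * (p - 1) / T) (hC0 : C ≠ 0) (hC : C ≠ ∞) :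
    ∀ x ∈ upper d, U x = 0 := by
  set n : ℝ := ((d + 1 : ℕ) : ℝ) with hn
  have hn0 : 0 < n := by rw [hn]; positivity
  have hT0 : 0 < T := by linarith
  have hp1 : 0 < p - 1 := by linarith
  have hp0 : 0 < p := by linarith
  have hs0 : 0 < s := by rw [hs]; positivity
  -- For n < p(n-T) no weight is needed: 1/s + T/n = Tp/(n(p-1)) < 1, and (U^(p-1))^(n/T) = U^s.
  rcases lt_or_ge n (p * (n - T)) with hcase | hcase
  · refine h.eq_zero_of_weighted ha₁ hab₁ ha₂ hab₂ (φ := 0) (β₁ := n + 2 * (a₁ - b₁))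
      (β₂ := n + 2 * (a₂ - b₂) - 0) le_rfl ha₂.le hβ₁ (by linarith) rfl rfl hs0 ?_ hp hC0 hC ?_
    · have e : 1 / s + (n + 2 * (a₁ - b₁) + (n + 2 * (a₂ - b₂) - 0)) / n
          = T * p / (n * (p - 1)) := by
        rw [sub_zero, ← hT, hs]
        field_simp
        ring
      rw [e, div_lt_one (by positivity)]
      linarith
    · have hle := h.int
      rw [sub_zero, ← hT]
      convert hle using 3 with y
      rw [ENNReal.rpow_zero, one_mul, ← ENNReal.rpow_mul, hs]
      congr 1
      ring
  -- The first alternative is exactly 1/s + (T-a₂)/n ≥ 1, where moving planes with the full weight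
  -- fail and the lower bound takes over.
  rcases le_or_gt 0 (s * (n + 2 * (a₁ - b₁) + (a₂ - 2 * b₂)) + n) with hserrin | hserrin
  · exact h.eq_zero_of_le ha₁ hab₁ ha₂ hab₂ hs0 hC0 hC hserrin
  -- The interior estimate needs φ = T - θ in [0, a₂] and (n-θ)(p-1) ≤ θ; this is the least such θ.
  -- Here p(n-T) ≤ n gives θ ≤ T. The moving planes below use the full weight a₂ instead.
  set θ := max (T - a₂) (n * (p - 1) / p) with hθ
  have hθ1 : T - a₂ ≤ θ := le_max_left _ _
  have hθ2 : n * (p - 1) ≤ θ * p := (div_le_iff₀ hp0).1 (le_max_right _ _)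
  have hθn : θ < n := max_lt hTn (by rw [div_lt_iff₀ hp0]; nlinarith)
  have hθT : θ ≤ T := max_le (by linarith) (by rw [div_le_iff₀ hp0]; linarith)
  obtain ⟨K, hK⟩ := h.exists_bound ha₁ hab₁ ha₂ hab₂ (T := T) (φ := T - θ) (θ := θ) hβ₁ rfl hT
    (by linarith) (by linarith) (by linarith) hθn (by ring) hp hs (by linarith) hC0 hC
  refine h.eq_zero_of_weighted ha₁ hab₁ ha₂ hab₂ (φ := a₂) (β₁ := n + 2 * (a₁ - b₁))
    (β₂ := n + 2 * (a₂ - b₂) - a₂) ha₂.le le_rfl hβ₁ (by linarith) rfl rfl hs0 ?_ hp hC0 hC ?_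
  · have e : 1 / s + (n + 2 * (a₁ - b₁) + (n + 2 * (a₂ - b₂) - a₂)) / n
        = 1 + (n + s * (n + 2 * (a₁ - b₁) + (a₂ - 2 * b₂))) / (s * n) := by
      field_simp
      ring
    rw [e]
    have : (n + s * (n + 2 * (a₁ - b₁) + (a₂ - 2 * b₂))) / (s * n) < 0 :=
      div_neg_of_neg_of_pos (by linarith) (by positivity)
    linarith
  · exact h.lintegral_weighted_ne_top ha₂.le (by linarith) (by rw [hT]; ring) hp hs hK

end IsPotSol

end Liouville

end HalfSpace

/-! ### Translation of the Green function equation and conclusion -/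

namespace HalfSpace

variable {d : ℕ}

/-- The constant in `greenPoly`, relative to `kern`. -/
noncomputable def polyConst (d m : ℕ) : ℝ :=
  Real.Gamma (((d + 1 : ℕ) : ℝ) / 2 - m) /
    (4 ^ m * Real.pi ^ (((d + 1 : ℕ) : ℝ) / 2) * Real.Gamma m) * (((d + 1 : ℕ) : ℝ) / 2 - m)

/-- The constant in `greenFrac`, relative to `kern`. -/
noncomputable def fracConst (d : ℕ) (α : ℝ) : ℝ :=
  Real.Gamma (((d + 1 : ℕ) : ℝ) / 2) /
    (2 ^ α * Real.pi ^ (((d + 1 : ℕ) : ℝ) / 2) * Real.Gamma (α / 2) ^ 2)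

lemma polyConst_pos {m : ℕ} (hm : 1 ≤ m) (hdim : 2 * m < d + 1) : 0 < polyConst d m := by
  have hν : 0 < ((d + 1 : ℕ) : ℝ) / 2 - m := by
    have : (2 * m : ℝ) < ((d + 1 : ℕ) : ℝ) := by exact_mod_cast hdim
    linarith
  have hm0 : (0 : ℝ) < m := by exact_mod_cast hm
  have h1 := Real.Gamma_pos_of_pos hν
  have h2 := Real.Gamma_pos_of_pos hm0
  rw [polyConst]
  positivity

lemma fracConst_pos {α : ℝ} (hα : 0 < α) : 0 < fracConst d α := by
  have h1 := Real.Gamma_pos_of_pos (show (0 : ℝ) < ((d + 1 : ℕ) : ℝ) / 2 by positivity)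
  have h2 := Real.Gamma_pos_of_pos (half_pos hα)
  rw [fracConst]
  positivity

/-- The identification with `kern` is available only off the diagonals, that is, away from the null
set z = x or z = y. -/
lemma green_eq {m : ℕ} (hdim : 2 * m < d + 1) {α : ℝ} (hα : 0 < α) (hαn : α < ((d + 1 : ℕ) : ℝ))
    {x y : EuclideanSpace ℝ (Fin (d + 1))} (hx : x ∈ upper d) (hy : y ∈ upper d) :
    green m α x y = ENNReal.ofReal (polyConst d m) * ENNReal.ofReal (fracConst d α) *
      ∫⁻ z in upper d, kern 1 (((d + 1 : ℕ) : ℝ) / 2 - m + 1) x z *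
        kern (α / 2) (((d + 1 : ℕ) : ℝ) / 2) z y := by
  rw [green, ← lintegral_const_mul' _ _ (ENNReal.mul_ne_top ENNReal.ofReal_ne_top
    ENNReal.ofReal_ne_top)]
  refine setLIntegral_congr_fun_ae isOpen_upper.measurableSet ?_
  filter_upwards [Measure.ae_ne volume x, Measure.ae_ne volume y] with z hzx hzy hz
  rw [ofReal_greenPoly hdim hx hz hzx.symm, ofReal_greenFrac hα hαn hz hy hzy, polyConst, fracConst]
  ring

/-- Tonelli's theorem for the composed kernel. -/
lemma lintegral_kern_kern {a₁ b₁ a₂ b₂ : ℝ} {f : EuclideanSpace ℝ (Fin (d + 1)) → ℝ≥0∞}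
    (hf : Measurable f) (x : EuclideanSpace ℝ (Fin (d + 1))) :
    ∫⁻ y in upper d, (∫⁻ z in upper d, kern a₁ b₁ x z * kern a₂ b₂ z y) * f y
      = pot a₁ b₁ (pot a₂ b₂ f) x := by
  have hk : Measurable (Function.uncurry (kern (d := d) a₂ b₂)) := HalfSpace.measurable_kern
  have hk1 := measurable_kern_left (a := a₁) (b := b₁) x
  have hm : Measurable fun q : EuclideanSpace ℝ (Fin (d + 1)) × EuclideanSpace ℝ (Fin (d + 1)) =>
      kern a₁ b₁ x q.2 * kern a₂ b₂ q.2 q.1 * f q.1 :=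
    ((hk1.comp measurable_snd).mul (hk.comp measurable_swap)).mul (hf.comp measurable_fst)
  calc _ = ∫⁻ y in upper d, ∫⁻ z in upper d, kern a₁ b₁ x z * kern a₂ b₂ z y * f y := by
        refine lintegral_congr fun y => (lintegral_mul_const _ ?_).symm
        exact hk1.mul (hk.comp (measurable_id.prodMk measurable_const))
    _ = ∫⁻ z in upper d, ∫⁻ y in upper d, kern a₁ b₁ x z * kern a₂ b₂ z y * f y :=
        lintegral_lintegral_swap hm.aemeasurable
    _ = _ := by
        refine lintegral_congr fun z => ?_
        rw [pot, ← lintegral_const_mul _ (measurable_kern_mul hf z)]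
        exact lintegral_congr fun y => mul_assoc _ _ _

lemma isPotSol_indicator {m : ℕ} (hdim : 2 * m < d + 1) {α : ℝ} (hα : 0 < α)
    (hαn : α < ((d + 1 : ℕ) : ℝ)) {p s : ℝ} (hp : 0 < p) (hs : 0 < s)
    {u : EuclideanSpace ℝ (Fin (d + 1)) → ℝ} (hcont : ContinuousOn u (upper d))
    (hLp : MemLp u (ENNReal.ofReal s) (volume.restrict (upper d)))
    (hnonneg : ∀ x ∈ upper d, 0 ≤ u x)
    (heq : ∀ x ∈ upper d, ENNReal.ofReal (u x)
      = ∫⁻ y in upper d, green m α x y * ENNReal.ofReal (u y ^ p)) :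
    IsPotSol 1 (((d + 1 : ℕ) : ℝ) / 2 - m + 1) (α / 2) (((d + 1 : ℕ) : ℝ) / 2) p s
      (ENNReal.ofReal (polyConst d m) * ENNReal.ofReal (fracConst d α))
      ((upper d).indicator fun x => ENNReal.ofReal (u x)) := by
  have hm := (isOpen_upper (d := d)).measurableSet
  have hc : ContinuousOn (fun x => ENNReal.ofReal (u x)) (upper d) :=
    ENNReal.continuous_ofReal.comp_continuousOn hcont
  have hmeas : Measurable ((upper d).indicator fun x => ENNReal.ofReal (u x)) := by
    classical
    rw [← piecewise_eq_indicator]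
    exact hc.measurable_piecewise continuousOn_const hm
  refine ⟨hmeas, fun x => ?_, fun x hx => indicator_of_notMem hx _,
    hc.congr fun x hx => indicator_of_mem hx _, ?_, fun x hx => ?_⟩
  · by_cases hx : x ∈ upper d
    · rw [indicator_of_mem hx]
      exact ENNReal.ofReal_ne_top
    · simp [hx]
  · have h1 := lintegral_rpow_enorm_lt_top_of_eLpNorm_lt_top (ENNReal.ofReal_pos.2 hs).ne'
      ENNReal.ofReal_ne_top hLp.2
    rw [ENNReal.toReal_ofReal hs.le] at h1
    refine ne_top_of_le_ne_top h1.ne (le_of_eq ?_)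
    rw [← lintegral_indicator hm]
    refine lintegral_congr fun x => ?_
    by_cases hx : x ∈ upper d
    · rw [indicator_of_mem hx, indicator_of_mem hx, Real.enorm_of_nonneg (hnonneg x hx)]
    · simp [hx, hs]
  · rw [indicator_of_mem hx, heq x hx, ← lintegral_kern_kern (hmeas.pow_const p) x,
      ← lintegral_const_mul' _ _ (ENNReal.mul_ne_top ENNReal.ofReal_ne_top ENNReal.ofReal_ne_top)]
    refine setLIntegral_congr_fun hm fun y hy => ?_
    rw [green_eq hdim hα hαn hx hy, indicator_of_mem hy,
      ENNReal.ofReal_rpow_of_nonneg (hnonneg y hy) hp.le, mul_assoc]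

end HalfSpace

theorem mainTheorem1 (d m : ℕ) (hm : 1 ≤ m) (hdim : 2 * m < d + 1)
    (α : ℝ) (hα0 : 0 < α) (hα2 : α < 2)
    (t : ℝ) (ht : t = m + α / 2)
    (p : ℝ) (hp : 1 < p)
    (u : EuclideanSpace ℝ (Fin (d + 1)) → ℝ)
    (hreg : HalfSpace.IsLocC1 (2 * m) u (HalfSpace.upper d))
    (hL : HalfSpace.MemWeightedL (2 * t) u)
    (hLp : MemLp u (ENNReal.ofReal (((d + 1 : ℕ) : ℝ) * (p - 1) / (2 * t)))
      (volume.restrict (HalfSpace.upper d)))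
    (hnonneg : ∀ x ∈ HalfSpace.upper d, 0 ≤ u x)
    (hlap : ∀ x ∈ HalfSpace.upper d, 0 ≤ HalfSpace.negLaplacianPow m u x)
    (heq : ∀ x ∈ HalfSpace.upper d,
      ENNReal.ofReal (u x) =
        ∫⁻ y in HalfSpace.upper d,
          HalfSpace.green m α x y * ENNReal.ofReal (u y ^ p)) :
    ∀ x ∈ HalfSpace.upper d, u x = 0 := by
  have hm0 : (1 : ℝ) ≤ m := by exact_mod_cast hm
  have hmn : (2 * m : ℝ) + 1 ≤ ((d + 1 : ℕ) : ℝ) := by exact_mod_cast hdim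
  have ht0 : 0 < t := by rw [ht]; linarith
  have hp1 : 0 < p - 1 := by linarith
  have h := HalfSpace.isPotSol_indicator hdim hα0 (by linarith) (by linarith : 0 < p)
    (by positivity : 0 < ((d + 1 : ℕ) : ℝ) * (p - 1) / (2 * t)) hreg.1.continuousOn hLp hnonneg heq
  intro x hx
  -- For these parameters n + 2(a₁-b₁) = 2m and n + 2(a₂-b₂) = α, so T = 2t. The requirement T - a₂
  -- < n reads 2m + α/2 < n and follows from 2m + 1 ≤ n and α < 2.
  have hx0 := h.eq_zero one_pos (by linarith) (half_pos hα0) (by linarith) (T := 2 * t)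
    (by linarith) (by linarith) (by rw [ht]; ring) (by rw [ht]; linarith) hp rfl
    (mul_ne_zero (ENNReal.ofReal_pos.2 (HalfSpace.polyConst_pos hm hdim)).ne'
      (ENNReal.ofReal_pos.2 (HalfSpace.fracConst_pos hα0)).ne')
    (ENNReal.mul_ne_top ENNReal.ofReal_ne_top ENNReal.ofReal_ne_top) x hx
  rw [indicator_of_mem hx, ENNReal.ofReal_eq_zero] at hx0
  exact le_antisymm hx0 (hnonneg x hx)
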